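/- **Setting.** Let $b\ge 2$ be an integer, $\beta,\lambda\ge 0$ and $h\in L^1([0,\beta])$ (real-valued). Let $\Sigma$ be the set of càdlàg functions $\sigma:[0,\beta]\to\{\pm1\}$ with the $\sigma$-algebra generated by the evaluations, and let $\varphi$ be the law on $\Sigma$ of the spin with uniform initial sign that flips at the points of an independent Poisson point process of intensity $\lambda$ on $[0,\beta]$. Write $f\bullet g=\int_0^\beta f(t)g(t)\,dt$. Let $\mathbb T$ be the infinite rooted tree in which every vertex has $b$ children; $r$ is its root, $y\sim z$ means that $y,z$ are neighbors, $|z-x|$ is the graph distance, and $\mathbb T_l$ is the subtree of vertices of depth at most $l$. For a finite set $A$ of vertices of $\mathbb T$ and $\tau\in\Sigma^{\mathbb T}$ let $\mu_A^\tau$ be the probability measure on $\Sigma^A$ given by $$\mu_A^\tau(d\sigma)=\frac1Z\exp\Big(\sum_{\{i,j\}\subset A,\ i\sim j}\sigma_i\bullet\sigma_j+\sum_{z\in A}\Big(h+\sum_{y\notin A,\ y\sim z}\tau_y\Big)\bullet\sigma_z\Big)\prod_{z\in A}\varphi(d\sigma_z),$$ and write $\mu_l^\tau=\mu_{\mathbb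 T_l}^\tau$. The symbols $+$ and $-$ denote the constant spins, and also the boundary conditions that are identically equal to them. - The parameters are in the *uniqueness regime* if $\lim_{l\to\infty}\|\mu_l^+(\sigma_r\in\cdot)-\mu_l^-(\sigma_r\in\cdot)\|_{TV}=0$. - $\gamma$ is the supremum of $\|\mu_A^{\eta}(\sigma_z\in\cdot)-\mu_A^{\bar\eta}(\sigma_z\in\cdot)\|_{TV}$ over all $l\ge0$, all $A\subset\mathbb T_l$, all vertices $y\notin A$ of $\mathbb T$ having a neighbor in $A$, all neighbors $z\in A$ of $y$, and all $\eta,\bar\eta\in\Sigma^{\mathbb T}$ that differ only at $y$. - For $\tau\in\Sigma^{\mathbb T}$, $\kappa(\tau)$ is the infimum of the $\kappa\ge0$ (with $\inf\emptyset=+\infty$) for which there is $l_0\ge0$ such that, for every vertex $x$, every $n\ge0$, the subtree $T$ consisting of $x$ and its descendants down to $n$ generations below $x$, and every $z\in T$ with $|z-x|\ge l_0$, $$\mu_T^\tau(\sigma_z\bullet 1\mid\sigma_x=+)-\mu_T^\tau(\sigma_z\bullet 1\mid\sigma_x=-)\le\kappa^{|z-x|}.$$ **Theorem 5.1 (Decay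 of correlations).** For all $b\ge2$, $\beta,\lambda\ge0$ and $h\in L^1([0,\beta])$: 1. $\kappa(+)\le 1/b$. 2. If $\beta,\lambda,h$ are in the uniqueness regime, then $\kappa(\tau)\le 1/b$ for every $\tau\in\Sigma^{\mathbb T}$. As a result, $\kappa(+)\,\gamma\, b<1$, and in the uniqueness regime $\kappa(\tau)\,\gamma\, b<1$ for every $\tau\in\Sigma^{\mathbb T}$. -/

import Mathlib

open MeasureTheory Filter Topology Set
open scoped ENNReal NNReal

noncomputable section

namespace QuantumIsing

/-! ### Single spins -/

/-- Lebesgue measure on the (imaginary) time interval `[0, β]`. -/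
def leb (β : ℝ) : Measure (Icc (0 : ℝ) β) := Measure.comap Subtype.val volume

/-- The set `Σ` of single spins: cadlag functions from `[0, β]` to `{1, -1}`. As a subtype of a
product of copies of `ℝ` it carries the `σ`-algebra generated by the evaluations
`σ ↦ σ t`, `t ∈ [0, β]`. -/
abbrev Spin (β : ℝ) : Type :=
  {σ : Icc (0 : ℝ) β → ℝ //
    (∀ t, σ t = 1 ∨ σ t = -1) ∧
      ∀ t, ContinuousWithinAt σ (Ici t) t ∧ ∃ a, Tendsto σ (𝓝[<] t) (𝓝 a)}

/-- The spin that is constantly equal to the sign `ε`. -/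
def Spin.const (β : ℝ) (ε : ℤˣ) : Spin β :=
  ⟨fun _ => ((ε : ℤ) : ℝ), fun _ => by rcases Int.units_eq_one_or ε with rfl | rfl <;> simp,
    fun _ => ⟨continuousWithinAt_const, _, tendsto_const_nhds⟩⟩

/-- The spin identically equal to `+`. -/
def Spin.plus (β : ℝ) : Spin β := Spin.const β 1

/-- The spin identically equal to `-`. -/
def Spin.minus (β : ℝ) : Spin β := Spin.const β (-1)

/-- The product `f • g = ∫_[0, β] f(t) g(t) dt`. -/
def dot {β : ℝ} (f g : Icc (0 : ℝ) β → ℝ) : ℝ := ∫ t, f t * g t ∂(leb β)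

/-- The function with value `1` before time `u` and `-1` from time `u` on. -/
def flipAt {β : ℝ} (u t : Icc (0 : ℝ) β) : ℝ := if u ≤ t then -1 else 1

theorem flipAt_right {β : ℝ} (u t : Icc (0 : ℝ) β) :
    ContinuousWithinAt (flipAt u) (Ici t) t := by
  by_cases hut : u ≤ t
  · refine (continuousWithinAt_const (b := (-1 : ℝ))).congr (fun s hs => ?_) ?_
    · simp [flipAt, hut.trans hs]
    · simp [flipAt, hut]
  · have hopen : ∀ᶠ s in 𝓝[Ici t] t, s < u :=
      mem_nhdsWithin_of_mem_nhds (Iio_mem_nhds (not_le.mp hut))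
    refine (continuousWithinAt_const (b := (1 : ℝ))).congr_of_eventuallyEq ?_ ?_
    · filter_upwards [hopen] with s hs
      simp [flipAt, not_le.mpr hs]
    · simp [flipAt, hut]

theorem flipAt_left {β : ℝ} (u t : Icc (0 : ℝ) β) :
    ∃ a, Tendsto (flipAt u) (𝓝[<] t) (𝓝 a) := by
  by_cases hut : u < t
  · refine ⟨-1, tendsto_const_nhds.congr' ?_⟩
    filter_upwards [mem_nhdsWithin_of_mem_nhds (Ioi_mem_nhds hut)] with s hs
    simp [flipAt, le_of_lt (mem_Ioi.mp hs)]
  · refine ⟨1, tendsto_const_nhds.congr' ?_⟩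
    filter_upwards [self_mem_nhdsWithin] with s hs
    have : ¬ u ≤ s := fun h => hut (lt_of_le_of_lt h hs)
    simp [flipAt, this]

/-- The spin with initial sign `ε` that flips at each of the times `u 0, …, u (n - 1)`. -/
def flipSpin {β : ℝ} (ε : ℤˣ) {n : ℕ} (u : Fin n → Icc (0 : ℝ) β) : Spin β :=
  ⟨fun t => ((ε : ℤ) : ℝ) * ∏ i, flipAt (u i) t, by
    intro t
    have hprod : ∏ i, flipAt (u i) t = 1 ∨ ∏ i, flipAt (u i) t = -1 := by
      refine Finset.prod_induction (fun i => flipAt (u i) t) (fun x => x = 1 ∨ x = -1) ?_ ?_ ?_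
      · rintro x y (rfl | rfl) (rfl | rfl) <;> simp
      · simp
      · intro i _
        unfold flipAt
        split_ifs <;> simp
    rcases Int.units_eq_one_or ε with rfl | rfl <;> rcases hprod with h | h <;> simp [h], by
    intro t
    refine ⟨continuousWithinAt_const.mul (tendsto_finsetProd _ fun i _ => flipAt_right (u i) t), ?_⟩
    choose a ha using fun i => flipAt_left (u i) t
    exact ⟨_, tendsto_const_nhds.mul (tendsto_finsetProd _ fun i _ => ha i)⟩⟩

/-- The law `φ` of a single free spin: the flip times form a Poisson point process of intensity
`lam` on `[0, β]`, and the initial sign is uniform on `{1, -1}` and independent of it. The Poisson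
process is written through the number `n` of its points: it has `n` points with probability
`exp (-(lam * β)) * (lam * β) ^ n / n!`, and these are then `n` independent uniform points of
`[0, β]`, of joint law `β ^ (-n)` times Lebesgue measure on `[0, β] ^ n`. -/
def freeSpin (β lam : ℝ) : Measure (Spin β) :=
  Measure.sum fun n : ℕ =>
    ENNReal.ofReal (Real.exp (-(lam * β)) * lam ^ n / (n.factorial : ℝ)) •
      ∑ ε : ℤˣ, (2⁻¹ : ℝ≥0∞) • (Measure.pi fun _ : Fin n => leb β).map (flipSpin ε)

/-! ### The regular tree -/

/-- Vertices of the infinite rooted `b`-ary tree. The root is `[]` and the children of `v` are the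
vertices `i :: v`, so that the depth of a vertex is its length. -/
abbrev Vertex (b : ℕ) : Type := List (Fin b)

/-- The children of a vertex. -/
def children {b : ℕ} (v : Vertex b) : Finset (Vertex b) :=
  Finset.univ.image fun i : Fin b => i :: v

/-- The set of ancestors at distance one: empty for the root, a singleton otherwise. -/
def parent {b : ℕ} : Vertex b → Finset (Vertex b)
  | [] => ∅
  | _ :: p => {p}

/-- The neighbors of a vertex in the infinite tree. -/
def neighbors {b : ℕ} (v : Vertex b) : Finset (Vertex b) := children v ∪ parent v

/-- The regular subtree with root `x` and uniform depth `n`: `x` and its descendants up to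
`n` generations below it. -/
def subtree {b : ℕ} (x : Vertex b) : ℕ → Finset (Vertex b)
  | 0 => {x}
  | n + 1 => insert x (Finset.univ.biUnion fun i : Fin b => subtree (i :: x) n)

theorem root_mem_subtree {b : ℕ} (x : Vertex b) (n : ℕ) : x ∈ subtree x n := by
  cases n <;> simp [subtree]

/-- The root of a regular subtree, as one of its vertices. -/
def subtreeRoot {b : ℕ} (x : Vertex b) (n : ℕ) : subtree x n := ⟨x, root_mem_subtree x n⟩

/-! ### Gibbs measures -/

/-- The exponent in the density of the Gibbs measure on `A` with boundary condition `τ`: every edge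
inside `A` (a vertex together with one of its children) contributes once, and each `v ∈ A` feels
the field `h` and the boundary spins of its neighbors outside `A`. -/
def energy {b : ℕ} {β : ℝ} (h : Icc (0 : ℝ) β → ℝ) (A : Finset (Vertex b))
    (τ : Vertex b → Spin β) (σ : A → Spin β) : ℝ :=
  (∑ v : A, ∑ w : A, if (w : Vertex b) ∈ children (v : Vertex b)
      then dot (σ v).1 (σ w).1 else 0) +
    ∑ v : A, dot (fun t => h t + ∑ y ∈ neighbors (v : Vertex b) \ A, (τ y).1 t) (σ v).1

/-- The Gibbs measure on `A` with boundary condition `τ`: density `exp (energy) / Z` with respect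
to the product of the free spin measures. -/
def gibbs {b : ℕ} {β : ℝ} (lam : ℝ) (h : Icc (0 : ℝ) β → ℝ) (A : Finset (Vertex b))
    (τ : Vertex b → Spin β) : Measure (A → Spin β) :=
  (Measure.pi fun _ : A => freeSpin β lam).tilted (energy h A τ)

/-- The marginal distribution of the spin at `z ∈ A` under the Gibbs measure. -/
def marginal {b : ℕ} {β : ℝ} (lam : ℝ) (h : Icc (0 : ℝ) β → ℝ) (A : Finset (Vertex b))
    (τ : Vertex b → Spin β) (z : A) : Measure (Spin β) :=
  (gibbs lam h A τ).map fun σ => σ z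

/-- Total variation distance of two probability measures. -/
def tvDist {α : Type*} [MeasurableSpace α] (μ ν : Measure α) : ℝ≥0∞ :=
  ⨆ (s : Set α) (_ : MeasurableSet s), ENNReal.ofReal |μ.real s - ν.real s|

/-- The conditional expectation of `σ z • 1` under the Gibbs measure on `A`, given that the spin at
`x` is the spin `ξ`; used for `ξ = +` and `ξ = -`, where the event has positive probability. -/
def condMag {b : ℕ} {β : ℝ} (lam : ℝ) (h : Icc (0 : ℝ) β → ℝ) (A : Finset (Vertex b))
    (τ : Vertex b → Spin β) (x z : A) (ξ : Spin β) : ℝ :=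
  ∫ σ, dot (σ z).1 (fun _ => 1) ∂(ProbabilityTheory.cond (gibbs lam h A τ) {σ | σ x = ξ})

/-! ### Uniqueness region and exponents -/

/-- The parameters are in the uniqueness region: the marginals at the root of the tree of depth
`l`, with plus and with minus boundary condition, merge in total variation as `l → ∞`. -/
def InUniquenessRegion (b : ℕ) {β : ℝ} (lam : ℝ) (h : Icc (0 : ℝ) β → ℝ) : Prop :=
  Tendsto (fun l : ℕ =>
    tvDist
      (marginal lam h (subtree ([] : Vertex b) l) (fun _ => Spin.plus β) (subtreeRoot [] l))
      (marginal lam h (subtree ([] : Vertex b) l) (fun _ => Spin.minus β) (subtreeRoot [] l)))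
    atTop (𝓝 0)

/-- The exponent `γ`: the supremum, over subsets `A` of the trees of depth `l`, vertices `y` of the
external boundary of `A`, neighbors `z ∈ A` of `y` and boundary conditions that differ only at `y`,
of the distance between the two marginals at `z`. -/
def gamma (b : ℕ) {β : ℝ} (lam : ℝ) (h : Icc (0 : ℝ) β → ℝ) : ℝ≥0∞ :=
  ⨆ (l : ℕ) (A : Finset (Vertex b)) (_ : A ⊆ subtree [] l) (y : Vertex b) (_ : y ∉ A) (z : A)
    (_ : y ∈ neighbors (z : Vertex b)) (η : Vertex b → Spin β) (η' : Vertex b → Spin β)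
    (_ : ∀ w, w ≠ y → η w = η' w),
    tvDist (marginal lam h A η z) (marginal lam h A η' z)

/-- `k` is an admissible rate in the definition of `κ(τ)`: beyond some distance `l₀`, uniformly in
the regular subtree `T` (with root `x` and depth `n`), the influence on `z ∈ T` of the spin at the
root `x` of `T` is at most `k` to the power of the distance from `z` to `x`. That distance is the
difference of the depths, as `z` is a descendant of `x`. -/
def IsDecayRate {b : ℕ} {β : ℝ} (lam : ℝ) (h : Icc (0 : ℝ) β → ℝ) (τ : Vertex b → Spin β)
    (k : ℝ≥0) : Prop :=
  ∃ l₀ : ℕ, ∀ (x : Vertex b) (n : ℕ) (z : subtree x n),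
    l₀ ≤ (z : Vertex b).length - x.length →
      condMag lam h (subtree x n) τ (subtreeRoot x n) z (Spin.plus β) -
          condMag lam h (subtree x n) τ (subtreeRoot x n) z (Spin.minus β) ≤
        (k : ℝ) ^ ((z : Vertex b).length - x.length)

/-- The exponent `κ(τ)`, the infimum of the admissible rates (`∞` if there is none). -/
def kappa {b : ℕ} {β : ℝ} (lam : ℝ) (h : Icc (0 : ℝ) β → ℝ) (τ : Vertex b → Spin β) : ℝ≥0∞ :=
  ⨅ (k : ℝ≥0) (_ : IsDecayRate lam h τ k), (k : ℝ≥0∞)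

end QuantumIsing

end

/-!
# Decay of correlations for the quantum Ising model on a regular tree

Integrating out everything below a vertex `x` of a subtree turns the Gibbs measure into a product of
*weights*: `weight lam h τ n x` is the density, with respect to the free spin measure, of the spin
at `x`, and it is obtained from the weights of the children of `x` by the transfer operator
`V ↦ ∫ exp (σ • ξ) V ξ φ(dξ)`. Along a path the spins form a Markov chain, whose transition kernels
`kernel` are the transfer operators normalized by the weights. The quantity that defines `kappa` is
therefore the oscillation `osc` of a composition `chain` of kernels, applied to the magnetization
(`integral_cond_gibbs`, `condMag_sub_condMag`).

**Monotonicity.** The signs of a free spin at finitely many times form a Markov chain with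
nonnegatively correlated steps. So the four functions theorem on a finite distributive lattice,
followed by an approximation of spins by step functions, gives a four functions theorem for the law
of a free spin (`four_functions_freeSpin`). The transfer operator hence preserves the Holley order
`HolleyLE` of weights, weights are log-supermodular and increasing in the boundary condition
(`holleyLE_weight`), and kernels map increasing functions to increasing functions.

**Plus boundary conditions.** The plus weights decrease in the Holley order with the depth and have
bounded oscillation, so the logarithms of their ratios at `+` and `-` converge. Now tilt the plus
weight at *all* vertices at distance `k` below `x` by `exp (s g)`, where `g` is increasing and `s`
is small. One level up, the tilted weight is still dominated by the plus boundary condition on a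
tree that ends there (`tilt_succ_holleyLE_plusWeight`), so the effect of the tilt at `x`, on a
logarithmic scale, stays below a fixed `ε`, uniformly in `k`. But as long as the effect is at most
`ε`, each level multiplies it by the `b` children, up to a factor `exp (-ε)`, while the kernel acts
on it (`monotone_logTilt_sub_chain`). Thus `(b exp (-ε)) ^ k` times the influence along a path of
length `k` is bounded (`exists_osc_chain_plusWeight_le`), which is `kappa ≤ 1 / b`.

**Uniqueness.** Applied to the atoms at the constant spins, which have positive mass, uniqueness
shows that the ratios of the weights at `+` and `-` with plus and with minus boundary conditions
merge. By monotonicity every weight, with any boundary condition, is then close to the plus weight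
far from the boundary (`InUniquenessRegion.exists_close`), up to a factor near `1`. Kernels of close
weights are close, so over blocks of fixed length the decay for plus boundary conditions carries
over (`exists_osc_chain_le_pow`); the vertices within a bounded distance of the boundary cost only a
constant.

**The product.** Changing one boundary spin changes the energy by at most `2 β (b + 1)`, so that the
two Gibbs measures have densities with respect to each other that are bounded away from zero; hence
`gamma < 1` (`gamma_lt_one`).
-/

noncomputable section

namespace QuantumIsing

/-! ### Spins and their step approximations -/

section Spins

variable {β : ℝ}

instance : IsFiniteMeasure (leb β) :=
  ⟨by
    rw [leb, (MeasurableEmbedding.subtype_coe measurableSet_Icc).comap_apply]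
    simp only [image_univ, Subtype.range_coe_subtype, ofPred_mem_eq, Real.volume_Icc]
    exact ENNReal.ofReal_lt_top⟩

theorem leb_real_univ (hβ : 0 ≤ β) : (leb β).real univ = β := by
  rw [Measure.real, leb, (MeasurableEmbedding.subtype_coe measurableSet_Icc).comap_apply]
  simp only [image_univ, Subtype.range_coe_subtype, ofPred_mem_eq, Real.volume_Icc]
  rw [ENNReal.toReal_ofReal (by linarith), sub_zero]

theorem leb_real_Ioc (a b : Icc (0 : ℝ) β) (hab : a ≤ b) :
    (leb β).real (Ioc a b) = (b : ℝ) - a := by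
  rw [Measure.real, leb, (MeasurableEmbedding.subtype_coe measurableSet_Icc).comap_apply]
  have : (Subtype.val '' Ioc a b : Set ℝ) = Ioc (a : ℝ) b := by
    ext x
    constructor
    · rintro ⟨y, hy, rfl⟩
      exact ⟨hy.1, hy.2⟩
    · intro hx
      exact ⟨⟨x, a.2.1.trans hx.1.le, hx.2.trans b.2.2⟩, ⟨hx.1, hx.2⟩, rfl⟩
  rw [this, Real.volume_Ioc, ENNReal.toReal_ofReal (sub_nonneg.2 hab)]

namespace Spin

theorem abs_apply (σ : Spin β) (t : Icc (0 : ℝ) β) : |σ.1 t| = 1 := by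
  rcases σ.2.1 t with h | h <;> simp [h]

theorem neg_one_le (σ : Spin β) (t : Icc (0 : ℝ) β) : -1 ≤ σ.1 t := by
  rcases σ.2.1 t with h | h <;> simp [h]

theorem le_one (σ : Spin β) (t : Icc (0 : ℝ) β) : σ.1 t ≤ 1 := by
  rcases σ.2.1 t with h | h <;> simp [h]

@[simp] theorem plus_apply (t : Icc (0 : ℝ) β) : (plus β).1 t = 1 := by simp [plus, const]

@[simp] theorem minus_apply (t : Icc (0 : ℝ) β) : (minus β).1 t = -1 := by simp [minus, const]

theorem le_plus (σ : Spin β) : σ ≤ plus β := fun t => by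
  change σ.1 t ≤ (plus β).1 t
  simpa using σ.le_one t

theorem minus_le (σ : Spin β) : minus β ≤ σ := fun t => by
  change (minus β).1 t ≤ σ.1 t
  simpa using σ.neg_one_le t

/-- The pointwise maximum of two spins. -/
def sup (σ ξ : Spin β) : Spin β :=
  ⟨fun t => max (σ.1 t) (ξ.1 t), fun t => by
    rcases σ.2.1 t with h | h <;> rcases ξ.2.1 t with h' | h' <;> simp [h, h'], fun t => by
    obtain ⟨a, ha⟩ := (σ.2.2 t).2
    obtain ⟨a', ha'⟩ := (ξ.2.2 t).2
    exact ⟨(σ.2.2 t).1.max (ξ.2.2 t).1, _, ha.max ha'⟩⟩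

/-- The pointwise minimum of two spins. -/
def inf (σ ξ : Spin β) : Spin β :=
  ⟨fun t => min (σ.1 t) (ξ.1 t), fun t => by
    rcases σ.2.1 t with h | h <;> rcases ξ.2.1 t with h' | h' <;> simp [h, h'], fun t => by
    obtain ⟨a, ha⟩ := (σ.2.2 t).2
    obtain ⟨a', ha'⟩ := (ξ.2.2 t).2
    exact ⟨(σ.2.2 t).1.min (ξ.2.2 t).1, _, ha.min ha'⟩⟩

theorem le_sup_left (σ ξ : Spin β) : σ ≤ σ.sup ξ := fun _ => le_max_left _ _

/-- Convergence of spins in the product topology is pointwise convergence. -/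
theorem tendsto_iff {ι : Type*} {l : Filter ι} {u : ι → Spin β} {σ : Spin β} :
    Tendsto u l (𝓝 σ) ↔ ∀ t, Tendsto (fun i => (u i).1 t) l (𝓝 (σ.1 t)) := by
  rw [tendsto_subtype_rng, tendsto_pi_nhds]

theorem measurable_eval (t : Icc (0 : ℝ) β) : Measurable fun σ : Spin β => σ.1 t :=
  (measurable_pi_apply t).comp measurable_subtype_coe

end Spin

/-- The sign `±1` encoded by a truth value. -/
def sgn (x : Bool) : ℝ := if x then 1 else -1

/-- The index of the cell of mesh `1 / (N + 1)` that contains the time `t`. -/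
def cell (N : ℕ) (t : Icc (0 : ℝ) β) : ℕ := ⌊(t : ℝ) * (N + 1)⌋₊

theorem cell_le (N : ℕ) (t : Icc (0 : ℝ) β) : cell N t ≤ ⌊β * (N + 1)⌋₊ :=
  Nat.floor_le_floor (mul_le_mul_of_nonneg_right t.2.2 (by positivity))

theorem cell_eventually_right (N : ℕ) (t : Icc (0 : ℝ) β) :
    ∀ᶠ s in 𝓝[Ici t] t, cell N s = cell N t := by
  have hc : Continuous fun s : Icc (0 : ℝ) β => (s : ℝ) * (N + 1) := by fun_prop
  have h1 : ∀ᶠ s : Icc (0 : ℝ) β in 𝓝 t, (s : ℝ) * (N + 1) < ⌊(t : ℝ) * (N + 1)⌋₊ + 1 :=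
    hc.continuousAt.eventually_lt continuousAt_const (Nat.lt_floor_add_one _)
  filter_upwards [mem_nhdsWithin_of_mem_nhds h1, self_mem_nhdsWithin] with s hs hts
  have ht0 := t.2.1
  have hs0 := s.2.1
  have hts' : (t : ℝ) ≤ s := hts
  refine (Nat.floor_eq_iff (by positivity)).2 ⟨?_, hs⟩
  exact (Nat.floor_le (by positivity)).trans (by gcongr)

theorem cell_eventually_left (N : ℕ) (t : Icc (0 : ℝ) β) :
    ∃ c, ∀ᶠ s in 𝓝[<] t, cell N s = c := by
  have hc : Continuous fun s : Icc (0 : ℝ) β => (s : ℝ) * (N + 1) := by fun_prop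
  refine ⟨⌈(t : ℝ) * (N + 1)⌉₊ - 1, ?_⟩
  rcases t.2.1.eq_or_lt with h0 | h0
  · filter_upwards [self_mem_nhdsWithin] with s hs
    have h1 : (s : ℝ) < t := hs
    have h2 := s.2.1
    linarith
  have hpos : 0 < (t : ℝ) * (N + 1) := by positivity
  have hceil : 0 < ⌈(t : ℝ) * (N + 1)⌉₊ := Nat.ceil_pos.2 hpos
  have hcast : ((⌈(t : ℝ) * (N + 1)⌉₊ - 1 : ℕ) : ℝ) = ⌈(t : ℝ) * (N + 1)⌉₊ - 1 := by
    rw [Nat.cast_sub hceil]; simp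
  have h1 : ∀ᶠ s : Icc (0 : ℝ) β in 𝓝 t,
      ((⌈(t : ℝ) * (N + 1)⌉₊ - 1 : ℕ) : ℝ) < (s : ℝ) * (N + 1) := by
    refine continuousAt_const.eventually_lt hc.continuousAt ?_
    rw [hcast]
    linarith [Nat.ceil_lt_add_one hpos.le]
  filter_upwards [mem_nhdsWithin_of_mem_nhds h1, self_mem_nhdsWithin] with s hs hts
  have hs0 := s.2.1
  have hts' : (s : ℝ) < t := hts
  refine (Nat.floor_eq_iff (by positivity)).2 ⟨hs.le, ?_⟩
  rw [hcast]
  have : (s : ℝ) * (N + 1) < t * (N + 1) := by gcongr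
  linarith [Nat.le_ceil ((t : ℝ) * (N + 1))]

theorem measurable_cell (N : ℕ) : Measurable (cell N : Icc (0 : ℝ) β → ℕ) :=
  Nat.measurable_floor.comp (measurable_subtype_coe.mul_const _)

theorem dot_comm (f g : Icc (0 : ℝ) β → ℝ) : dot f g = dot g f := by
  simp [dot, mul_comm]

theorem measurable_stepSpin_coe (N : ℕ) (s : Fin (⌊β * (N + 1)⌋₊ + 1) → Bool) :
    Measurable fun t : Icc (0 : ℝ) β => sgn (s ⟨cell N t, Nat.lt_succ_of_le (cell_le N t)⟩) :=
  (measurable_of_countable fun k : Fin (⌊β * (N + 1)⌋₊ + 1) => sgn (s k)).comp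
    ((measurable_of_countable fun k : {k : ℕ // k < ⌊β * (N + 1)⌋₊ + 1} =>
      (⟨k.1, k.2⟩ : Fin (⌊β * (N + 1)⌋₊ + 1))).comp
        ((measurable_cell N).subtype_mk (h := fun t => Nat.lt_succ_of_le (cell_le N t))))

variable [hβ : Fact (0 ≤ β)]

/-- The points of the grid of mesh `1 / (N + 1)`, truncated at `β`. -/
def gridPoint (β : ℝ) [hβ : Fact (0 ≤ β)] (N k : ℕ) : Icc (0 : ℝ) β :=
  projIcc 0 β hβ.out (k / (N + 1))

theorem gridPoint_mono (N : ℕ) : Monotone (gridPoint β N) := fun k l hkl =>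
  monotone_projIcc _ (by gcongr)

/-- The first grid points to the right of `t` approximate `t` from the right. -/
theorem tendsto_gridPoint (t : Icc (0 : ℝ) β) :
    Tendsto (fun N => gridPoint β N (cell N t + 1)) atTop (𝓝[Ici t] t) := by
  have h0 : ∀ N : ℕ, (0 : ℝ) < N + 1 := fun N => by positivity
  have hlow : ∀ N : ℕ, (t : ℝ) ≤ (cell N t + 1 : ℕ) / ((N : ℝ) + 1) := fun N => by
    rw [le_div_iff₀ (h0 N)]
    push_cast
    exact (Nat.lt_floor_add_one _).le
  have hup : ∀ N : ℕ, ((cell N t + 1 : ℕ) : ℝ) / ((N : ℝ) + 1) ≤ t + 1 / ((N : ℝ) + 1) :=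
    fun N => by
      rw [div_le_iff₀ (h0 N), add_mul, div_mul_cancel₀ _ (h0 N).ne']
      push_cast
      have := Nat.floor_le (mul_nonneg t.2.1 (h0 N).le)
      simpa [cell] using this
  have hlim : Tendsto (fun N : ℕ => ((cell N t + 1 : ℕ) : ℝ) / ((N : ℝ) + 1)) atTop (𝓝 t) := by
    refine tendsto_of_tendsto_of_tendsto_of_le_of_le tendsto_const_nhds ?_ hlow hup
    simpa using (tendsto_const_nhds (x := (t : ℝ))).add tendsto_one_div_add_atTop_nhds_zero_nat
  have hproj : projIcc 0 β hβ.out (t : ℝ) = t := projIcc_val _ t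
  refine tendsto_nhdsWithin_iff.2 ⟨?_, Eventually.of_forall fun N => ?_⟩
  · have := (continuous_projIcc (h := hβ.out)).continuousAt.tendsto.comp hlim
    rw [hproj] at this
    exact this
  · change t ≤ projIcc 0 β hβ.out _
    exact hproj.symm.le.trans (monotone_projIcc hβ.out (hlow N))

/-- The spin that has the constant sign `s k` on the `k`-th cell of the grid of mesh
`1 / (N + 1)`. -/
def stepSpin (N : ℕ) (s : Fin (⌊β * (N + 1)⌋₊ + 1) → Bool) : Spin β :=
  ⟨fun t => sgn (s ⟨cell N t, Nat.lt_succ_of_le (cell_le N t)⟩), fun t => by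
    simp only [sgn]; split_ifs <;> simp, fun t => by
    refine ⟨?_, ?_⟩
    · refine (continuousWithinAt_const (b := _)).congr_of_eventuallyEq ?_ rfl
      filter_upwards [cell_eventually_right N t] with r hr
      simp [hr]
    · obtain ⟨c, hc⟩ := cell_eventually_left N t
      by_cases hlt : c < ⌊β * (N + 1)⌋₊ + 1
      · refine ⟨sgn (s ⟨c, hlt⟩), tendsto_const_nhds.congr' ?_⟩
        filter_upwards [hc] with r hr
        simp [hr]
      · refine ⟨0, tendsto_const_nhds.congr' ?_⟩
        filter_upwards [hc] with r hr
        exact absurd (hr ▸ Nat.lt_succ_of_le (cell_le N r)) hlt⟩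

/-- The signs of a spin at the points `1, …, ⌊β (N + 1)⌋ + 1` of the grid of mesh
`1 / (N + 1)`. -/
def bits (N : ℕ) (σ : Spin β) : Fin (⌊β * (N + 1)⌋₊ + 1) → Bool :=
  fun k => decide (σ.1 (gridPoint β N (k + 1)) = 1)

theorem sgn_bits (N : ℕ) (σ : Spin β) (k : Fin (⌊β * (N + 1)⌋₊ + 1)) :
    sgn (bits N σ k) = σ.1 (gridPoint β N (k + 1)) := by
  rcases σ.2.1 (gridPoint β N (k + 1)) with h | h <;> norm_num [sgn, bits, h]

/-- The step approximation of a spin: on each cell it takes the value of the spin at the right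
end of the cell. Right ends are used because the spin is continuous from the right, so that
the approximations converge at *every* time. -/
def snap (N : ℕ) (σ : Spin β) : Spin β := stepSpin N (bits N σ)

theorem snap_apply (N : ℕ) (σ : Spin β) (t : Icc (0 : ℝ) β) :
    (snap N σ).1 t = σ.1 (gridPoint β N (cell N t + 1)) :=
  sgn_bits N σ ⟨cell N t, Nat.lt_succ_of_le (cell_le N t)⟩

theorem tendsto_snap (σ : Spin β) : Tendsto (fun N => snap N σ) atTop (𝓝 σ) :=
  Spin.tendsto_iff.2 fun t => by
    simp_rw [snap_apply]
    exact (σ.2.2 t).1.tendsto.comp (tendsto_gridPoint t)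

theorem measurable_bits (N : ℕ) : Measurable (bits N : Spin β → _) :=
  measurable_pi_lambda _ fun k => by
    have hs : MeasurableSet {σ : Spin β | σ.1 (gridPoint β N (k + 1)) = 1} :=
      Spin.measurable_eval _ (measurableSet_singleton (1 : ℝ))
    refine measurable_to_bool ?_
    convert hs using 1
    ext σ
    simp [bits]

theorem Spin.measurable (σ : Spin β) : Measurable σ.1 :=
  measurable_of_tendsto_metrizable (fun N => measurable_stepSpin_coe N (bits N σ))
    (tendsto_pi_nhds.2 fun t => Spin.tendsto_iff.1 (tendsto_snap σ) t)

/-- Measurability needs an argument, as the evaluation `σ`-algebra may be smaller than the Borel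
`σ`-algebra of the product topology: the step approximations depend on finitely many evaluations. -/
theorem _root_.SeqContinuous.measurable_of_spin {g : Spin β → ℝ} (hg : SeqContinuous g) :
    Measurable g :=
  measurable_of_tendsto_metrizable (f := fun N σ => g (snap N σ))
    (fun N => (measurable_of_countable fun s => g (stepSpin N s)).comp (measurable_bits N))
    (tendsto_pi_nhds.2 fun σ => hg (tendsto_snap σ))

/-- A real-valued function of two spins that is sequentially continuous is measurable. -/
theorem measurable_of_seqContinuous₂ {g : Spin β × Spin β → ℝ} (hg : SeqContinuous g) :
    Measurable g := by
  refine measurable_of_tendsto_metrizable (f := fun N p => g (snap N p.1, snap N p.2))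
    (fun N => ?_) (tendsto_pi_nhds.2 fun p => ?_)
  · exact (measurable_of_countable fun s : (Fin (⌊β * (N + 1)⌋₊ + 1) → Bool) ×
      (Fin (⌊β * (N + 1)⌋₊ + 1) → Bool) => g (stepSpin N s.1, stepSpin N s.2)).comp
      (((measurable_bits N).comp measurable_fst).prodMk ((measurable_bits N).comp measurable_snd))
  · exact hg ((tendsto_snap p.1).prodMk_nhds (tendsto_snap p.2))

theorem measurableSet_singleton_spin (ξ : Spin β) : MeasurableSet ({ξ} : Set (Spin β)) := by
  have : ({ξ} : Set (Spin β)) = ⋂ N, bits N ⁻¹' {bits N ξ} := by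
    ext σ
    simp only [mem_singleton_iff, mem_iInter, mem_preimage]
    refine ⟨fun h _ => by rw [h], fun h => Subtype.ext (funext fun t => ?_)⟩
    have h2 : ∀ N, snap N σ = snap N ξ := fun N => by rw [snap, h N, snap]
    refine tendsto_nhds_unique (Spin.tendsto_iff.1 (tendsto_snap σ) t) ?_
    simp_rw [h2]
    exact Spin.tendsto_iff.1 (tendsto_snap ξ) t
  rw [this]
  exact MeasurableSet.iInter fun N => measurable_bits N (MeasurableSet.of_discrete)

/-! ### The pairing with a spin -/

theorem integrable_mul_spin {f : Icc (0 : ℝ) β → ℝ} (hf : Integrable f (leb β)) (σ : Spin β) :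
    Integrable (fun t => f t * σ.1 t) (leb β) :=
  hf.mul_bdd (c := 1) σ.measurable.aestronglyMeasurable
    (Eventually.of_forall fun t => (σ.abs_apply t).le)

theorem Spin.integrable (σ : Spin β) : Integrable σ.1 (leb β) := by
  simpa using integrable_mul_spin (integrable_const (1 : ℝ)) σ

theorem abs_dot_le {f : Icc (0 : ℝ) β → ℝ} (hf : Integrable f (leb β)) (σ : Spin β) :
    |dot f σ.1| ≤ ∫ t, |f t| ∂(leb β) := by
  refine (abs_integral_le_integral_abs).trans (integral_mono_ae ?_ hf.abs ?_)
  · exact (integrable_mul_spin hf σ).abs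
  · exact Eventually.of_forall fun t => by simp [abs_mul, σ.abs_apply]

theorem abs_dot_spin_le (σ ξ : Spin β) : |dot σ.1 ξ.1| ≤ β := by
  refine (abs_dot_le σ.integrable ξ).trans ?_
  simp [σ.abs_apply, leb_real_univ hβ.out]

theorem dot_add {f g : Icc (0 : ℝ) β → ℝ} (hf : Integrable f (leb β)) (hg : Integrable g (leb β))
    (σ : Spin β) : dot (fun t => f t + g t) σ.1 = dot f σ.1 + dot g σ.1 := by
  simp_rw [dot, add_mul]
  exact integral_add (integrable_mul_spin hf σ) (integrable_mul_spin hg σ)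

theorem seqContinuous_dot_left {f : Icc (0 : ℝ) β → ℝ} (hf : Integrable f (leb β)) :
    SeqContinuous fun σ : Spin β => dot f σ.1 := fun u σ hu => by
  refine tendsto_integral_of_dominated_convergence (fun t => |f t|)
    (fun n => (integrable_mul_spin hf (u n)).1) hf.abs (fun n => ?_) ?_
  · exact Eventually.of_forall fun t => by simp [(u n).abs_apply]
  · exact Eventually.of_forall fun t => tendsto_const_nhds.mul (Spin.tendsto_iff.1 hu t)

theorem seqContinuous_dot : SeqContinuous fun p : Spin β × Spin β => dot p.1.1 p.2.1 :=
  fun u p hu => by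
    have h1 := Spin.tendsto_iff.1 ((continuous_fst.tendsto p).comp hu)
    have h2 := Spin.tendsto_iff.1 ((continuous_snd.tendsto p).comp hu)
    refine tendsto_integral_of_dominated_convergence (fun _ => 1)
      (fun n => (integrable_mul_spin (u n).1.integrable (u n).2).1) (integrable_const _)
      (fun n => ?_) ?_
    · exact Eventually.of_forall fun t => by simp [Spin.abs_apply]
    · exact Eventually.of_forall fun t => (h1 t).mul (h2 t)

/-- The pairing of spins is supermodular. -/
theorem dot_supermodular (a b σ ξ : Spin β) :
    dot a.1 σ.1 + dot b.1 ξ.1 ≤ dot (a.inf b).1 (σ.inf ξ).1 + dot (a.sup b).1 (σ.sup ξ).1 := by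
  have hi : ∀ a b : Spin β, Integrable (fun t => a.1 t * b.1 t) (leb β) := fun a b =>
    integrable_mul_spin a.integrable b
  simp only [dot]
  rw [← integral_add (hi _ _) (hi _ _), ← integral_add (hi _ _) (hi _ _)]
  refine integral_mono ((hi _ _).add (hi _ _)) ((hi _ _).add (hi _ _)) fun t => ?_
  change a.1 t * σ.1 t + b.1 t * ξ.1 t ≤ min (a.1 t) (b.1 t) * min (σ.1 t) (ξ.1 t) +
    max (a.1 t) (b.1 t) * max (σ.1 t) (ξ.1 t)
  rcases a.2.1 t with h1 | h1 <;> rcases b.2.1 t with h2 | h2 <;>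
    rcases σ.2.1 t with h3 | h3 <;> rcases ξ.2.1 t with h4 | h4 <;> rw [h1, h2, h3, h4] <;> norm_num

/-- The pairing with a fixed function is modular. -/
theorem dot_inf_add_dot_sup {f : Icc (0 : ℝ) β → ℝ} (hf : Integrable f (leb β)) (σ ξ : Spin β) :
    dot f (σ.inf ξ).1 + dot f (σ.sup ξ).1 = dot f σ.1 + dot f ξ.1 := by
  simp only [dot]
  rw [← integral_add (integrable_mul_spin hf _) (integrable_mul_spin hf _),
    ← integral_add (integrable_mul_spin hf _) (integrable_mul_spin hf _)]
  refine integral_congr_ae (Eventually.of_forall fun t => ?_)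
  change f t * min (σ.1 t) (ξ.1 t) + f t * max (σ.1 t) (ξ.1 t) = _
  rw [← mul_add, min_add_max, mul_add]

end Spins

/-! ### The law of a free spin at finitely many times -/

section FreeSpin

variable {β lam : ℝ}

theorem measurable_flipSpin (ε : ℤˣ) (n : ℕ) :
    Measurable (flipSpin ε : (Fin n → Icc (0 : ℝ) β) → Spin β) := by
  refine Measurable.subtype_mk (measurable_pi_lambda _ fun t => measurable_const.mul ?_)
  refine Finset.measurable_prod _ fun i _ => ?_
  exact Measurable.ite ((measurable_pi_apply i) measurableSet_Iic) measurable_const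
    measurable_const

theorem sum_units_const (x : ℝ≥0∞) : ∑ _ε : ℤˣ, 2⁻¹ * x = x := by
  simp [← mul_assoc, ENNReal.mul_inv_cancel]

theorem hasSum_poisson (c x : ℝ) :
    HasSum (fun n : ℕ => Real.exp c * lam ^ n / (n.factorial : ℝ) * x ^ n)
      (Real.exp (c + lam * x)) := by
  have h := (NormedSpace.expSeries_div_hasSum_exp (lam * x)).mul_left (Real.exp c)
  rw [← Real.exp_eq_exp_ℝ, ← Real.exp_add] at h
  refine h.congr_fun ?_
  intro n
  rw [mul_pow]
  ring

theorem poisson_coeff_nonneg [hlam : Fact (0 ≤ lam)] (n : ℕ) :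
    0 ≤ Real.exp (-(lam * β)) * lam ^ n / (n.factorial : ℝ) := by
  have := hlam.out
  positivity

/-- The sign flips between two consecutive times exactly if the flip time lies between them, which
happens for at most one pair of consecutive times. -/
theorem prod_flipAt_mul_flipAt {p : ℕ → Icc (0 : ℝ) β} (hp : Monotone p) (u : Icc (0 : ℝ) β)
    {n : ℕ} (S : Finset (Fin n)) :
    ∏ k ∈ S, flipAt u (p k) * flipAt u (p (k + 1)) =
      1 - 2 * ∑ k ∈ S, (Ioc (p k) (p (k + 1))).indicator (fun _ => (1 : ℝ)) u := by
  have h1 : ∀ k : ℕ, flipAt u (p k) * flipAt u (p (k + 1)) =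
      1 - 2 * (Ioc (p k) (p (k + 1))).indicator (fun _ => (1 : ℝ)) u := fun k => by
    have hk : p k ≤ p (k + 1) := hp k.le_succ
    by_cases ha : u ≤ p k
    · simp [flipAt, ha, ha.trans hk]
    · by_cases hb : u ≤ p (k + 1)
      · simp [flipAt, ha, hb, not_le.1 ha]; norm_num
      · simp [flipAt, ha, hb]
  induction S using Finset.induction_on with
  | empty => simp
  | insert j S hj ih =>
    rw [Finset.prod_insert hj, Finset.sum_insert hj, ih, h1]
    by_cases hu : u ∈ Ioc (p j) (p (j + 1))
    · have h0 : ∑ k ∈ S, (Ioc (p k) (p (k + 1))).indicator (fun _ => (1 : ℝ)) u = 0 := by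
        refine Finset.sum_eq_zero fun k hk => indicator_of_notMem (fun hu' => ?_) _
        have hne : (j : ℕ) ≠ k := fun h => hj (Fin.ext h ▸ hk)
        exact disjoint_left.1 (hp.pairwise_disjoint_on_Ioc_succ hne) hu hu'
      rw [h0]; ring
    · rw [indicator_of_notMem hu]; ring

variable [hβ : Fact (0 ≤ β)] [hlam : Fact (0 ≤ lam)]

instance : IsProbabilityMeasure (freeSpin β lam) := ⟨by
  have hb : (leb β) univ = ENNReal.ofReal β := by
    rw [← ofReal_measureReal (s := univ), leb_real_univ hβ.out]
  have h1 : ∀ n : ℕ, (ENNReal.ofReal (Real.exp (-(lam * β)) * lam ^ n / (n.factorial : ℝ)) •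
      ∑ ε : ℤˣ, (2⁻¹ : ℝ≥0∞) • (Measure.pi fun _ : Fin n => leb β).map (flipSpin ε)) univ =
      ENNReal.ofReal (Real.exp (-(lam * β)) * lam ^ n / (n.factorial : ℝ) * β ^ n) := fun n => by
    rw [ENNReal.ofReal_mul (poisson_coeff_nonneg n), ENNReal.ofReal_pow hβ.out, ← hb]
    simp only [Measure.smul_apply, Measure.finsetSum_apply, smul_eq_mul,
      Measure.map_apply (measurable_flipSpin _ n) MeasurableSet.univ, preimage_univ,
      Measure.pi_univ, Finset.prod_const, Finset.card_univ, Fintype.card_fin, sum_units_const]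
  rw [freeSpin, Measure.sum_apply _ MeasurableSet.univ]
  simp_rw [h1]
  rw [← ENNReal.ofReal_tsum_of_nonneg
    (fun n => mul_nonneg (poisson_coeff_nonneg n) (pow_nonneg hβ.out n))
    (hasSum_poisson _ _).summable, (hasSum_poisson _ _).tsum_eq]
  simp⟩

/-- Integration against the law of a free spin, as a series over the number of flips. -/
theorem hasSum_integral_freeSpin {G : Spin β → ℝ} (hG : Measurable G) {C : ℝ}
    (hC : ∀ σ, |G σ| ≤ C) :
    HasSum (fun n : ℕ => Real.exp (-(lam * β)) * lam ^ n / (n.factorial : ℝ) *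
      ∑ ε : ℤˣ, 2⁻¹ * ∫ u : Fin n → Icc (0 : ℝ) β, G (flipSpin ε u)
        ∂(Measure.pi fun _ => leb β)) (∫ σ, G σ ∂(freeSpin β lam)) := by
  have hint : Integrable G (freeSpin β lam) :=
    Integrable.of_bound hG.aestronglyMeasurable C (Eventually.of_forall hC)
  refine (hasSum_integral_measure hint).congr_fun fun n => ?_
  rw [integral_smul_measure, integral_finsetSum_measure, ENNReal.toReal_ofReal
    (poisson_coeff_nonneg n), smul_eq_mul]
  · congr 1
    refine Finset.sum_congr rfl fun ε _ => ?_
    rw [integral_smul_measure, integral_map (measurable_flipSpin ε n).aemeasurable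
      hG.aestronglyMeasurable]
    simp
  · intro ε _
    exact (Integrable.of_bound hG.aestronglyMeasurable C (Eventually.of_forall hC)).smul_measure
      (by simp)

/-- With positive probability a free spin does not flip. -/
theorem freeSpin_const_pos (ε : ℤˣ) : 0 < (freeSpin β lam).real {Spin.const β ε} := by
  refine ENNReal.toReal_pos ?_ (measure_ne_top _ _)
  have hms := measurableSet_singleton_spin (Spin.const β ε)
  rw [freeSpin, Measure.sum_apply _ hms]
  refine fun h0 => ?_
  have h1 := ENNReal.tsum_eq_zero.1 h0 0
  have h2 : (flipSpin ε : (Fin 0 → Icc (0 : ℝ) β) → Spin β) ⁻¹' {Spin.const β ε} = univ := by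
    ext u
    simp [flipSpin, Spin.const]
  simp only [Measure.smul_apply, Measure.finsetSum_apply, smul_eq_mul, mul_eq_zero,
    Finset.sum_eq_zero_iff, Finset.mem_univ, true_implies] at h1
  rcases h1 with h1 | h1
  · rw [ENNReal.ofReal_eq_zero] at h1
    have := Real.exp_pos (-(lam * β))
    simp at h1
    linarith
  · have h3 := h1 ε
    rw [Measure.map_apply (measurable_flipSpin ε 0) hms, h2] at h3
    simp at h3

theorem integral_prod_flipAt {p : ℕ → Icc (0 : ℝ) β} (hp : Monotone p) {n : ℕ}
    (S : Finset (Fin n)) :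
    ∫ u, ∏ k ∈ S, flipAt u (p k) * flipAt u (p (k + 1)) ∂(leb β) =
      β - 2 * ∑ k ∈ S, ((p (k + 1) : ℝ) - p k) := by
  have hint : ∀ k : Fin n, Integrable ((Ioc (p k) (p (k + 1))).indicator fun _ => (1 : ℝ))
      (leb β) := fun k => (integrable_const 1).indicator measurableSet_Ioc
  simp_rw [prod_flipAt_mul_flipAt hp]
  rw [integral_sub (integrable_const _) ((integrable_finsetSum _ fun k _ => hint k).const_mul _),
    integral_const_mul, integral_finsetSum _ fun k _ => hint k]
  congr 1
  · simp [leb_real_univ hβ.out]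
  · congr 1
    refine Finset.sum_congr rfl fun k _ => ?_
    rw [integral_indicator_const _ measurableSet_Ioc, leb_real_Ioc _ _ (hp (Nat.le_succ _))]
    simp

/-- The values of a free spin at the times `p 0 ≤ p 1 ≤ …` form a Markov chain: the initial sign
is symmetric, and the products of consecutive signs are independent with mean
`exp (-2 lam (p (k + 1) - p k))`. Here this is stated through polynomials that will be indicator
functions of cylinder events. -/
theorem integral_freeSpin_cylinder {p : ℕ → Icc (0 : ℝ) β} (hp : Monotone p) {n : ℕ} (a : ℝ)
    (b : Fin n → ℝ) :
    ∫ σ : Spin β, (1 + a * σ.1 (p 0)) / 2 *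
        ∏ k, (1 + b k * (σ.1 (p k) * σ.1 (p (k + 1)))) / 2 ∂(freeSpin β lam) =
      2⁻¹ * ∏ k, (1 + b k * Real.exp (-(2 * lam * ((p (k + 1) : ℝ) - p k)))) / 2 := by
  set G : Spin β → ℝ := fun σ => (1 + a * σ.1 (p 0)) / 2 *
    ∏ k : Fin n, (1 + b k * (σ.1 (p k) * σ.1 (p (k + 1)))) / 2 with hG
  have hmeas : Measurable G := by
    have he := fun t : Icc (0 : ℝ) β => Spin.measurable_eval t
    exact (((he _).const_mul _).const_add _ |>.div_const _).mul (Finset.measurable_prod _ fun k _ =>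
      ((((he _).mul (he _)).const_mul _).const_add _).div_const _)
  have hbound : ∀ σ, |G σ| ≤ (1 + |a|) / 2 * ∏ k : Fin n, (1 + |b k|) / 2 := fun σ => by
    have haux : ∀ x y : ℝ, |y| = 1 → |(1 + x * y) / 2| ≤ (1 + |x|) / 2 := fun x y hy => by
      rw [abs_div, abs_two]
      have := abs_add_le 1 (x * y)
      rw [abs_mul, hy, abs_one, mul_one] at this
      linarith
    rw [hG, abs_mul, Finset.abs_prod]
    refine mul_le_mul (haux _ _ (σ.abs_apply _)) (Finset.prod_le_prod (fun _ _ => abs_nonneg _)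
      fun k _ => haux _ _ ?_) (Finset.prod_nonneg fun _ _ => abs_nonneg _) (by positivity)
    rw [abs_mul, σ.abs_apply, σ.abs_apply, mul_one]
  have hflip : ∀ (m : ℕ) (u : Fin m → Icc (0 : ℝ) β) (ε : ℤˣ), G (flipSpin ε u) =
      (1 + a * (((ε : ℤ) : ℝ) * ∏ i, flipAt (u i) (p 0))) / 2 * ((2 ^ n)⁻¹ *
        ∑ S : Finset (Fin n), (∏ k ∈ S, b k) *
          ∏ i, ∏ k ∈ S, flipAt (u i) (p k) * flipAt (u i) (p (k + 1))) := fun m u ε => by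
    have hε : ((ε : ℤ) : ℝ) * ((ε : ℤ) : ℝ) = 1 := by
      rcases Int.units_eq_one_or ε with rfl | rfl <;> simp
    have h1 : ∀ k : Fin n, (flipSpin ε u).1 (p k) * (flipSpin ε u).1 (p (k + 1)) =
        ∏ i, flipAt (u i) (p k) * flipAt (u i) (p (k + 1)) := fun k => by
      rw [Finset.prod_mul_distrib]
      simp only [flipSpin]
      linear_combination (∏ i, flipAt (u i) (p k)) * (∏ i, flipAt (u i) (p (k + 1))) * hε
    simp only [hG, h1]
    rw [Finset.prod_div_distrib, Finset.prod_one_add, Finset.prod_const, Finset.card_univ,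
      Fintype.card_fin, Finset.powerset_univ, div_eq_inv_mul (∑ t, _)]
    congr 2
    refine Finset.sum_congr rfl fun S _ => ?_
    rw [Finset.prod_mul_distrib, Finset.prod_comm]
  have hterm : ∀ m : ℕ, ∑ ε : ℤˣ, 2⁻¹ * ∫ u : Fin m → Icc (0 : ℝ) β, G (flipSpin ε u)
      ∂(Measure.pi fun _ => leb β) = 2⁻¹ * ((2 ^ n)⁻¹ * ∑ S : Finset (Fin n), (∏ k ∈ S, b k) *
        (β - 2 * ∑ k ∈ S, ((p (k + 1) : ℝ) - p k)) ^ m) := fun m => by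
    have hflipm : ∀ ε, Measurable fun u : Fin m → Icc (0 : ℝ) β => G (flipSpin ε u) := fun ε =>
      hmeas.comp (measurable_flipSpin ε m)
    have hi : ∀ ε, Integrable (fun u : Fin m → Icc (0 : ℝ) β => G (flipSpin ε u))
        (Measure.pi fun _ => leb β) := fun ε =>
      Integrable.of_bound (hflipm ε).aestronglyMeasurable _
        (Eventually.of_forall fun u => hbound _)
    have hfa : ∀ t : Icc (0 : ℝ) β, Measurable fun u : Icc (0 : ℝ) β => flipAt u t := fun t =>
      Measurable.ite measurableSet_Iic measurable_const measurable_const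
    have hfb : ∀ u t : Icc (0 : ℝ) β, |flipAt u t| = 1 := fun u t => by
      unfold flipAt; split_ifs <;> simp
    have hprodint : ∀ S : Finset (Fin n), Integrable (fun u : Fin m → Icc (0 : ℝ) β =>
        (∏ k ∈ S, b k) * ∏ i, ∏ k ∈ S, flipAt (u i) (p k) * flipAt (u i) (p (k + 1)))
        (Measure.pi fun _ => leb β) := fun S => by
      refine (Integrable.of_bound (C := 1) ?_ ?_).const_mul _
      · exact (Finset.measurable_prod _ fun i _ => Finset.measurable_prod _ fun k _ =>
          ((hfa _).comp (measurable_pi_apply i)).mul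
            ((hfa _).comp (measurable_pi_apply i))).aestronglyMeasurable
      · exact Eventually.of_forall fun u => by
          simp only [Real.norm_eq_abs, Finset.abs_prod, abs_mul, hfb]; simp
    rw [← Finset.mul_sum, ← integral_finsetSum _ fun ε _ => hi ε]
    congr 1
    have hsum : ∀ u : Fin m → Icc (0 : ℝ) β, ∑ ε, G (flipSpin ε u) = (2 ^ n)⁻¹ *
        ∑ S : Finset (Fin n), (∏ k ∈ S, b k) *
          ∏ i, ∏ k ∈ S, flipAt (u i) (p k) * flipAt (u i) (p (k + 1)) := fun u => by
      simp_rw [hflip, ← Finset.sum_mul]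
      rw [show (∑ ε : ℤˣ, (1 + a * (((ε : ℤ) : ℝ) * ∏ i, flipAt (u i) (p 0))) / 2) = 1 by
        simp [UnitsInt.univ]; ring, one_mul]
    simp_rw [hsum]
    rw [integral_const_mul, integral_finsetSum _ fun S _ => hprodint S]
    congr 1
    refine Finset.sum_congr rfl fun S _ => ?_
    rw [integral_const_mul, integral_fintype_prod_eq_pow
      (fun u => ∏ k ∈ S, flipAt u (p k) * flipAt u (p (k + 1))), integral_prod_flipAt hp,
      Fintype.card_fin]
  have hs := hasSum_integral_freeSpin (lam := lam) hmeas hbound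
  simp_rw [hterm] at hs
  refine hs.unique ?_
  have h2 : ∀ S : Finset (Fin n), HasSum (fun m : ℕ => Real.exp (-(lam * β)) * lam ^ m /
      (m.factorial : ℝ) * (β - 2 * ∑ k ∈ S, ((p (k + 1) : ℝ) - p k)) ^ m)
      (∏ k ∈ S, Real.exp (-(2 * lam * ((p (k + 1) : ℝ) - p k)))) := fun S => by
    convert hasSum_poisson (-(lam * β)) (β - 2 * ∑ k ∈ S, ((p (k + 1) : ℝ) - p k)) using 1
    rw [← Real.exp_sum, Finset.sum_neg_distrib, ← Finset.mul_sum]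
    congr 1
    ring
  have h3 := (((hasSum_sum fun (S : Finset (Fin n)) (_ : S ∈ Finset.univ) =>
    (h2 S).mul_left (∏ k ∈ S, b k)).mul_left (2 ^ n : ℝ)⁻¹).mul_left (2⁻¹ : ℝ))
  rw [Finset.prod_div_distrib, Finset.prod_one_add, Finset.prod_const, Finset.card_univ,
    Fintype.card_fin, Finset.powerset_univ, div_eq_inv_mul (∑ t, _)]
  simp_rw [Finset.prod_mul_distrib]
  refine h3.congr_fun fun m => ?_
  simp_rw [Finset.mul_sum]
  refine Finset.sum_congr rfl fun S _ => ?_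
  ring

/-! ### The four functions theorem for free spins -/

/-- The indicator function of equality of two sign sequences, in terms of the initial signs and of
the products of consecutive signs. -/
theorem prod_sgn_eq_ite {n : ℕ} (s t : Fin (n + 1) → Bool) :
    (1 + sgn (s 0) * sgn (t 0)) / 2 * ∏ k : Fin n, (1 + sgn (s k.castSucc) * sgn (s k.succ) *
      (sgn (t k.castSucc) * sgn (t k.succ))) / 2 = if t = s then 1 else 0 := by
  have hss : ∀ x : Bool, sgn x * sgn x = 1 := fun x => by cases x <;> simp [sgn]
  have hne : ∀ x y : Bool, y ≠ x → sgn x * sgn y = -1 := fun x y => by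
    cases x <;> cases y <;> simp [sgn]
  split_ifs with h
  · subst h
    rw [hss, Finset.prod_eq_one]
    · norm_num
    · intro k _
      rw [mul_mul_mul_comm, hss, hss]; norm_num
  · by_cases h0 : t 0 = s 0
    · have : ∃ k : Fin n, t k.castSucc = s k.castSucc ∧ t k.succ ≠ s k.succ := by
        by_contra! hcon
        exact h (funext fun k => Fin.induction h0 (fun k hk => hcon k hk) k)
      obtain ⟨k, hk, hk'⟩ := this
      rw [Finset.prod_eq_zero (Finset.mem_univ k), mul_zero]
      rw [mul_mul_mul_comm, hk, hss, hne _ _ hk']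
      norm_num
    · rw [hne _ _ h0]; norm_num

/-- The probability that a free spin has the signs `s` on the grid of mesh `1 / (N + 1)`. -/
def gridWeight (β lam : ℝ) [Fact (0 ≤ β)] (N : ℕ) (s : Fin (⌊β * (N + 1)⌋₊ + 1) → Bool) : ℝ :=
  2⁻¹ * ∏ k : Fin ⌊β * (N + 1)⌋₊, (1 + sgn (s k.castSucc) * sgn (s k.succ) *
    Real.exp (-(2 * lam * ((gridPoint β N (k + 2) : ℝ) - gridPoint β N (k + 1))))) / 2

theorem integral_bits (N : ℕ) (F : (Fin (⌊β * (N + 1)⌋₊ + 1) → Bool) → ℝ) :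
    ∫ σ : Spin β, F (bits N σ) ∂(freeSpin β lam) = ∑ s, gridWeight β lam N s * F s := by
  have h1 : ∀ σ : Spin β, F (bits N σ) = ∑ s, (if bits N σ = s then 1 else 0) * F s := fun σ => by
    simp
  simp_rw [h1]
  rw [integral_finsetSum]
  · refine Finset.sum_congr rfl fun s _ => ?_
    rw [integral_mul_const]
    congr 1
    have h2 := integral_freeSpin_cylinder (lam := lam) (p := fun k => gridPoint β N (k + 1))
      (fun k l hkl => gridPoint_mono N (Nat.succ_le_succ hkl)) (n := ⌊β * (N + 1)⌋₊) (sgn (s 0))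
      (fun k => sgn (s k.castSucc) * sgn (s k.succ))
    rw [gridWeight, ← h2]
    refine integral_congr_ae (Eventually.of_forall fun σ => ?_)
    simp only
    rw [← prod_sgn_eq_ite s (bits N σ)]
    simp_rw [sgn_bits]
    simp
  · intro s _
    exact (Integrable.of_bound (C := 1)
      ((measurable_of_countable fun t => if t = s then (1 : ℝ) else 0).comp
        (measurable_bits N)).aestronglyMeasurable
      (Eventually.of_forall fun σ => by simp only [Function.comp]; split_ifs <;> simp)).mul_const _

theorem gridWeight_nonneg (N : ℕ) (s : Fin (⌊β * (N + 1)⌋₊ + 1) → Bool) :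
    0 ≤ gridWeight β lam N s := by
  refine mul_nonneg (by norm_num) (Finset.prod_nonneg fun k _ => ?_)
  have h1 : Real.exp (-(2 * lam * ((gridPoint β N (k + 2) : ℝ) - gridPoint β N (k + 1)))) ≤ 1 := by
    have h2 : (gridPoint β N (k + 1) : ℝ) ≤ gridPoint β N (k + 2) := gridPoint_mono N (by omega)
    rw [Real.exp_le_one_iff]
    have := mul_nonneg hlam.out (sub_nonneg.2 h2)
    linarith
  have h3 := Real.exp_pos (-(2 * lam * ((gridPoint β N (k + 2) : ℝ) - gridPoint β N (k + 1))))
  cases s k.castSucc <;> cases s k.succ <;> simp [sgn] <;> linarith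

theorem gridWeight_supermodular (N : ℕ) (s t : Fin (⌊β * (N + 1)⌋₊ + 1) → Bool) :
    gridWeight β lam N s * gridWeight β lam N t ≤
      gridWeight β lam N (s ⊓ t) * gridWeight β lam N (s ⊔ t) := by
  have haux : ∀ (θ : ℝ) (_ : 0 ≤ θ) (_ : θ ≤ 1) (x y z w : Bool),
      0 ≤ (1 + sgn x * sgn y * θ) / 2 ∧
      (1 + sgn x * sgn y * θ) / 2 * ((1 + sgn z * sgn w * θ) / 2) ≤
        (1 + sgn (x ⊓ z) * sgn (y ⊓ w) * θ) / 2 * ((1 + sgn (x ⊔ z) * sgn (y ⊔ w) * θ) / 2) :=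
    fun θ h0 h1 x y z w => by
      cases x <;> cases y <;> cases z <;> cases w <;> simp [sgn] <;>
        first | (constructor <;> nlinarith) | nlinarith
  have hθ : ∀ k : ℕ,
      Real.exp (-(2 * lam * ((gridPoint β N (k + 2) : ℝ) - gridPoint β N (k + 1)))) ≤ 1 :=
    fun k => by
      have h2 : (gridPoint β N (k + 1) : ℝ) ≤ gridPoint β N (k + 2) := gridPoint_mono N (by omega)
      rw [Real.exp_le_one_iff]
      have := mul_nonneg hlam.out (sub_nonneg.2 h2)
      linarith
  simp only [gridWeight]
  rw [mul_mul_mul_comm, mul_mul_mul_comm (2⁻¹ : ℝ) (∏ k, _) (2⁻¹ : ℝ), ← Finset.prod_mul_distrib,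
    ← Finset.prod_mul_distrib]
  refine mul_le_mul_of_nonneg_left (Finset.prod_le_prod (fun k _ => ?_) fun k _ => ?_)
    (by norm_num)
  · exact mul_nonneg (haux _ (Real.exp_pos _).le (hθ k) _ _ true true).1
      (haux _ (Real.exp_pos _).le (hθ k) _ _ true true).1
  · exact (haux _ (Real.exp_pos _).le (hθ k) _ _ _ _).2

/-- Bounded functions of a spin that are sequentially continuous for pointwise convergence. -/
structure Tame (g : Spin β → ℝ) : Prop where
  seqCont : SeqContinuous g
  bdd : ∃ C, ∀ σ, |g σ| ≤ C

theorem Tame.measurable {g : Spin β → ℝ} (hg : Tame g) : Measurable g :=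
  hg.seqCont.measurable_of_spin

theorem Tame.integrable {g : Spin β → ℝ} (hg : Tame g) {μ : Measure (Spin β)}
    [IsFiniteMeasure μ] : Integrable g μ := by
  obtain ⟨C, hC⟩ := hg.bdd
  exact Integrable.of_bound hg.measurable.aestronglyMeasurable C (Eventually.of_forall hC)

theorem Tame.tendsto_integral_snap {g : Spin β → ℝ} (hg : Tame g) :
    Tendsto (fun N => ∑ s, gridWeight β lam N s * g (stepSpin N s)) atTop
      (𝓝 (∫ σ, g σ ∂(freeSpin β lam))) := by
  obtain ⟨C, hC⟩ := hg.bdd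
  simp_rw [← integral_bits]
  refine tendsto_integral_of_dominated_convergence (fun _ => C) (fun N => ?_) (integrable_const _)
    (fun N => Eventually.of_forall fun σ => hC _)
    (Eventually.of_forall fun σ => hg.seqCont (tendsto_snap σ))
  exact ((measurable_of_countable fun s => g (stepSpin N s)).comp
    (measurable_bits N)).aestronglyMeasurable

/-- The four functions theorem for the law of a free spin. On the signs at the points of a grid it
is the four functions theorem for a finite distributive lattice, because the law of a free spin at
finitely many times is a Markov chain with nonnegatively correlated steps; the general case follows
by approximation. -/
theorem four_functions_freeSpin {f₁ f₂ f₃ f₄ : Spin β → ℝ} (h₁ : Tame f₁) (h₂ : Tame f₂)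
    (h₃ : Tame f₃) (h₄ : Tame f₄) (n₁ : 0 ≤ f₁) (n₂ : 0 ≤ f₂) (n₃ : 0 ≤ f₃) (n₄ : 0 ≤ f₄)
    (h : ∀ σ ξ, f₁ σ * f₂ ξ ≤ f₃ (σ.inf ξ) * f₄ (σ.sup ξ)) :
    (∫ σ, f₁ σ ∂(freeSpin β lam)) * ∫ σ, f₂ σ ∂(freeSpin β lam) ≤
      (∫ σ, f₃ σ ∂(freeSpin β lam)) * ∫ σ, f₄ σ ∂(freeSpin β lam) := by
  refine le_of_tendsto_of_tendsto' (h₁.tendsto_integral_snap.mul h₂.tendsto_integral_snap)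
    (h₃.tendsto_integral_snap.mul h₄.tendsto_integral_snap) fun N => ?_
  have hinf : ∀ s t, stepSpin (β := β) N (s ⊓ t) = (stepSpin N s).inf (stepSpin N t) :=
    fun s t => Subtype.ext (funext fun r => by
      simp only [stepSpin, Spin.inf, Pi.inf_apply]
      generalize s _ = x
      generalize t _ = y
      cases x <;> cases y <;> simp [sgn])
  have hsup : ∀ s t, stepSpin (β := β) N (s ⊔ t) = (stepSpin N s).sup (stepSpin N t) :=
    fun s t => Subtype.ext (funext fun r => by
      simp only [stepSpin, Spin.sup, Pi.sup_apply]
      generalize s _ = x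
      generalize t _ = y
      cases x <;> cases y <;> simp [sgn])
  refine four_functions_theorem_univ (fun s => gridWeight β lam N s * f₁ (stepSpin N s))
    (fun s => gridWeight β lam N s * f₂ (stepSpin N s))
    (fun s => gridWeight β lam N s * f₃ (stepSpin N s))
    (fun s => gridWeight β lam N s * f₄ (stepSpin N s))
    (fun s => mul_nonneg (gridWeight_nonneg N s) (n₁ _))
    (fun s => mul_nonneg (gridWeight_nonneg N s) (n₂ _))
    (fun s => mul_nonneg (gridWeight_nonneg N s) (n₃ _))
    (fun s => mul_nonneg (gridWeight_nonneg N s) (n₄ _)) fun s t => ?_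
  rw [mul_mul_mul_comm, mul_mul_mul_comm (gridWeight β lam N (s ⊓ t)), hinf, hsup]
  exact mul_le_mul (gridWeight_supermodular N s t) (h _ _) (mul_nonneg (n₁ _) (n₂ _))
    (mul_nonneg (gridWeight_nonneg N _) (gridWeight_nonneg N _))

end FreeSpin

/-! ### Tame functions, weights and the Holley order -/

section Weights

variable {β : ℝ}

theorem Spin.inf_eq_left {σ ξ : Spin β} (h : σ ≤ ξ) : σ.inf ξ = σ :=
  Subtype.ext (funext fun t => min_eq_left (h t))

theorem Spin.sup_eq_right {σ ξ : Spin β} (h : σ ≤ ξ) : σ.sup ξ = ξ :=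
  Subtype.ext (funext fun t => max_eq_right (h t))

theorem Spin.inf_comm (σ ξ : Spin β) : σ.inf ξ = ξ.inf σ :=
  Subtype.ext (funext fun _ => min_comm _ _)

theorem Spin.sup_comm (σ ξ : Spin β) : σ.sup ξ = ξ.sup σ :=
  Subtype.ext (funext fun _ => max_comm _ _)

namespace Tame

variable {f g : Spin β → ℝ}

theorem const (c : ℝ) : Tame fun _ : Spin β => c :=
  ⟨fun _ _ _ => tendsto_const_nhds, |c|, fun _ => le_rfl⟩

theorem add (hf : Tame f) (hg : Tame g) : Tame fun σ => f σ + g σ := by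
  obtain ⟨C, hC⟩ := hf.bdd
  obtain ⟨D, hD⟩ := hg.bdd
  exact ⟨fun _ _ hu => (hf.seqCont hu).add (hg.seqCont hu), C + D,
    fun σ => (abs_add_le _ _).trans (add_le_add (hC σ) (hD σ))⟩

theorem mul (hf : Tame f) (hg : Tame g) : Tame fun σ => f σ * g σ := by
  obtain ⟨C, hC⟩ := hf.bdd
  obtain ⟨D, hD⟩ := hg.bdd
  exact ⟨fun _ _ hu => (hf.seqCont hu).mul (hg.seqCont hu), C * D, fun σ => by
    rw [abs_mul]
    exact mul_le_mul (hC σ) (hD σ) (abs_nonneg _) ((abs_nonneg _).trans (hC σ))⟩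

theorem sub (hf : Tame f) (hg : Tame g) : Tame fun σ => f σ - g σ := by
  simpa [sub_eq_add_neg] using hf.add ((const (-1)).mul hg)

theorem exp (hf : Tame f) : Tame fun σ => Real.exp (f σ) := by
  obtain ⟨C, hC⟩ := hf.bdd
  exact ⟨fun _ _ hu => (hf.seqCont hu).rexp, Real.exp C, fun σ => by
    rw [Real.abs_exp]
    exact Real.exp_le_exp.2 ((le_abs_self _).trans (hC σ))⟩

end Tame

/-- Tame functions that are bounded away from `0`. The unnormalized densities of all marginal laws
of single spins are of this form. -/
structure IsWeight (W : Spin β → ℝ) : Prop where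
  tame : Tame W
  lower : ∃ c, 0 < c ∧ ∀ σ, c ≤ W σ

namespace IsWeight

variable {V W : Spin β → ℝ}

theorem pos (hW : IsWeight W) (σ : Spin β) : 0 < W σ := by
  obtain ⟨c, hc, h⟩ := hW.lower
  exact hc.trans_le (h σ)

theorem mul (hV : IsWeight V) (hW : IsWeight W) : IsWeight fun σ => V σ * W σ := by
  obtain ⟨c, hc, h⟩ := hV.lower
  obtain ⟨d, hd, h'⟩ := hW.lower
  exact ⟨hV.tame.mul hW.tame, c * d, mul_pos hc hd, fun σ => mul_le_mul (h σ) (h' σ) hd.le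
    (hV.pos σ).le⟩

theorem prod {ι : Type*} (s : Finset ι) {W : ι → Spin β → ℝ} (hW : ∀ i, IsWeight (W i)) :
    IsWeight fun σ => ∏ i ∈ s, W i σ := by
  classical
  induction s using Finset.induction_on with
  | empty => simpa using ⟨Tame.const 1, 1, one_pos, fun _ => le_rfl⟩
  | insert i s hi ih =>
    simp_rw [Finset.prod_insert hi]
    exact (hW i).mul ih

theorem exp {f : Spin β → ℝ} (hf : Tame f) : IsWeight fun σ => Real.exp (f σ) := by
  refine ⟨hf.exp, ?_⟩
  obtain ⟨C, hC⟩ := hf.bdd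
  exact ⟨Real.exp (-C), Real.exp_pos _, fun σ => Real.exp_le_exp.2 (neg_le_of_abs_le (hC σ))⟩

theorem tame_div {f : Spin β → ℝ} (hf : Tame f) (hW : IsWeight W) : Tame fun σ => f σ / W σ := by
  obtain ⟨C, hC⟩ := hf.bdd
  obtain ⟨c, hc, h⟩ := hW.lower
  exact ⟨fun u σ hu => (hf.seqCont hu).div (hW.tame.seqCont hu) (hW.pos σ).ne', C / c, fun σ => by
    rw [abs_div, abs_of_pos (hW.pos σ)]
    exact div_le_div₀ ((abs_nonneg _).trans (hC σ)) (hC σ) hc (h σ)⟩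

theorem tame_log (hW : IsWeight W) : Tame fun σ => Real.log (W σ) := by
  obtain ⟨C, hC⟩ := hW.tame.bdd
  obtain ⟨c, hc, h⟩ := hW.lower
  refine ⟨fun u σ hu => (hW.tame.seqCont hu).log (hW.pos σ).ne', |Real.log C| + |Real.log c|,
    fun σ => ?_⟩
  have h1 := Real.log_le_log (hW.pos σ) ((le_abs_self _).trans (hC σ))
  have h2 := Real.log_le_log hc (h σ)
  refine abs_le.2 ⟨?_, ?_⟩
  · linarith [neg_abs_le (Real.log c), abs_nonneg (Real.log C)]
  · linarith [le_abs_self (Real.log C), abs_nonneg (Real.log c)]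

end IsWeight

/-- The condition of Holley's inequality for two weights. `HolleyLE W W` says that `W` is
log-supermodular, and `HolleyLE W W'` implies that `W' / W` is increasing. -/
def HolleyLE (W W' : Spin β → ℝ) : Prop :=
  ∀ σ ξ, W ξ * W' σ ≤ W (σ.inf ξ) * W' (σ.sup ξ)

namespace HolleyLE

variable {V V' W W' : Spin β → ℝ}

/-- Monotonicity of the likelihood ratio. -/
theorem ratio (hW : HolleyLE W W') {σ σ' : Spin β} (h : σ ≤ σ') :
    W σ' * W' σ ≤ W σ * W' σ' := by
  simpa [Spin.inf_eq_left h, Spin.sup_eq_right h] using hW σ σ'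

theorem mul (hW : HolleyLE W W') (hV : HolleyLE V V') (nW : 0 ≤ W) (nW' : 0 ≤ W') (nV : 0 ≤ V)
    (nV' : 0 ≤ V') : HolleyLE (fun σ => W σ * V σ) (fun σ => W' σ * V' σ) := fun σ ξ => by
  have := mul_le_mul (hW σ ξ) (hV σ ξ) (mul_nonneg (nV _) (nV' _)) (mul_nonneg (nW _) (nW' _))
  linarith

theorem prod {ι : Type*} (s : Finset ι) {W W' : ι → Spin β → ℝ} (hW : ∀ i, HolleyLE (W i) (W' i))
    (n : ∀ i, 0 ≤ W i) (n' : ∀ i, 0 ≤ W' i) :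
    HolleyLE (fun σ => ∏ i ∈ s, W i σ) (fun σ => ∏ i ∈ s, W' i σ) := fun σ ξ => by
  simp_rw [← Finset.prod_mul_distrib]
  exact Finset.prod_le_prod (fun i _ => mul_nonneg (n i _) (n' i _)) fun i _ => hW i σ ξ

/-- Multiplying a log-supermodular weight by an increasing function moves it up. -/
theorem mul_monotone (hW : HolleyLE W W) (nW : 0 ≤ W) {g : Spin β → ℝ} (hg : Monotone g)
    (ng : 0 ≤ g) : HolleyLE W fun σ => W σ * g σ := fun σ ξ => by
  have := mul_le_mul (hW σ ξ) (hg (σ.le_sup_left ξ)) (ng σ) (mul_nonneg (nW _) (nW _))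
  linarith

end HolleyLE

/-! ### The transfer operator, the kernel of the edge interaction, weights of subtrees -/

variable {lam : ℝ} {b : ℕ}

/-- The integral of `W` against the interaction with a neighboring spin `σ`. -/
def transfer (lam : ℝ) (W : Spin β → ℝ) (σ : Spin β) : ℝ :=
  ∫ ξ, Real.exp (dot σ.1 ξ.1) * W ξ ∂(freeSpin β lam)

theorem transfer_const_mul (c : ℝ) (W : Spin β → ℝ) (σ : Spin β) :
    transfer lam (fun ξ => c * W ξ) σ = c * transfer lam W σ := by
  simp_rw [transfer, mul_left_comm _ c]
  exact integral_const_mul _ _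

/-- Expectation under the law of a spin with weight `W`, given that a neighbor has spin `σ`. -/
def kernel (lam : ℝ) (W g : Spin β → ℝ) (σ : Spin β) : ℝ :=
  transfer lam (fun ξ => W ξ * g ξ) σ / transfer lam W σ

theorem kernel_const_mul (W g : Spin β → ℝ) (c : ℝ) (σ : Spin β) :
    kernel lam W (fun ξ => c * g ξ) σ = c * kernel lam W g σ := by
  simp_rw [kernel, mul_left_comm _ c, transfer_const_mul, mul_div_assoc]

/-- The unnormalized density, with respect to the free spin measure, of the law of the spin at `x`
under the Gibbs measure on the subtree of depth `n` rooted at `x`, when the interaction of `x` with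
its parent is left out. -/
def weight (lam : ℝ) (h : Icc (0 : ℝ) β → ℝ) (τ : Vertex b → Spin β) :
    ℕ → Vertex b → Spin β → ℝ
  | 0, x => fun σ => Real.exp (dot h σ.1) * ∏ i, Real.exp (dot σ.1 (τ (i :: x)).1)
  | n + 1, x => fun σ => Real.exp (dot h σ.1) * ∏ i, transfer lam (weight lam h τ n (i :: x)) σ

/-- With a constant boundary condition, all subtrees of the same depth have the same weight. -/
theorem weight_const_eq (h : Icc (0 : ℝ) β → ℝ) (ξ : Spin β) (n : ℕ) (x y : Vertex b) :
    weight lam h (fun _ => ξ) n x = weight lam h (fun _ => ξ) n y := by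
  induction n generalizing x y with
  | zero => rfl
  | succ n ih =>
    funext σ
    simp only [weight]
    congr 1
    exact Finset.prod_congr rfl fun i _ => by rw [ih (i :: x) (i :: y)]

/-! ### Examples of tame functions and the Holley order -/

variable [hβ : Fact (0 ≤ β)]

theorem tame_dot_left {f : Icc (0 : ℝ) β → ℝ} (hf : Integrable f (leb β)) :
    Tame fun σ : Spin β => dot f σ.1 :=
  ⟨seqContinuous_dot_left hf, _, abs_dot_le hf⟩

theorem tame_dot (σ : Spin β) : Tame fun ξ : Spin β => dot σ.1 ξ.1 := tame_dot_left σ.integrable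

theorem tame_dot_right (ξ : Spin β) : Tame fun σ : Spin β => dot σ.1 ξ.1 := by
  simp_rw [dot_comm _ ξ.1]
  exact tame_dot ξ

theorem holleyLE_exp_field {f : Icc (0 : ℝ) β → ℝ} (hf : Integrable f (leb β)) :
    HolleyLE (fun σ => Real.exp (dot f σ.1)) (fun σ => Real.exp (dot f σ.1)) := fun σ ξ => by
  rw [← Real.exp_add, ← Real.exp_add, dot_inf_add_dot_sup hf, add_comm]

theorem holleyLE_exp_dot {τ τ' : Spin β} (h : τ ≤ τ') :
    HolleyLE (fun σ => Real.exp (dot σ.1 τ.1)) (fun σ => Real.exp (dot σ.1 τ'.1)) := fun σ ξ => by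
  rw [← Real.exp_add, ← Real.exp_add, Real.exp_le_exp]
  have := dot_supermodular ξ σ τ τ'
  rwa [Spin.inf_eq_left h, Spin.sup_eq_right h, ξ.inf_comm, ξ.sup_comm] at this

/-! ### Monotonicity of the transfer operator and of the kernel -/

variable [hlam : Fact (0 ≤ lam)]

theorem tame_transfer_integrand {W : Spin β → ℝ} (hW : Tame W) (σ : Spin β) :
    Tame fun ξ => Real.exp (dot σ.1 ξ.1) * W ξ := (tame_dot σ).exp.mul hW

theorem integrable_transfer_integrand {W : Spin β → ℝ} (hW : Tame W) (σ : Spin β) :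
    Integrable (fun ξ => Real.exp (dot σ.1 ξ.1) * W ξ) (freeSpin β lam) :=
  (tame_transfer_integrand hW σ).integrable

theorem transfer_mono {V W : Spin β → ℝ} (hV : Tame V) (hW : Tame W) (h : V ≤ W) (σ : Spin β) :
    transfer lam V σ ≤ transfer lam W σ :=
  integral_mono (integrable_transfer_integrand hV σ) (integrable_transfer_integrand hW σ)
    fun ξ => mul_le_mul_of_nonneg_left (h ξ) (Real.exp_pos _).le

theorem transfer_add {V W : Spin β → ℝ} (hV : Tame V) (hW : Tame W) (σ : Spin β) :
    transfer lam (fun ξ => V ξ + W ξ) σ = transfer lam V σ + transfer lam W σ := by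
  simp_rw [transfer, mul_add]
  exact integral_add (integrable_transfer_integrand hV σ) (integrable_transfer_integrand hW σ)

theorem Tame.transfer {W : Spin β → ℝ} (hW : Tame W) : Tame (transfer lam W) := by
  obtain ⟨C, hC⟩ := hW.bdd
  have hb : ∀ σ ξ : Spin β, |Real.exp (dot σ.1 ξ.1) * W ξ| ≤ Real.exp β * C := fun σ ξ => by
    rw [abs_mul, Real.abs_exp]
    exact mul_le_mul (Real.exp_le_exp.2 ((le_abs_self _).trans (abs_dot_spin_le σ ξ))) (hC ξ)
      (abs_nonneg _) (Real.exp_pos _).le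
  refine ⟨fun u σ hu => ?_, Real.exp β * C, fun σ => ?_⟩
  · exact tendsto_integral_of_dominated_convergence (fun _ => Real.exp β * C)
      (fun n => (integrable_transfer_integrand hW (u n)).1) (integrable_const _)
      (fun n => Eventually.of_forall fun ξ => hb _ ξ)
      (Eventually.of_forall fun ξ => ((tame_dot_right ξ).seqCont hu).rexp.mul_const _)
  · have := norm_integral_le_of_norm_le_const (μ := freeSpin β lam)
      (f := fun ξ => Real.exp (dot σ.1 ξ.1) * W ξ) (Eventually.of_forall fun ξ => hb σ ξ)
    rwa [probReal_univ, mul_one] at this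

theorem IsWeight.transfer {W : Spin β → ℝ} (hW : IsWeight W) : IsWeight (transfer lam W) := by
  refine ⟨hW.tame.transfer, ?_⟩
  obtain ⟨c, hc, h⟩ := hW.lower
  refine ⟨Real.exp (-β) * c, by positivity, fun σ => ?_⟩
  have := integral_mono (μ := freeSpin β lam) (integrable_const (Real.exp (-β) * c))
    (integrable_transfer_integrand hW.tame σ) fun ξ => mul_le_mul
      (Real.exp_le_exp.2 (neg_le_of_abs_le (abs_dot_spin_le σ ξ))) (h ξ) hc.le (Real.exp_pos _).le
  rw [integral_const, probReal_univ, one_smul] at this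
  exact this

/-- The transfer operator preserves the Holley order; in particular it preserves
log-supermodularity. -/
theorem HolleyLE.transfer {W W' : Spin β → ℝ} (h : HolleyLE W W') (hW : Tame W) (hW' : Tame W')
    (nW : 0 ≤ W) (nW' : 0 ≤ W') : HolleyLE (transfer lam W) (transfer lam W') := fun σ ξ => by
  refine four_functions_freeSpin (tame_transfer_integrand hW _) (tame_transfer_integrand hW' _)
    (tame_transfer_integrand hW _) (tame_transfer_integrand hW' _)
    (fun _ => mul_nonneg (Real.exp_pos _).le (nW _))
    (fun _ => mul_nonneg (Real.exp_pos _).le (nW' _))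
    (fun _ => mul_nonneg (Real.exp_pos _).le (nW _))
    (fun _ => mul_nonneg (Real.exp_pos _).le (nW' _)) fun a b => ?_
  rw [mul_mul_mul_comm, mul_mul_mul_comm (Real.exp (dot (σ.inf ξ).1 _)), ← Real.exp_add,
    ← Real.exp_add]
  refine mul_le_mul (Real.exp_le_exp.2 ?_) ?_ (mul_nonneg (nW _) (nW' _)) (Real.exp_pos _).le
  · have := dot_supermodular ξ σ a b
    rwa [ξ.inf_comm, ξ.sup_comm] at this
  · have := h b a
    rwa [b.inf_comm, b.sup_comm] at this

/-- The interaction with a random spin is dominated by the interaction with the spin `+`. -/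
theorem holleyLE_transfer_plus {W : Spin β → ℝ} (hW : Tame W) (nW : 0 ≤ W) :
    HolleyLE (transfer lam W) fun σ => Real.exp (dot σ.1 (Spin.plus β).1) := fun σ ξ => by
  simp only [transfer]
  rw [← integral_mul_const, ← integral_mul_const]
  refine integral_mono ((integrable_transfer_integrand hW _).mul_const _)
    ((integrable_transfer_integrand hW _).mul_const _) fun ζ => ?_
  have h1 := mul_le_mul_of_nonneg_left (holleyLE_exp_dot ζ.le_plus σ ξ) (nW ζ)
  simp only at h1 ⊢
  linarith

section Kernel

variable {W V f g : Spin β → ℝ}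

theorem IsWeight.tame_kernel (hW : IsWeight W) (hg : Tame g) : Tame (kernel lam W g) :=
  IsWeight.tame_div (hW.tame.mul hg).transfer hW.transfer

theorem IsWeight.kernel_const (hW : IsWeight W) (c : ℝ) (σ : Spin β) :
    kernel lam W (fun _ => c) σ = c := by
  simp_rw [kernel, mul_comm _ c, transfer_const_mul]
  exact mul_div_cancel_right₀ c (hW.transfer.pos σ).ne'

theorem IsWeight.kernel_add (hW : IsWeight W) (hf : Tame f) (hg : Tame g) (σ : Spin β) :
    kernel lam W (fun ξ => f ξ + g ξ) σ = kernel lam W f σ + kernel lam W g σ := by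
  simp_rw [kernel, mul_add]
  rw [transfer_add (hW.tame.mul hf) (hW.tame.mul hg), add_div]

theorem IsWeight.kernel_sub (hW : IsWeight W) (hf : Tame f) (hg : Tame g) (σ : Spin β) :
    kernel lam W (fun ξ => f ξ - g ξ) σ = kernel lam W f σ - kernel lam W g σ := by
  have h := hW.kernel_add (lam := lam) hf ((Tame.const (-1)).mul hg) σ
  rw [kernel_const_mul] at h
  simpa [sub_eq_add_neg] using h

theorem IsWeight.kernel_le (hW : IsWeight W) (hf : Tame f) (hg : Tame g) (h : f ≤ g)
    (σ : Spin β) : kernel lam W f σ ≤ kernel lam W g σ :=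
  div_le_div_of_nonneg_right (transfer_mono (hW.tame.mul hf) (hW.tame.mul hg)
    (fun ξ => mul_le_mul_of_nonneg_left (h ξ) (hW.pos ξ).le) σ) (hW.transfer.pos σ).le

/-- The kernel of a log-supermodular weight maps increasing functions to increasing functions. -/
theorem IsWeight.monotone_kernel (hW : IsWeight W) (hWW : HolleyLE W W) (hg : Tame g)
    (hm : Monotone g) : Monotone (kernel lam W g) := fun σ σ' hσ => by
  -- adding a constant to `g`, one may assume that `g` is nonnegative
  obtain ⟨C, hC⟩ := hg.bdd
  have hgC : Tame fun ξ => g ξ + C := hg.add (Tame.const C)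
  have hnn : (0 : Spin β → ℝ) ≤ fun ξ => g ξ + C := fun ξ => by
    have := neg_le_of_abs_le (hC ξ)
    simp only [Pi.zero_apply]
    linarith
  have nW : 0 ≤ W := fun ξ => (hW.pos ξ).le
  have h1 := ((hWW.mul_monotone nW (fun _ _ h => add_le_add_left (hm h) C) hnn).transfer
    (lam := lam) hW.tame (hW.tame.mul hgC) nW fun ξ => mul_nonneg (nW ξ) (hnn ξ)).ratio hσ
  have h2 : kernel lam W (fun ξ => g ξ + C) σ ≤ kernel lam W (fun ξ => g ξ + C) σ' := by
    rw [kernel, kernel, div_le_div_iff₀ (hW.transfer.pos _) (hW.transfer.pos _)]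
    linarith
  rw [hW.kernel_add hg (Tame.const C), hW.kernel_add hg (Tame.const C), hW.kernel_const,
    hW.kernel_const] at h2
  linarith

/-- Increments of `log K (exp g)` are at least those of `exp (-ε) K g`, if `g` is increasing and
oscillates by at most `ε`. -/
theorem IsWeight.monotone_log_kernel_exp_sub (hW : IsWeight W) (hWW : HolleyLE W W) (hg : Tame g)
    (hm : Monotone g) {ε : ℝ} (hε : g (Spin.plus β) - g (Spin.minus β) ≤ ε) :
    Monotone fun σ => Real.log (kernel lam W (fun ξ => Real.exp (g ξ)) σ) -
      Real.exp (-ε) * kernel lam W g σ := fun σ σ' hσ => by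
  set c := Real.exp (g (Spin.minus β)) with hc
  have hc0 : 0 < c := Real.exp_pos _
  have h1 : Monotone fun ξ => Real.exp (g ξ) - c * g ξ := fun ξ ξ' hξ => by
    have e1 : c ≤ Real.exp (g ξ) := Real.exp_le_exp.2 (hm ξ.minus_le)
    have e2 := Real.add_one_le_exp (g ξ' - g ξ)
    have e3 : Real.exp (g ξ') = Real.exp (g ξ) * Real.exp (g ξ' - g ξ) := by
      rw [← Real.exp_add]; ring_nf
    have e4 := hm hξ
    simp only
    nlinarith [Real.exp_pos (g ξ)]
  have h2 := hW.monotone_kernel (lam := lam) hWW (hg.exp.sub ((Tame.const c).mul hg)) h1 hσ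
  rw [hW.kernel_sub hg.exp ((Tame.const c).mul hg), hW.kernel_sub hg.exp ((Tame.const c).mul hg),
    kernel_const_mul, kernel_const_mul] at h2
  have h3 := hW.monotone_kernel (lam := lam) hWW hg hm hσ
  have hlow : ∀ ξ, c ≤ kernel lam W (fun ξ => Real.exp (g ξ)) ξ := fun ξ => by
    have := hW.kernel_le (lam := lam) (Tame.const c) hg.exp
      (fun ζ => Real.exp_le_exp.2 (hm ζ.minus_le)) ξ
    rwa [hW.kernel_const] at this
  have hup : kernel lam W (fun ξ => Real.exp (g ξ)) σ' ≤ c * Real.exp ε := by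
    have := hW.kernel_le (lam := lam) hg.exp (Tame.const (c * Real.exp ε)) (fun ζ => by
      rw [hc, ← Real.exp_add, Real.exp_le_exp]
      linarith [hm ζ.le_plus]) σ'
    rwa [hW.kernel_const] at this
  set A := kernel lam W (fun ξ => Real.exp (g ξ)) σ
  set A' := kernel lam W (fun ξ => Real.exp (g ξ)) σ'
  have hA : 0 < A := hc0.trans_le (hlow σ)
  have hA' : 0 < A' := hc0.trans_le (hlow σ')
  have h4 : 1 - A / A' ≤ Real.log A' - Real.log A := by
    have := Real.log_le_sub_one_of_pos (div_pos hA hA')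
    rw [Real.log_div hA.ne' hA'.ne'] at this
    linarith
  have h5 : Real.exp (-ε) * (kernel lam W g σ' - kernel lam W g σ) ≤ 1 - A / A' := by
    rw [Real.exp_neg, one_sub_div hA'.ne', le_div_iff₀ hA', inv_mul_eq_div, div_mul_eq_mul_div,
      div_le_iff₀ (Real.exp_pos _)]
    have h6 := mul_le_mul_of_nonneg_left hup (sub_nonneg.2 h3)
    have h7 : c * (kernel lam W g σ' - kernel lam W g σ) ≤ A' - A := by linarith
    have h8 := mul_le_mul_of_nonneg_right h7 (Real.exp_pos ε).le
    linarith
  simp only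
  linarith

end Kernel

/-! ### Monotonicity of the weights of subtrees -/

variable {h : Icc (0 : ℝ) β → ℝ}

theorem isWeight_weight (hh : Integrable h (leb β)) (τ : Vertex b → Spin β) (n : ℕ) (x : Vertex b) :
    IsWeight (weight lam h τ n x) := by
  induction n generalizing x with
  | zero =>
    exact (IsWeight.exp (tame_dot_left hh)).mul (V := fun σ => Real.exp (dot h σ.1))
      (IsWeight.prod _ fun i => IsWeight.exp (tame_dot_right (τ (i :: x))))
  | succ n ih =>
    exact (IsWeight.exp (tame_dot_left hh)).mul (V := fun σ => Real.exp (dot h σ.1))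
      (IsWeight.prod _ fun i => (ih (i :: x)).transfer)

theorem holleyLE_weight (hh : Integrable h (leb β)) {τ τ' : Vertex b → Spin β}
    (hτ : τ ≤ τ') (n : ℕ) (x : Vertex b) :
    HolleyLE (weight lam h τ n x) (weight lam h τ' n x) := by
  have hexp : (0 : Spin β → ℝ) ≤ fun σ => Real.exp (dot h σ.1) := fun _ => (Real.exp_pos _).le
  induction n generalizing x with
  | zero =>
    exact (holleyLE_exp_field hh).mul (HolleyLE.prod _ (fun i => holleyLE_exp_dot (hτ (i :: x)))
      (fun i σ => (Real.exp_pos _).le) (fun i σ => (Real.exp_pos _).le)) hexp hexp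
      (fun σ => Finset.prod_nonneg fun i _ => (Real.exp_pos _).le)
      (fun σ => Finset.prod_nonneg fun i _ => (Real.exp_pos _).le)
  | succ n ih =>
    have hn : ∀ (τ : Vertex b → Spin β) i, 0 ≤ transfer lam (weight lam h τ n (i :: x)) :=
      fun τ i σ => ((isWeight_weight hh τ n (i :: x)).transfer.pos σ).le
    refine (holleyLE_exp_field hh).mul (HolleyLE.prod _ (fun i => (ih (i :: x)).transfer
      (isWeight_weight hh τ n _).tame (isWeight_weight hh τ' n _).tame
      (fun σ => ((isWeight_weight hh τ n _).pos σ).le)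
      (fun σ => ((isWeight_weight hh τ' n _).pos σ).le)) (hn τ) (hn τ')) hexp hexp
      (fun σ => Finset.prod_nonneg fun i _ => hn τ i σ)
      (fun σ => Finset.prod_nonneg fun i _ => hn τ' i σ)

/-- The weights of subtrees have uniformly bounded oscillation. -/
theorem weight_le_mul_weight (hh : Integrable h (leb β)) (τ : Vertex b → Spin β) (n : ℕ)
    (x : Vertex b) (σ ξ : Spin β) :
    weight lam h τ n x σ ≤
      Real.exp (2 * (∫ t, |h t| ∂(leb β)) + b * (2 * β)) * weight lam h τ n x ξ := by
  have h1 : Real.exp (dot h σ.1) ≤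
      Real.exp (2 * ∫ t, |h t| ∂(leb β)) * Real.exp (dot h ξ.1) := by
    rw [← Real.exp_add, Real.exp_le_exp]
    linarith [le_of_abs_le (abs_dot_le hh σ), neg_le_of_abs_le (abs_dot_le hh ξ)]
  have h2 : ∀ ζ : Spin β, Real.exp (dot σ.1 ζ.1) ≤ Real.exp (2 * β) * Real.exp (dot ξ.1 ζ.1) :=
    fun ζ => by
      rw [← Real.exp_add, Real.exp_le_exp]
      linarith [le_of_abs_le (abs_dot_spin_le σ ζ), neg_le_of_abs_le (abs_dot_spin_le ξ ζ)]
  have h3 : ∀ {A B : Fin b → ℝ}, (∀ i, 0 ≤ A i) → (∀ i, A i ≤ Real.exp (2 * β) * B i) →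
      Real.exp (dot h σ.1) * ∏ i, A i ≤
      Real.exp (2 * (∫ t, |h t| ∂(leb β)) + b * (2 * β)) * (Real.exp (dot h ξ.1) * ∏ i, B i) :=
    fun {A B} hA hAB => by
      have h4 := Finset.prod_le_prod (s := Finset.univ) (fun i _ => hA i) fun i _ => hAB i
      rw [Finset.prod_mul_distrib, Finset.prod_const, Finset.card_univ, Fintype.card_fin,
        ← Real.exp_nat_mul] at h4
      have h5 := mul_le_mul h1 h4 (Finset.prod_nonneg fun i _ => hA i) (by positivity)
      rw [Real.exp_add]
      linarith
  cases n with
  | zero => exact h3 (fun i => (Real.exp_pos _).le) fun i => h2 (τ (i :: x))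
  | succ n =>
    have hW := fun i => isWeight_weight (lam := lam) hh τ n (i :: x)
    refine h3 (A := fun i => transfer lam (weight lam h τ n (i :: x)) σ)
      (B := fun i => transfer lam (weight lam h τ n (i :: x)) ξ)
      (fun i => ((hW i).transfer.pos σ).le) fun i => ?_
    rw [transfer, transfer, ← integral_const_mul]
    refine integral_mono (integrable_transfer_integrand (hW i).tame _)
      ((integrable_transfer_integrand (hW i).tame _).const_mul _) fun ζ => ?_
    have := mul_le_mul_of_nonneg_right (h2 ζ) ((hW i).pos ζ).le
    simp only
    linarith

end Weights

section Decay

variable {β : ℝ}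

/-! ### Chains of kernels -/

/-- The difference between the values of a function at the spins `+` and `-`. For increasing
functions this is the oscillation. -/
def osc (g : Spin β → ℝ) : ℝ := g (Spin.plus β) - g (Spin.minus β)

theorem osc_nonneg {g : Spin β → ℝ} (hm : Monotone g) : 0 ≤ osc g :=
  sub_nonneg.2 (hm (Spin.minus_le _))

/-- Two weights are `η`-close if the logarithm of their ratio oscillates by at most `η`. -/
def Close (η : ℝ) (W W' : Spin β → ℝ) : Prop :=
  ∀ σ ξ, W σ * W' ξ ≤ Real.exp η * (W ξ * W' σ)

theorem Close.symm {η : ℝ} {W W' : Spin β → ℝ} (h : Close η W W') : Close η W' W := fun σ ξ => by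
  have := h ξ σ
  linarith

/-- The logarithm of the ratio of the weights of `+` and `-`. -/
def logRatio (W : Spin β → ℝ) : ℝ := Real.log (W (Spin.plus β) / W (Spin.minus β))

theorem HolleyLE.logRatio_le {V W : Spin β → ℝ} (hVW : HolleyLE V W) (hV : IsWeight V)
    (hW : IsWeight W) : logRatio V ≤ logRatio W := by
  refine Real.log_le_log (div_pos (hV.pos _) (hV.pos _)) ?_
  rw [div_le_div_iff₀ (hV.pos _) (hW.pos _)]
  have := hVW.ratio (Spin.minus_le (Spin.plus β))
  linarith

/-- The function `g` of the spin at a vertex, averaged successively over the spins at the first `k`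
vertices of a path, whose weights are `w 0, w 1, …`; it is a function of the spin at the next
vertex of the path. -/
def chain (lam : ℝ) (w : ℕ → Spin β → ℝ) (g : Spin β → ℝ) : ℕ → Spin β → ℝ
  | 0 => g
  | k + 1 => kernel lam (w k) (chain lam w g k)

theorem chain_add (lam : ℝ) (w : ℕ → Spin β → ℝ) (g : Spin β → ℝ) (i k : ℕ) :
    chain lam w g (i + k) = chain lam (fun j => w (i + j)) (chain lam w g i) k := by
  induction k with
  | zero => rfl
  | succ k ih => rw [← add_assoc, chain, ih, chain]

/-- One step of the recursion for the weights of subtrees, when all children have the same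
weight. -/
def recStep (b : ℕ) (lam : ℝ) (h : Icc (0 : ℝ) β → ℝ) (V : Spin β → ℝ) (σ : Spin β) : ℝ :=
  Real.exp (dot h σ.1) * transfer lam V σ ^ b

/-- The weight of a subtree of depth `n` with plus boundary condition. -/
def plusWeight (b : ℕ) (lam : ℝ) (h : Icc (0 : ℝ) β → ℝ) (n : ℕ) : Spin β → ℝ :=
  weight lam h (fun _ : Vertex b => Spin.plus β) n []

theorem plusWeight_succ (b : ℕ) (lam : ℝ) (h : Icc (0 : ℝ) β → ℝ) (n : ℕ) :
    plusWeight b lam h (n + 1) = recStep b lam h (plusWeight b lam h n) := by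
  funext σ
  simp only [plusWeight, weight, recStep]
  simp_rw [weight_const_eq h (Spin.plus β) n _ ([] : Vertex b)]
  simp

/-- The plus weight of depth `m`, tilted by the exponential of `g`, and carried `j` steps up the
tree by the recursion. -/
def tilt (b : ℕ) (lam : ℝ) (h : Icc (0 : ℝ) β → ℝ) (m : ℕ) (g : Spin β → ℝ) : ℕ → Spin β → ℝ
  | 0 => fun σ => plusWeight b lam h m σ * Real.exp (g σ)
  | j + 1 => recStep b lam h (tilt b lam h m g j)

variable {lam : ℝ} [hβ : Fact (0 ≤ β)] [hlam : Fact (0 ≤ lam)]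

theorem IsWeight.kernel_le_apply_plus {W g : Spin β → ℝ} (hW : IsWeight W) (hg : Tame g)
    (hm : Monotone g) (σ : Spin β) : kernel lam W g σ ≤ g (Spin.plus β) := by
  have := hW.kernel_le (lam := lam) hg (Tame.const (g (Spin.plus β))) (fun ξ => hm ξ.le_plus) σ
  rwa [hW.kernel_const] at this

theorem IsWeight.apply_minus_le_kernel {W g : Spin β → ℝ} (hW : IsWeight W) (hg : Tame g)
    (hm : Monotone g) (σ : Spin β) : g (Spin.minus β) ≤ kernel lam W g σ := by
  have := hW.kernel_le (lam := lam) (Tame.const (g (Spin.minus β))) hg (fun ξ => hm ξ.minus_le) σ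
  rwa [hW.kernel_const] at this

section Chain

variable {w w' : ℕ → Spin β → ℝ} {g : Spin β → ℝ}

theorem tame_chain (hw : ∀ j, IsWeight (w j)) (hg : Tame g) (k : ℕ) :
    Tame (chain lam w g k) := by
  induction k with
  | zero => exact hg
  | succ k ih => exact (hw k).tame_kernel ih

theorem monotone_chain (hw : ∀ j, IsWeight (w j)) (hww : ∀ j, HolleyLE (w j) (w j)) (hg : Tame g)
    (hm : Monotone g) (k : ℕ) : Monotone (chain lam w g k) := by
  induction k with
  | zero => exact hm
  | succ k ih => exact (hw k).monotone_kernel (hww k) (tame_chain hw hg k) ih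

theorem osc_chain_le (hw : ∀ j, IsWeight (w j)) (hww : ∀ j, HolleyLE (w j) (w j)) (hg : Tame g)
    (hm : Monotone g) (k : ℕ) : osc (chain lam w g k) ≤ osc g := by
  induction k with
  | zero => exact le_rfl
  | succ k ih =>
    have h1 := tame_chain (lam := lam) hw hg k
    have h2 := monotone_chain (lam := lam) hw hww hg hm k
    refine (sub_le_sub ((hw k).kernel_le_apply_plus h1 h2 _)
      ((hw k).apply_minus_le_kernel h1 h2 _)).trans ih

theorem chain_le_apply_plus (hw : ∀ j, IsWeight (w j)) (hww : ∀ j, HolleyLE (w j) (w j))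
    (hg : Tame g) (hm : Monotone g) (k : ℕ) :
    chain lam w g k (Spin.plus β) ≤ g (Spin.plus β) := by
  induction k with
  | zero => exact le_rfl
  | succ k ih =>
    exact ((hw k).kernel_le_apply_plus (tame_chain hw hg k) (monotone_chain hw hww hg hm k) _).trans
      ih

theorem chain_nonneg (hw : ∀ j, IsWeight (w j)) (hg : Tame g) (ng : 0 ≤ g) (k : ℕ) :
    0 ≤ chain lam w g k := by
  induction k with
  | zero => exact ng
  | succ k ih =>
    intro ξ
    have := (hw k).kernel_le (lam := lam) (Tame.const 0) (tame_chain (lam := lam) hw hg k) ih ξ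
    rwa [(hw k).kernel_const] at this

theorem chain_sub_const (hw : ∀ j, IsWeight (w j)) (hg : Tame g) (c : ℝ) (k : ℕ) (σ : Spin β) :
    chain lam w (fun ξ => g ξ - c) k σ = chain lam w g k σ - c := by
  induction k generalizing σ with
  | zero => rfl
  | succ k ih =>
    simp only [chain]
    rw [funext ih, (hw k).kernel_sub (tame_chain hw hg k) (Tame.const c), (hw k).kernel_const]

/-- The kernels of close weights are comparable on nonnegative functions. -/
theorem Close.kernel_le {η : ℝ} {W W' : Spin β → ℝ} (h : Close η W W') (hW : IsWeight W)
    (hW' : IsWeight W') (hg : Tame g) (ng : 0 ≤ g) (σ : Spin β) :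
    kernel lam W g σ ≤ Real.exp η * kernel lam W' g σ := by
  have h1 : ∀ ξ, W ξ * transfer lam W' σ ≤ Real.exp η * transfer lam W σ * W' ξ := fun ξ => by
    have h2 := integral_mono (μ := freeSpin β lam)
      ((integrable_transfer_integrand hW'.tame σ).const_mul (W ξ))
      ((integrable_transfer_integrand hW.tame σ).const_mul (Real.exp η * W' ξ)) fun ζ => by
        have h3 := mul_le_mul_of_nonneg_left (h ξ ζ) (Real.exp_pos (dot σ.1 ζ.1)).le
        simp only
        linarith
    rw [integral_const_mul, integral_const_mul] at h2
    change W ξ * transfer lam W' σ ≤ Real.exp η * W' ξ * transfer lam W σ at h2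
    linarith
  have h4 := transfer_mono (lam := lam) (V := fun ξ => transfer lam W' σ * (W ξ * g ξ))
    (W := fun ξ => Real.exp η * transfer lam W σ * (W' ξ * g ξ))
    ((Tame.const _).mul (hW.tame.mul hg)) ((Tame.const _).mul (hW'.tame.mul hg)) (fun ξ => by
      have := mul_le_mul_of_nonneg_right (h1 ξ) (ng ξ)
      simp only
      linarith) σ
  rw [transfer_const_mul, transfer_const_mul] at h4
  rw [kernel, kernel, mul_div_assoc', div_le_div_iff₀ (hW.transfer.pos σ) (hW'.transfer.pos σ)]
  linarith

theorem chain_le_of_close {η : ℝ} (hw : ∀ j, IsWeight (w j)) (hw' : ∀ j, IsWeight (w' j))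
    (hc : ∀ j, Close η (w j) (w' j)) (hg : Tame g) (ng : 0 ≤ g) (k : ℕ) (σ : Spin β) :
    chain lam w g k σ ≤ Real.exp (k * η) * chain lam w' g k σ := by
  induction k generalizing σ with
  | zero => simp [chain]
  | succ k ih =>
    simp only [chain]
    refine ((hc k).kernel_le (hw k) (hw' k) (tame_chain hw hg k)
      (chain_nonneg hw hg ng k) σ).trans ?_
    have h1 := (hw' k).kernel_le (lam := lam) (tame_chain hw hg k)
      ((Tame.const (Real.exp (k * η))).mul (tame_chain hw' hg k)) ih σ
    rw [kernel_const_mul] at h1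
    have h2 := mul_le_mul_of_nonneg_left h1 (Real.exp_pos η).le
    rw [← mul_assoc, ← Real.exp_add] at h2
    convert h2 using 3
    push_cast
    ring

/-- Chains of close kernels have close oscillations. -/
theorem osc_chain_le_of_close {η : ℝ} (hη : 0 ≤ η) (hw : ∀ j, IsWeight (w j))
    (hw' : ∀ j, IsWeight (w' j)) (hc : ∀ j, Close η (w j) (w' j))
    (hww' : ∀ j, HolleyLE (w' j) (w' j)) (hg : Tame g) (hm : Monotone g) (k : ℕ) :
    osc (chain lam w g k) ≤ osc (chain lam w' g k) +
      (Real.exp (k * η) - Real.exp (-(k * η))) * osc g := by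
  -- subtracting a constant, one may assume that `g` vanishes at `-`
  have hG : Tame fun ξ => g ξ - g (Spin.minus β) := hg.sub (Tame.const _)
  have nG : (0 : Spin β → ℝ) ≤ fun ξ => g ξ - g (Spin.minus β) := fun ξ =>
    sub_nonneg.2 (hm ξ.minus_le)
  have h1 := chain_le_of_close (lam := lam) hw hw' hc hG nG k (Spin.plus β)
  have h2 := chain_le_of_close (lam := lam) hw' hw (fun j => (hc j).symm) hG nG k (Spin.minus β)
  rw [chain_sub_const hw hg, chain_sub_const hw' hg] at h1 h2
  have h3 := chain_le_apply_plus (lam := lam) hw' hww' hg hm k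
  have h5 := monotone_chain (lam := lam) hw' hww' hg hm k (Spin.minus_le (Spin.plus β))
  set A := chain lam w' g k (Spin.plus β) - g (Spin.minus β)
  set B := chain lam w' g k (Spin.minus β) - g (Spin.minus β)
  set A' := chain lam w g k (Spin.plus β) - g (Spin.minus β)
  set B' := chain lam w g k (Spin.minus β) - g (Spin.minus β)
  have hx : 0 ≤ (k : ℝ) * η := by positivity
  have h6 : Real.exp (-(k * η)) * B ≤ B' := by
    rw [Real.exp_neg, inv_mul_le_iff₀ (Real.exp_pos _)]
    exact h2
  have h7 : Real.exp (-(k * η)) ≤ 1 := Real.exp_le_one_iff.2 (by linarith)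
  have h8 : 1 ≤ Real.exp (k * η) := Real.one_le_exp hx
  have h9 : B ≤ A := sub_le_sub_right h5 _
  have h10 : A ≤ osc g := sub_le_sub_right h3 _
  have h11 : osc (chain lam w g k) = A' - B' := by simp only [osc, A', B']; ring
  have h12 : osc (chain lam w' g k) = A - B := by simp only [osc, A, B]; ring
  rw [h11, h12]
  have h13 := mul_le_mul_of_nonneg_left h10 (show 0 ≤ Real.exp (k * η) - Real.exp (-(k * η)) by
    linarith)
  nlinarith [mul_nonneg (sub_nonneg.2 h7) (sub_nonneg.2 h9)]

end Chain

/-! ### Plus boundary conditions -/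

variable {b : ℕ} {h : Icc (0 : ℝ) β → ℝ}

theorem isWeight_plusWeight (hh : Integrable h (leb β)) (n : ℕ) :
    IsWeight (plusWeight b lam h n) := isWeight_weight hh _ _ _

theorem holleyLE_plusWeight (hh : Integrable h (leb β)) (n : ℕ) :
    HolleyLE (plusWeight b lam h n) (plusWeight b lam h n) := holleyLE_weight hh le_rfl _ _

theorem IsWeight.recStep (hh : Integrable h (leb β)) {V : Spin β → ℝ} (hV : IsWeight V) :
    IsWeight (recStep b lam h V) := by
  have := (IsWeight.exp (tame_dot_left hh)).mul (V := fun σ => Real.exp (dot h σ.1))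
    (IsWeight.prod (Finset.univ : Finset (Fin b)) fun _ => hV.transfer (lam := lam))
  simp only [Finset.prod_const, Finset.card_univ, Fintype.card_fin] at this
  exact this

theorem HolleyLE.exp_field_mul_pow (hh : Integrable h (leb β)) {V V' : Spin β → ℝ}
    (hVV : HolleyLE V V') (nV : 0 ≤ V) (nV' : 0 ≤ V') :
    HolleyLE (fun σ => Real.exp (dot h σ.1) * V σ ^ b) (fun σ => Real.exp (dot h σ.1) * V' σ ^ b) :=
  fun σ ξ => by
    have h1 := pow_le_pow_left₀ (mul_nonneg (nV _) (nV' _)) (hVV σ ξ) b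
    have h2 := mul_le_mul (holleyLE_exp_field hh σ ξ) h1
      (pow_nonneg (mul_nonneg (nV _) (nV' _)) _) (by positivity)
    rw [mul_pow, mul_pow] at h2
    linarith

theorem HolleyLE.recStep (hh : Integrable h (leb β)) {V V' : Spin β → ℝ}
    (hVV : HolleyLE V V') (hV : IsWeight V) (hV' : IsWeight V') :
    HolleyLE (recStep b lam h V) (recStep b lam h V') :=
  (hVV.transfer (lam := lam) hV.tame hV'.tame (fun σ => (hV.pos σ).le)
    fun σ => (hV'.pos σ).le).exp_field_mul_pow hh (fun σ => (hV.transfer.pos σ).le)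
    fun σ => (hV'.transfer.pos σ).le

/-- The plus boundary condition dominates the result of every step of the recursion. -/
theorem holleyLE_recStep_plusWeight_zero (hh : Integrable h (leb β)) {V : Spin β → ℝ}
    (hV : IsWeight V) : HolleyLE (recStep b lam h V) (plusWeight b lam h 0) := by
  have := (holleyLE_transfer_plus (lam := lam) hV.tame fun σ => (hV.pos σ).le).exp_field_mul_pow
    (b := b) hh (fun σ => (hV.transfer.pos σ).le) fun σ => (Real.exp_pos _).le
  have h0 : plusWeight b lam h 0 = fun σ =>
      Real.exp (dot h σ.1) * Real.exp (dot σ.1 (Spin.plus β).1) ^ b := by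
    funext σ
    simp [plusWeight, weight]
  rw [h0]
  exact this

theorem holleyLE_plusWeight_succ (hh : Integrable h (leb β)) (n : ℕ) :
    HolleyLE (plusWeight b lam h (n + 1)) (plusWeight b lam h n) := by
  induction n with
  | zero =>
    rw [plusWeight_succ]
    exact holleyLE_recStep_plusWeight_zero hh (isWeight_plusWeight hh 0)
  | succ n ih =>
    have := ih.recStep (b := b) (lam := lam) hh (isWeight_plusWeight hh _)
      (isWeight_plusWeight hh _)
    rwa [← plusWeight_succ, ← plusWeight_succ] at this

/-- As the depth grows, the log ratio of the plus weights decreases, and it is bounded. -/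
theorem exists_logRatio_plusWeight_le (hh : Integrable h (leb β)) {ε : ℝ} (hε : 0 < ε) :
    ∃ J, ∀ j m, J ≤ j →
      logRatio (plusWeight b lam h j) - logRatio (plusWeight b lam h m) ≤ ε := by
  have hanti : Antitone fun n => logRatio (plusWeight b lam h n) := antitone_nat_of_succ_le fun n =>
    (holleyLE_plusWeight_succ hh n).logRatio_le (isWeight_plusWeight hh _)
      (isWeight_plusWeight hh _)
  have hbdd : BddBelow (range fun n => logRatio (plusWeight b lam h n)) := by
    refine ⟨-(2 * (∫ t, |h t| ∂(leb β)) + b * (2 * β)), ?_⟩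
    rintro _ ⟨n, rfl⟩
    have h1 := weight_le_mul_weight (lam := lam) hh (fun _ : Vertex b => Spin.plus β) n []
      (Spin.minus β) (Spin.plus β)
    have h2 := (isWeight_plusWeight (b := b) (lam := lam) hh n).pos
    simp only [logRatio]
    rw [Real.le_log_iff_exp_le (div_pos (h2 _) (h2 _)), le_div_iff₀ (h2 _), Real.exp_neg,
      inv_mul_le_iff₀ (Real.exp_pos _)]
    exact h1
  have hlim := tendsto_atTop_ciInf hanti hbdd
  obtain ⟨J, hJ⟩ := (hlim.eventually (gt_mem_nhds (lt_add_of_pos_right _ hε))).exists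
  refine ⟨J, fun j m hj => ?_⟩
  have h1 := hanti hj
  have h2 := ciInf_le hbdd m
  simp only at h1 h2 hJ
  linarith

section Tilt

variable {m : ℕ} {g : Spin β → ℝ}

theorem isWeight_tilt (hh : Integrable h (leb β)) (hg : Tame g) (j : ℕ) :
    IsWeight (tilt b lam h m g j) := by
  induction j with
  | zero =>
    exact (isWeight_plusWeight (b := b) (lam := lam) hh m).mul (IsWeight.exp hg)
  | succ j ih => exact ih.recStep hh

/-- An increasing tilt moves the plus weights up at every level. -/
theorem plusWeight_holleyLE_tilt (hh : Integrable h (leb β)) (hg : Tame g) (hm : Monotone g)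
    (j : ℕ) : HolleyLE (plusWeight b lam h (m + j)) (tilt b lam h m g j) := by
  induction j with
  | zero =>
    exact (holleyLE_plusWeight (b := b) (lam := lam) hh m).mul_monotone
      (fun σ => ((isWeight_plusWeight (b := b) (lam := lam) hh m).pos σ).le)
      (fun _ _ h => Real.exp_le_exp.2 (hm h))
      fun σ => (Real.exp_pos _).le
  | succ j ih =>
    rw [← add_assoc, plusWeight_succ]
    exact ih.recStep hh (isWeight_plusWeight hh _) (isWeight_tilt hh hg j)

/-- After one step up, a tilted weight is dominated by the plus weight of the tree that ends right
there, however large the tilt: the spins below it are at most `+`. -/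
theorem tilt_succ_holleyLE_plusWeight (hh : Integrable h (leb β)) (hg : Tame g) (j : ℕ) :
    HolleyLE (tilt b lam h m g (j + 1)) (plusWeight b lam h j) := by
  induction j with
  | zero => exact holleyLE_recStep_plusWeight_zero hh (isWeight_tilt hh hg 0)
  | succ j ih =>
    rw [plusWeight_succ]
    exact ih.recStep hh (isWeight_tilt hh hg (j + 1)) (isWeight_plusWeight hh _)

/-- The effect of a tilt `j` steps higher up in the tree, on a logarithmic scale. -/
def logTilt (b : ℕ) (lam : ℝ) (h : Icc (0 : ℝ) β → ℝ) (m : ℕ) (g : Spin β → ℝ) (j : ℕ)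
    (σ : Spin β) : ℝ :=
  Real.log (tilt b lam h m g j σ / plusWeight b lam h (m + j) σ)

theorem logTilt_zero (hh : Integrable h (leb β)) : logTilt b lam h m g 0 = g := by
  funext σ
  rw [logTilt, tilt, add_zero, mul_div_cancel_left₀ _ ((isWeight_plusWeight hh m).pos σ).ne',
    Real.log_exp]

theorem tilt_eq (hh : Integrable h (leb β)) (hg : Tame g) (j : ℕ) (σ : Spin β) :
    tilt b lam h m g j σ =
      plusWeight b lam h (m + j) σ * Real.exp (logTilt b lam h m g j σ) := by
  have h1 := (isWeight_plusWeight (b := b) (lam := lam) hh (m + j)).pos σ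
  rw [logTilt, Real.exp_log (div_pos ((isWeight_tilt hh hg j).pos σ) h1), mul_div_cancel₀ _ h1.ne']

theorem logTilt_succ (hh : Integrable h (leb β)) (hg : Tame g) (j : ℕ) (σ : Spin β) :
    logTilt b lam h m g (j + 1) σ = b * Real.log (kernel lam (plusWeight b lam h (m + j))
      (fun ξ => Real.exp (logTilt b lam h m g j ξ)) σ) := by
  rw [logTilt, ← add_assoc, plusWeight_succ, tilt, recStep, recStep,
    mul_div_mul_left _ _ (Real.exp_pos _).ne', ← div_pow, Real.log_pow, kernel]
  rw [funext (tilt_eq hh hg j)]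

theorem tame_logTilt (hh : Integrable h (leb β)) (hg : Tame g) (j : ℕ) :
    Tame (logTilt b lam h m g j) := by
  have h1 := fun σ => (isWeight_tilt (b := b) (lam := lam) (m := m) hh hg j).pos σ
  have h2 := fun σ => (isWeight_plusWeight (b := b) (lam := lam) hh (m + j)).pos σ
  have : logTilt b lam h m g j = fun σ => Real.log (tilt b lam h m g j σ) -
      Real.log (plusWeight b lam h (m + j) σ) := funext fun σ =>
    Real.log_div (h1 σ).ne' (h2 σ).ne'
  rw [this]
  exact (isWeight_tilt hh hg j).tame_log.sub (isWeight_plusWeight hh _).tame_log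

theorem monotone_logTilt (hh : Integrable h (leb β)) (hg : Tame g) (hm : Monotone g) (j : ℕ) :
    Monotone (logTilt b lam h m g j) := fun σ σ' hσ => by
  have h1 := fun σ => (isWeight_tilt (b := b) (lam := lam) (m := m) hh hg j).pos σ
  have h2 := fun σ => (isWeight_plusWeight (b := b) (lam := lam) hh (m + j)).pos σ
  refine Real.log_le_log (div_pos (h1 _) (h2 _)) ?_
  rw [div_le_div_iff₀ (h2 _) (h2 _)]
  have := (plusWeight_holleyLE_tilt (b := b) (lam := lam) (m := m) hh hg hm j).ratio hσ
  linarith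

theorem osc_logTilt_eq (hh : Integrable h (leb β)) (hg : Tame g) (j : ℕ) :
    osc (logTilt b lam h m g j) =
      logRatio (tilt b lam h m g j) - logRatio (plusWeight b lam h (m + j)) := by
  have h1 := fun σ => ((isWeight_tilt (b := b) (lam := lam) (m := m) hh hg j).pos σ).ne'
  have h2 := fun σ => ((isWeight_plusWeight (b := b) (lam := lam) hh (m + j)).pos σ).ne'
  simp only [osc, logTilt, logRatio]
  rw [Real.log_div (h1 _) (h2 _), Real.log_div (h1 _) (h2 _), Real.log_div (h1 _) (h1 _),
    Real.log_div (h2 _) (h2 _)]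
  ring

theorem osc_logTilt_succ_le (hh : Integrable h (leb β)) (hg : Tame g) (hm : Monotone g) (j : ℕ) :
    osc (logTilt b lam h m g (j + 1)) ≤ b * osc (logTilt b lam h m g j) := by
  have hW := isWeight_plusWeight (b := b) (lam := lam) hh (m + j)
  have ht := tame_logTilt (b := b) (lam := lam) (m := m) hh hg j
  have hmt : Monotone fun ξ => Real.exp (logTilt b lam h m g j ξ) := fun _ _ hξ =>
    Real.exp_le_exp.2 (monotone_logTilt hh hg hm j hξ)
  have hlow := fun σ => hW.apply_minus_le_kernel (lam := lam) ht.exp hmt σ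
  have hup := hW.kernel_le_apply_plus (lam := lam) ht.exp hmt (Spin.plus β)
  have h1 := Real.log_le_log (Real.exp_pos _) (hlow (Spin.minus β))
  have h2 := Real.log_le_log ((Real.exp_pos _).trans_le (hlow (Spin.plus β))) hup
  rw [Real.log_exp] at h1 h2
  rw [osc, logTilt_succ hh hg, logTilt_succ hh hg, ← mul_sub]
  exact mul_le_mul_of_nonneg_left (sub_le_sub h2 h1) (Nat.cast_nonneg b)

/-- While a tilt is small, going up one level multiplies its effect on a logarithmic scale by `b`,
up to a factor that is close to `1`, because all `b` children are tilted. -/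
theorem monotone_logTilt_sub_chain (hh : Integrable h (leb β)) (hg : Tame g) (hm : Monotone g)
    {ε : ℝ} (k : ℕ) (hε : ∀ j < k, osc (logTilt b lam h m g j) ≤ ε) :
    Monotone fun σ => logTilt b lam h m g k σ - (b * Real.exp (-ε)) ^ k *
      chain lam (fun j => plusWeight b lam h (m + j)) g k σ := by
  induction k with
  | zero => simp [logTilt_zero hh, chain, monotone_const]
  | succ k ih =>
    have hW := isWeight_plusWeight (b := b) (lam := lam) hh (m + k)
    have hWW := holleyLE_plusWeight (b := b) (lam := lam) hh (m + k)
    have ht := tame_logTilt (b := b) (lam := lam) (m := m) hh hg k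
    have hc := tame_chain (lam := lam) (w := fun j => plusWeight b lam h (m + j))
      (fun j => isWeight_plusWeight hh _) hg k
    intro σ σ' hσ
    have h1 := hW.monotone_log_kernel_exp_sub (lam := lam) hWW ht (monotone_logTilt hh hg hm k)
      (hε k k.lt_succ_self) hσ
    have h2 := hW.monotone_kernel (lam := lam) hWW (ht.sub ((Tame.const _).mul hc))
      (ih fun j hj => hε j (hj.trans k.lt_succ_self)) hσ
    rw [hW.kernel_sub ht ((Tame.const _).mul hc), hW.kernel_sub ht ((Tame.const _).mul hc),
      kernel_const_mul, kernel_const_mul] at h2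
    simp only [logTilt_succ hh hg, chain] at h1 ⊢
    have h3 := mul_le_mul_of_nonneg_left h1 (Nat.cast_nonneg (α := ℝ) b)
    have h4 := mul_le_mul_of_nonneg_left h2
      (mul_nonneg (Nat.cast_nonneg (α := ℝ) b) (Real.exp_pos (-ε)).le)
    rw [pow_succ']
    linarith

end Tilt

/-- Decay of correlations for plus boundary conditions. A small tilt by `g` of all spins at distance
`k` below a vertex is dominated by plus boundary conditions, so that its effect on the vertex stays
small, whereas it is at least the total influence of the vertex on the `b ^ k` tilted spins. -/
theorem exists_osc_chain_plusWeight_le (hb : 2 ≤ b) (hh : Integrable h (leb β)) {ε : ℝ}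
    (hε : 0 < ε) :
    ∃ C, 0 < C ∧ ∀ (m k : ℕ) (g : Spin β → ℝ) (a : ℝ), Tame g → Monotone g → 0 < a → osc g ≤ a →
      osc (chain lam (fun j => plusWeight b lam h (m + j)) g k) ≤ C * (Real.exp ε / b) ^ k * a := by
  obtain ⟨J, hJ⟩ := exists_logRatio_plusWeight_le (b := b) (lam := lam) hh hε
  have hb1 : (1 : ℝ) ≤ b := by exact_mod_cast (by omega : 1 ≤ b)
  have hb0 : (0 : ℝ) < b := by linarith
  refine ⟨b ^ (J + 1), by positivity, fun m k g a hg hm ha hga => ?_⟩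
  -- this size of the tilt keeps its effect below `ε` on the first `J + 1` levels
  set s : ℝ := ε / (b ^ (J + 1) * a) with hs
  have hs0 : 0 < s := by positivity
  have hsg : Tame fun σ => s * g σ := (Tame.const s).mul hg
  have hsm : Monotone fun σ => s * g σ := fun _ _ hσ => mul_le_mul_of_nonneg_left (hm hσ) hs0.le
  have hsosc : osc (fun σ => s * g σ) = s * osc g := by simp only [osc]; ring
  have hsmall : ∀ j, osc (logTilt b lam h m (fun σ => s * g σ) j) ≤ b ^ j * (s * a) := fun j => by
    induction j with
    | zero =>
      rw [logTilt_zero hh, hsosc, pow_zero, one_mul]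
      exact mul_le_mul_of_nonneg_left hga hs0.le
    | succ j ih =>
      refine (osc_logTilt_succ_le hh hsg hsm j).trans ?_
      rw [pow_succ', mul_assoc]
      exact mul_le_mul_of_nonneg_left ih hb0.le
  have hosc : ∀ j, osc (logTilt b lam h m (fun σ => s * g σ) j) ≤ ε := fun j => by
    by_cases hj : j ≤ J + 1
    · refine (hsmall j).trans ?_
      have h1 : s * a = ε / b ^ (J + 1) := by rw [hs]; field_simp
      rw [h1, mul_div_assoc', div_le_iff₀ (by positivity), mul_comm ε]
      exact mul_le_mul_of_nonneg_right (pow_le_pow_right₀ hb1 hj) hε.le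
    · obtain ⟨i, rfl⟩ : ∃ i, j = i + 1 := ⟨j - 1, by omega⟩
      rw [osc_logTilt_eq hh hsg]
      have h1 := (tilt_succ_holleyLE_plusWeight (b := b) (lam := lam) (m := m) hh hsg i).logRatio_le
        (isWeight_tilt hh hsg _) (isWeight_plusWeight hh _)
      have h2 := hJ i (m + (i + 1)) (by omega)
      linarith
  have h1 := monotone_logTilt_sub_chain (lam := lam) (m := m) hh hsg hsm k (fun j _ => hosc j)
    (Spin.minus_le (Spin.plus β))
  have h2 : ∀ (k : ℕ) σ, chain lam (fun j => plusWeight b lam h (m + j)) (fun σ => s * g σ) k σ =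
      s * chain lam (fun j => plusWeight b lam h (m + j)) g k σ := fun k => by
    induction k with
    | zero => intro σ; rfl
    | succ k ih =>
      intro σ
      simp only [chain]
      rw [funext ih, kernel_const_mul]
  simp only [h2] at h1
  have h3 := hosc k
  have h4 : (b * Real.exp (-ε)) ^ k *
      (s * osc (chain lam (fun j => plusWeight b lam h (m + j)) g k))
      ≤ ε := by
    simp only [osc] at h3 ⊢
    linarith
  have h5 : (b * Real.exp (-ε)) ^ k * (Real.exp ε / b) ^ k = 1 := by
    rw [← mul_pow, Real.exp_neg]
    field_simp
    simp
  have h6 : 0 < b * Real.exp (-ε) := by positivity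
  have h7 : ε = s * (b ^ (J + 1) * a) := by rw [hs]; field_simp
  clear_value s
  have h8 : (b * Real.exp (-ε)) ^ k * s *
      osc (chain lam (fun j => plusWeight b lam h (m + j)) g k) ≤ (b * Real.exp (-ε)) ^ k * s *
        (b ^ (J + 1) * (Real.exp ε / b) ^ k * a) := by
    have : (b * Real.exp (-ε)) ^ k * s * (b ^ (J + 1) * (Real.exp ε / b) ^ k * a) = ε := by
      linear_combination (s * b ^ (J + 1) * a) * h5 - h7
    rw [this]
    linarith
  exact le_of_mul_le_mul_left h8 (by positivity)

/-! ### Boundary conditions close to plus -/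

/-- Decay of correlations along paths whose weights are close to those with plus boundary
conditions, at vertices far from the boundary. -/
theorem exists_osc_chain_le_pow (hb : 2 ≤ b) (hh : Integrable h (leb β))
    (A : ℕ → Set (Spin β → ℝ)) (hA : ∀ n, ∀ W ∈ A n, IsWeight W ∧ HolleyLE W W)
    (hclose : ∀ η > 0, ∃ M, ∀ n, M ≤ n → ∀ W ∈ A n, Close η W (plusWeight b lam h n))
    {f : Spin β → ℝ} (hf : Tame f) (hfm : Monotone f) {q : ℝ} (hq : (b : ℝ)⁻¹ < q) :
    ∃ l₀, ∀ (m k : ℕ) (w : ℕ → Spin β → ℝ), l₀ ≤ k → (∀ j, w j ∈ A (m + j)) →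
      osc (chain lam w f k) ≤ q ^ k := by
  have hb2 : (2 : ℝ) ≤ b := by exact_mod_cast hb
  have hb0 : (0 : ℝ) < b := by linarith
  have hbinv : (0 : ℝ) < (b : ℝ)⁻¹ := inv_pos.2 hb0
  have hbinv1 : (b : ℝ)⁻¹ < 1 := inv_lt_one_of_one_lt₀ (by linarith)
  obtain ⟨p, hp1, hp2⟩ := exists_between (lt_min hq hbinv1)
  obtain ⟨hpq, hp1'⟩ := lt_min_iff.1 hp2
  have hp0 : 0 < p := hbinv.trans hp1
  have hbp : 1 < b * p := by
    rw [inv_lt_iff_one_lt_mul₀ hb0] at hp1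
    linarith
  -- the rate `exp ε / b` lies between `1 / b` and `p`
  set ε := Real.log (b * p) / 2 with hεdef
  have hlog : 0 < Real.log (b * p) := Real.log_pos hbp
  have hε : 0 < ε := by positivity
  have hρp : Real.exp ε / b < p := by
    rw [div_lt_iff₀ hb0, mul_comm p, ← Real.exp_log (by linarith : 0 < b * p), Real.exp_lt_exp]
    linarith
  set ρ := Real.exp ε / b with hρ
  have hρ0 : 0 < ρ := by positivity
  obtain ⟨C, hC0, hC⟩ := exists_osc_chain_plusWeight_le (lam := lam) hb hh hε
  -- the length of the blocks
  obtain ⟨l, hl1, hl⟩ : ∃ l : ℕ, 1 ≤ l ∧ C * ρ ^ l ≤ p ^ l / 2 := by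
    have h1 := tendsto_pow_atTop_nhds_zero_of_lt_one (r := ρ / p) (by positivity)
      ((div_lt_one hp0).2 hρp)
    obtain ⟨l, hl, hl1⟩ := ((h1.eventually (gt_mem_nhds (show 0 < 1 / (2 * C) by positivity))).and
      (eventually_ge_atTop 1)).exists
    refine ⟨l, hl1, ?_⟩
    rw [div_pow, div_lt_div_iff₀ (by positivity) (by positivity)] at hl
    linarith
  obtain ⟨η, hη0, hη⟩ : ∃ η > 0, Real.exp (l * η) - Real.exp (-(l * η)) ≤ p ^ l / 2 := by
    have h1 : Continuous fun η : ℝ => Real.exp (l * η) - Real.exp (-(l * η)) := by fun_prop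
    have h2 := h1.tendsto 0
    simp only [mul_zero, neg_zero, sub_self] at h2
    obtain ⟨η, h3, h4⟩ := (((h2.mono_left nhdsWithin_le_nhds).eventually
      (gt_mem_nhds (show 0 < p ^ l / 2 by positivity))).and
      (self_mem_nhdsWithin (a := (0 : ℝ)) (s := Ioi 0))).exists
    exact ⟨η, h4, h3.le⟩
  obtain ⟨M, hM⟩ := hclose η hη0
  have hblock : ∀ (n : ℕ) (w : ℕ → Spin β → ℝ) (g : Spin β → ℝ) (a : ℝ), M ≤ n →
      (∀ j, w j ∈ A (n + j)) → Tame g → Monotone g → 0 < a → osc g ≤ a →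
      osc (chain lam w g l) ≤ p ^ l * a := fun n w g a hn hw hg hm ha hga => by
    have h1 := osc_chain_le_of_close (lam := lam) (w := w)
      (w' := fun j => plusWeight b lam h (n + j)) hη0.le (fun j => (hA _ _ (hw j)).1)
      (fun j => isWeight_plusWeight hh _) (fun j => hM (n + j) (by omega) _ (hw j))
      (fun j => holleyLE_plusWeight hh _) hg hm l
    have h2 := hC n l g a hg hm ha hga
    have h3 := mul_le_mul_of_nonneg_right hl ha.le
    have h4 := mul_le_mul hη hga (osc_nonneg hm) (by positivity)
    linarith
  have hblocks : ∀ (i n : ℕ) (w : ℕ → Spin β → ℝ) (g : Spin β → ℝ) (a : ℝ), M ≤ n →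
      (∀ j, w j ∈ A (n + j)) → Tame g → Monotone g → 0 < a → osc g ≤ a →
      osc (chain lam w g (l * i)) ≤ p ^ (l * i) * a := fun i n w g a hn hw hg hm ha hga => by
    induction i with
    | zero => simpa [chain] using hga
    | succ i ih =>
      have hw1 : ∀ j, IsWeight (w j) := fun j => (hA _ _ (hw j)).1
      have hw2 : ∀ j, HolleyLE (w j) (w j) := fun j => (hA _ _ (hw j)).2
      rw [mul_add, mul_one, chain_add, pow_add, mul_comm (p ^ (l * i)), mul_assoc]
      exact hblock (n + l * i) _ _ _ (by omega) (fun j => by rw [add_assoc]; exact hw _)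
        (tame_chain hw1 hg _) (monotone_chain hw1 hw2 hg hm _) (by positivity) ih
  set a := osc f + 1 with ha_def
  have ha : 0 < a := by linarith [osc_nonneg hfm]
  obtain ⟨N, hN⟩ : ∃ N, ∀ k, N ≤ k → a / p ^ (M + l) * p ^ k ≤ q ^ k := by
    have hq0 : 0 < q := hp0.trans hpq
    have h1 := tendsto_pow_atTop_nhds_zero_of_lt_one (r := p / q) (by positivity)
      ((div_lt_one hq0).2 hpq)
    obtain ⟨N, hN⟩ := eventually_atTop.1
      (h1.eventually (gt_mem_nhds (show 0 < (a / p ^ (M + l))⁻¹ by positivity)))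
    refine ⟨N, fun k hk => ?_⟩
    have h2 := hN k hk
    rw [div_pow, div_lt_iff₀ (by positivity), inv_mul_eq_div, lt_div_iff₀ (by positivity)] at h2
    linarith
  refine ⟨max N M, fun m k w hk hw => ?_⟩
  obtain ⟨hkN, hkM⟩ := max_le_iff.1 hk
  have hw1 : ∀ j, IsWeight (w j) := fun j => (hA _ _ (hw j)).1
  have hw2 : ∀ j, HolleyLE (w j) (w j) := fun j => (hA _ _ (hw j)).2
  have hmod := Nat.div_add_mod (k - M) l
  have hlt := Nat.mod_lt (k - M) (show l > 0 by omega)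
  set i := (k - M) / l
  set r := (k - M) % l
  have hk' : k = M + l * i + r := by omega
  refine le_trans ?_ (hN k hkN)
  rw [hk', chain_add, chain_add]
  have hM1 := tame_chain (lam := lam) hw1 hf M
  have hM2 := monotone_chain (lam := lam) hw1 hw2 hf hfm M
  have hM3 : osc (chain lam w f M) ≤ a := (osc_chain_le hw1 hw2 hf hfm M).trans (by linarith)
  refine (osc_chain_le (fun j => hw1 _) (fun j => hw2 _) (tame_chain (fun j => hw1 _) hM1 _)
    (monotone_chain (fun j => hw1 _) (fun j => hw2 _) hM1 hM2 _) r).trans ?_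
  refine (hblocks i (m + M) _ _ a (by omega) (fun j => by rw [add_assoc]; exact hw _) hM1 hM2 ha
    hM3).trans ?_
  rw [div_mul_eq_mul_div, le_div_iff₀ (by positivity), mul_comm (p ^ (l * i)), mul_assoc, ← pow_add]
  exact mul_le_mul_of_nonneg_left (pow_le_pow_of_le_one hp0.le hp1'.le (by omega)) ha.le

end Decay

/-! ### Partial integration of products -/

theorem _root_.DependsOn.apply_updateFinset {δ : Type*} {X : δ → Type*} [DecidableEq δ]
    {α : Type*} {f : (∀ i, X i) → α} {S : Set δ}
    (hf : DependsOn f S) {s : Finset δ} (hs : ∀ i ∈ s, i ∉ S) (x : ∀ i, X i) (y : ∀ i : s, X i) :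
    f (Function.updateFinset x s y) = f x :=
  hf fun i hi => by simp [Function.updateFinset, show i ∉ s from fun h => hs i h hi]

section Marginal

variable {δ : Type*} {X : δ → Type*} [∀ i, MeasurableSpace (X i)] [DecidableEq δ]
  {μ : ∀ i, Measure (X i)}

theorem lmarginal_dependsOn {f : (∀ i, X i) → ℝ≥0∞} {S : Set δ} (hf : DependsOn f S)
    (s : Finset δ) : DependsOn (lmarginal μ s f) (S \ s) := fun x x' hx => by
  simp only [lmarginal]
  exact lintegral_congr fun y => hf.updateFinset y hx

theorem lmarginal_mul_of_dependsOn {f g : (∀ i, X i) → ℝ≥0∞} {S : Set δ} (hf : DependsOn f S)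
    {s : Finset δ} (hs : ∀ i ∈ s, i ∉ S) (hg : Measurable g) (x : ∀ i, X i) :
    lmarginal μ s (fun x => f x * g x) x = f x * lmarginal μ s g x := by
  simp only [lmarginal, hf.apply_updateFinset hs]
  exact lintegral_const_mul _ (hg.comp measurable_updateFinset)

theorem lmarginal_biUnion_prod [∀ i, SigmaFinite (μ i)] {ι : Type*} [DecidableEq ι]
    {T : ι → Finset δ} (hT : Pairwise fun i j => Disjoint (T i) (T j))
    {A : ι → (∀ i, X i) → ℝ≥0∞} (hA : ∀ i, Measurable (A i)) {D : ι → Set δ}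
    (hD : ∀ i, DependsOn (A i) (D i)) (hDT : ∀ i j, i ≠ j → ∀ v ∈ T j, v ∉ D i) (s : Finset ι)
    (x : ∀ i, X i) :
    lmarginal μ (s.biUnion T) (fun x => ∏ i ∈ s, A i x) x = ∏ i ∈ s, lmarginal μ (T i) (A i) x := by
  induction s using Finset.induction_on generalizing x with
  | empty => simp
  | insert i s hi ih =>
    have hdisj : Disjoint (T i) (s.biUnion T) := (Finset.disjoint_biUnion_right _ _ _).2
      fun j hj => hT fun h => hi (h ▸ hj)
    have hm : ∀ s : Finset ι, Measurable fun x => ∏ j ∈ s, A j x := fun s =>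
      Finset.measurable_prod _ fun j _ => hA j
    rw [Finset.biUnion_insert, lmarginal_union _ _ (hm _) hdisj, Finset.prod_insert hi]
    have h1 : lmarginal μ (s.biUnion T) (fun x => ∏ j ∈ insert i s, A j x) =
        fun x => (∏ j ∈ s, lmarginal μ (T j) (A j) x) * A i x := by
      funext x
      simp_rw [Finset.prod_insert hi]
      rw [lmarginal_mul_of_dependsOn (hD i) (fun v hv => ?_) (hm s), ih, mul_comm]
      obtain ⟨j, hj, hv⟩ := Finset.mem_biUnion.1 hv
      exact hDT i j (fun h => hi (h ▸ hj)) v hv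
    have h2 : DependsOn (fun x => ∏ j ∈ s, lmarginal μ (T j) (A j) x) (⋃ j ∈ s, D j) :=
      fun x x' hx => Finset.prod_congr rfl fun j hj =>
        lmarginal_dependsOn (hD j) _ fun v hv => hx v (mem_biUnion hj hv.1)
    rw [h1, lmarginal_mul_of_dependsOn h2 (fun v hv => ?_) (hA i), mul_comm]
    simp only [mem_iUnion, not_exists]
    exact fun j hj => hDT j i (fun h => hi (h ▸ hj)) v hv

end Marginal

/-! ### Subtrees and their energy -/

section Tree

variable {b : ℕ}

theorem mem_subtree {x v : Vertex b} {n : ℕ} :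
    v ∈ subtree x n ↔ x <:+ v ∧ v.length ≤ x.length + n := by
  induction n generalizing x with
  | zero =>
    simp only [subtree, Finset.mem_singleton, add_zero]
    exact ⟨fun h => h ▸ ⟨List.suffix_refl _, le_rfl⟩, fun h => (h.1.eq_of_length_le h.2).symm⟩
  | succ n ih =>
    simp only [subtree, Finset.mem_insert, Finset.mem_biUnion, Finset.mem_univ, true_and, ih]
    constructor
    · rintro (rfl | ⟨i, h1, h2⟩)
      · exact ⟨List.suffix_refl _, by omega⟩
      · exact ⟨(List.suffix_cons i x).trans h1, by simp at h2; omega⟩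
    · rintro ⟨⟨t, rfl⟩, h2⟩
      rcases List.eq_nil_or_concat t with rfl | ⟨t, i, rfl⟩
      · exact Or.inl rfl
      · refine Or.inr ⟨i, ⟨t, by simp⟩, ?_⟩
        simp at h2 ⊢
        omega

theorem suffix_of_mem_subtree {x v : Vertex b} {n : ℕ} (hv : v ∈ subtree x n) : x <:+ v :=
  (mem_subtree.1 hv).1

theorem child_suffix_inj {x v : Vertex b} {i j : Fin b} (hi : (i :: x) <:+ v)
    (hj : (j :: x) <:+ v) : i = j := by
  have h := (List.suffix_of_suffix_length_le hi hj (by simp)).eq_of_length (by simp)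
  exact (List.cons.inj h).1

theorem not_child_suffix (x : Vertex b) (i : Fin b) : ¬ (i :: x) <:+ x := fun h => by
  have := h.length_le
  simp at this

theorem disjoint_subtree_child (x : Vertex b) (n : ℕ) :
    Pairwise fun i j : Fin b => Disjoint (subtree (i :: x) n) (subtree (j :: x) n) :=
  fun _ _ hij => Finset.disjoint_left.2 fun _ h h' =>
    hij (child_suffix_inj (suffix_of_mem_subtree h) (suffix_of_mem_subtree h'))

theorem root_notMem_biUnion (x : Vertex b) (n : ℕ) :
    x ∉ Finset.univ.biUnion fun i : Fin b => subtree (i :: x) n := fun h => by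
  obtain ⟨i, -, hi⟩ := Finset.mem_biUnion.1 h
  exact not_child_suffix x i (suffix_of_mem_subtree hi)

variable {β : ℝ}

/-- The energy of the spins on the subtree of depth `n` rooted at `x`, including the interaction
with the children of its leaves, but not the one of `x` with its parent. -/
def subEnergy (h : Icc (0 : ℝ) β → ℝ) (x : Vertex b) (n : ℕ) (ω : Vertex b → Spin β) : ℝ :=
  ∑ v ∈ subtree x n, (dot h (ω v).1 + ∑ i : Fin b, dot (ω v).1 (ω (i :: v)).1)

theorem subEnergy_zero (h : Icc (0 : ℝ) β → ℝ) (x : Vertex b) (ω : Vertex b → Spin β) :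
    subEnergy h x 0 ω = dot h (ω x).1 + ∑ i : Fin b, dot (ω x).1 (ω (i :: x)).1 := by
  simp [subEnergy, subtree]

theorem subEnergy_succ (h : Icc (0 : ℝ) β → ℝ) (x : Vertex b) (n : ℕ) (ω : Vertex b → Spin β) :
    subEnergy h x (n + 1) ω = dot h (ω x).1 +
      ∑ i : Fin b, (dot (ω x).1 (ω (i :: x)).1 + subEnergy h (i :: x) n ω) := by
  rw [subEnergy, subtree, Finset.sum_insert (root_notMem_biUnion x n), Finset.sum_biUnion
    fun i _ j _ hij => disjoint_subtree_child x n hij, Finset.sum_add_distrib, ← add_assoc]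
  rfl

theorem subEnergy_dependsOn (h : Icc (0 : ℝ) β → ℝ) (x : Vertex b) (n : ℕ) :
    DependsOn (subEnergy h x n) {v | x <:+ v} := fun ω ω' hω => by
  refine Finset.sum_congr rfl fun v hv => ?_
  have hv' := suffix_of_mem_subtree hv
  rw [hω v hv']
  congr 1
  refine Finset.sum_congr rfl fun i _ => ?_
  rw [hω (i :: v) (hv'.trans (List.suffix_cons i v))]

variable [hβ : Fact (0 ≤ β)]

theorem measurable_dot_dot (v w : Vertex b) :
    Measurable fun ω : Vertex b → Spin β => dot (ω v).1 (ω w).1 := by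
  have h1 : Measurable fun ω : Vertex b → Spin β => (ω v, ω w) :=
    (measurable_pi_apply v).prodMk (measurable_pi_apply w)
  exact (measurable_of_seqContinuous₂ seqContinuous_dot).comp h1

theorem measurable_dot_field {h : Icc (0 : ℝ) β → ℝ} (hh : Integrable h (leb β)) (v : Vertex b) :
    Measurable fun ω : Vertex b → Spin β => dot h (ω v).1 :=
  (tame_dot_left hh).measurable.comp (measurable_pi_apply v)

theorem measurable_subEnergy {h : Icc (0 : ℝ) β → ℝ} (hh : Integrable h (leb β)) (x : Vertex b)
    (n : ℕ) : Measurable (subEnergy h x n) :=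
  Finset.measurable_sum _ fun v _ => (measurable_dot_field hh v).add
    (Finset.measurable_sum _ fun _ _ => measurable_dot_dot _ _)

theorem dot_sum {ι : Type*} (s : Finset ι) (ξ : ι → Spin β) (σ : Spin β) :
    dot (fun t => ∑ y ∈ s, (ξ y).1 t) σ.1 = ∑ y ∈ s, dot (ξ y).1 σ.1 := by
  simp_rw [dot, Finset.sum_mul]
  exact integral_finsetSum _ fun y _ => integrable_mul_spin (ξ y).integrable σ

theorem dot_add_sum {h : Icc (0 : ℝ) β → ℝ} (hh : Integrable h (leb β)) {ι : Type*} (s : Finset ι)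
    (ξ : ι → Spin β) (σ : Spin β) :
    dot (fun t => h t + ∑ y ∈ s, (ξ y).1 t) σ.1 = dot h σ.1 + ∑ y ∈ s, dot (ξ y).1 σ.1 := by
  rw [← dot_sum]
  exact dot_add hh (integrable_finsetSum _ fun y _ => (ξ y).integrable) σ

/-- The energy on `A` as a sum over the vertices of `A`. Each edge to a child is attributed to the
vertex, whether or not the child is in `A`, so that only the edges to parents outside `A` remain. -/
theorem energy_eq_sum {h : Icc (0 : ℝ) β → ℝ} (hh : Integrable h (leb β)) (A : Finset (Vertex b))
    (τ : Vertex b → Spin β) (σ : A → Spin β) :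
    energy h A τ σ =
      ∑ v ∈ A, (dot h (Function.updateFinset τ A σ v).1 + ∑ i : Fin b,
        dot (Function.updateFinset τ A σ v).1 (Function.updateFinset τ A σ (i :: v)).1) +
      ∑ v ∈ A, ∑ y ∈ parent v \ A, dot (τ y).1 (Function.updateFinset τ A σ v).1 := by
  set ω := Function.updateFinset τ A σ with hω
  have hin : ∀ v : A, σ v = ω v := fun v => by simp [hω, Function.updateFinset]
  have hout : ∀ y, y ∉ A → τ y = ω y := fun y hy => by simp [hω, Function.updateFinset, hy]
  have hpar : ∀ v : Vertex b, Disjoint (children v) (parent v) := fun v => by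
    refine Finset.disjoint_left.2 fun y hy hy' => ?_
    obtain ⟨i, -, rfl⟩ := Finset.mem_image.1 hy
    cases v with
    | nil => simp [parent] at hy'
    | cons j p =>
      have := congrArg List.length (Finset.mem_singleton.1 hy')
      simp only [List.length_cons] at this
      omega
  have hchild : ∀ v : Vertex b, ∀ F : Vertex b → ℝ,
      ∑ y ∈ children v, F y = ∑ i : Fin b, F (i :: v) :=
    fun v F => Finset.sum_image fun i _ j _ hij => (List.cons.inj hij).1
  rw [energy]
  simp_rw [dot_add_sum hh, hin]
  rw [Finset.sum_coe_sort A fun v => ∑ w : A, if (w : Vertex b) ∈ children v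
      then dot (ω v).1 (ω w).1 else 0,
    Finset.sum_coe_sort A fun v => dot h (ω v).1 + ∑ y ∈ neighbors v \ A, dot (τ y).1 (ω v).1,
    ← Finset.sum_add_distrib, ← Finset.sum_add_distrib]
  refine Finset.sum_congr rfl fun v _ => ?_
  rw [Finset.sum_coe_sort A fun w => if w ∈ children v then dot (ω v).1 (ω w).1 else 0,
    ← Finset.sum_filter, Finset.filter_mem_eq_inter, neighbors, Finset.union_sdiff_distrib,
    Finset.sum_union (Finset.disjoint_of_subset_left Finset.sdiff_subset
      (Finset.disjoint_of_subset_right Finset.sdiff_subset (hpar v))), ← hchild v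
        fun y => dot (ω v).1 (ω y).1, ← Finset.sum_inter_add_sum_sdiff (children v) A,
    Finset.inter_comm A]
  have : ∑ y ∈ children v \ A, dot (τ y).1 (ω v).1 = ∑ y ∈ children v \ A, dot (ω v).1 (ω y).1 :=
    Finset.sum_congr rfl fun y hy => by
      rw [hout y (Finset.mem_sdiff.1 hy).2, dot_comm]
  rw [this]
  ring

/-- On a subtree, the energy is `subEnergy` together with the interaction of the root with its
parent. -/
theorem energy_subtree {h : Icc (0 : ℝ) β → ℝ} (hh : Integrable h (leb β)) (x : Vertex b) (n : ℕ)
    (τ : Vertex b → Spin β) (σ : subtree x n → Spin β) :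
    energy h (subtree x n) τ σ = subEnergy h x n (Function.updateFinset τ (subtree x n) σ) +
      ∑ y ∈ parent x, dot (τ y).1 (Function.updateFinset τ (subtree x n) σ x).1 := by
  rw [energy_eq_sum hh, subEnergy]
  congr 1
  -- a vertex of the subtree has a parent outside the subtree only if it is the root
  rw [Finset.sum_eq_single_of_mem x (root_mem_subtree x n)]
  · refine Finset.sum_congr (Finset.sdiff_eq_self_of_disjoint ?_) fun _ _ => rfl
    refine Finset.disjoint_left.2 fun y hy hyT => ?_
    cases x with
    | nil => simp [parent] at hy
    | cons j p =>
      rw [Finset.mem_singleton.1 hy] at hyT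
      exact not_child_suffix p j (suffix_of_mem_subtree hyT)
  · intro v hv hvx
    refine Finset.sum_eq_zero fun y hy => ?_
    obtain ⟨hy, hyT⟩ := Finset.mem_sdiff.1 hy
    obtain ⟨hs, hl⟩ := mem_subtree.1 hv
    cases v with
    | nil => simp [parent] at hy
    | cons j p =>
      rw [Finset.mem_singleton.1 hy] at hyT
      refine absurd (mem_subtree.2 ⟨?_, ?_⟩) hyT
      · exact (List.suffix_cons_iff.1 hs).resolve_left fun h => hvx h.symm
      · simp at hl; omega

/-! ### Integrating out a subtree -/

variable {lam : ℝ} [hlam : Fact (0 ≤ lam)] {h : Icc (0 : ℝ) β → ℝ}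

theorem lintegral_ofReal_mul {V : Spin β → ℝ} (hV : Tame V) (nV : 0 ≤ V) (σ : Spin β) :
    ∫⁻ ξ, ENNReal.ofReal (Real.exp (dot σ.1 ξ.1)) * ENNReal.ofReal (V ξ) ∂(freeSpin β lam) =
      ENNReal.ofReal (transfer lam V σ) := by
  rw [transfer, ofReal_integral_eq_lintegral_ofReal (integrable_transfer_integrand hV σ)
    (Eventually.of_forall fun ξ => mul_nonneg (Real.exp_pos _).le (nV ξ))]
  refine lintegral_congr fun ξ => ?_
  rw [ENNReal.ofReal_mul (Real.exp_pos _).le]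

/-- Integrating out a subtree factorizes over the subtrees rooted at the children of its root. -/
theorem lmarginal_subtree_succ (hh : Integrable h (leb β)) (x : Vertex b) (n : ℕ)
    {u : Spin β → ℝ≥0∞} (hu : Measurable u) {G : Fin b → (Vertex b → Spin β) → ℝ≥0∞}
    (hG : ∀ i, Measurable (G i)) (hGd : ∀ i, DependsOn (G i) {v | (i :: x) <:+ v})
    (ω : Vertex b → Spin β) :
    lmarginal (fun _ => freeSpin β lam) (subtree x (n + 1))
      (fun ω => ENNReal.ofReal (Real.exp (subEnergy h x (n + 1) ω)) * (u (ω x) * ∏ i, G i ω)) ω =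
    ∫⁻ σ, u σ * (ENNReal.ofReal (Real.exp (dot h σ.1)) *
      ∏ i, lmarginal (fun _ => freeSpin β lam) (subtree (i :: x) n)
        (fun ω => ENNReal.ofReal (Real.exp (subEnergy h (i :: x) n ω)) *
          (ENNReal.ofReal (Real.exp (dot σ.1 (ω (i :: x)).1)) * G i ω)) ω) ∂(freeSpin β lam) := by
  have hE : ∀ i : Fin b, Measurable fun ω : Vertex b → Spin β =>
      ENNReal.ofReal (Real.exp (subEnergy h (i :: x) n ω)) := fun i =>
    (measurable_subEnergy hh _ _).exp.ennreal_ofReal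
  set F : (Vertex b → Spin β) → ℝ≥0∞ := fun ω =>
    u (ω x) * ENNReal.ofReal (Real.exp (dot h (ω x).1)) with hF
  set A : Fin b → (Vertex b → Spin β) → ℝ≥0∞ := fun i ω =>
    ENNReal.ofReal (Real.exp (subEnergy h (i :: x) n ω)) *
      (ENNReal.ofReal (Real.exp (dot (ω x).1 (ω (i :: x)).1)) * G i ω) with hA
  have hAm : ∀ i, Measurable (A i) := fun i => (hE i).mul
    ((measurable_dot_dot _ _).exp.ennreal_ofReal.mul (hG i))
  have hFm : Measurable F := (hu.comp (measurable_pi_apply x)).mul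
    (measurable_dot_field hh x).exp.ennreal_ofReal
  have hAd : ∀ i, DependsOn (A i) (insert x {v | (i :: x) <:+ v}) := fun i ω ω' hω => by
    simp only [hA]
    rw [subEnergy_dependsOn h (i :: x) n fun v hv => hω v (mem_insert_of_mem _ hv),
      hGd i fun v hv => hω v (mem_insert_of_mem _ hv), hω x (mem_insert _ _),
      hω (i :: x) (mem_insert_of_mem _ (List.suffix_refl _))]
  have hprod : (fun ω => ENNReal.ofReal (Real.exp (subEnergy h x (n + 1) ω)) *
      (u (ω x) * ∏ i, G i ω)) = fun ω => F ω * ∏ i, A i ω := by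
    funext ω
    simp only [hF, hA]
    rw [subEnergy_succ, Real.exp_add, Real.exp_sum, ENNReal.ofReal_mul (Real.exp_pos _).le,
      ENNReal.ofReal_prod_of_nonneg fun i _ => (Real.exp_pos _).le, Finset.prod_mul_distrib,
      Finset.prod_mul_distrib]
    simp_rw [Real.exp_add, ENNReal.ofReal_mul (Real.exp_pos _).le]
    rw [Finset.prod_mul_distrib]
    ring
  rw [hprod, subtree, lmarginal_insert (fun ω => F ω * ∏ i, A i ω)
    (hFm.mul (Finset.measurable_prod _ fun i _ => hAm i)) (root_notMem_biUnion x n)]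
  refine lintegral_congr fun σ => ?_
  have hFd : DependsOn F {x} := fun ω ω' hω => by simp only [hF]; rw [hω x rfl]
  rw [lmarginal_mul_of_dependsOn hFd (fun v hv hvx => ?_)
    (Finset.measurable_prod _ fun i _ => hAm i),
    lmarginal_biUnion_prod (disjoint_subtree_child x n) hAm hAd]
  · simp only [hF, Function.update_self]
    rw [mul_assoc]
    congr 2
    refine Finset.prod_congr rfl fun i _ => ?_
    simp only [lmarginal]
    refine lintegral_congr fun y => ?_
    have hxi : x ∉ subtree (i :: x) n := fun hx => not_child_suffix x i (suffix_of_mem_subtree hx)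
    have hagree : ∀ v, (i :: x) <:+ v →
        Function.updateFinset (Function.update ω x σ) (subtree (i :: x) n) y v =
          Function.updateFinset ω (subtree (i :: x) n) y v := fun v hv => by
      have hvx : v ≠ x := fun h => not_child_suffix x i (h ▸ hv)
      simp [Function.updateFinset, Function.update_of_ne hvx]
    have hself : Function.updateFinset (Function.update ω x σ) (subtree (i :: x) n) y x = σ := by
      simp [Function.updateFinset, hxi]
    simp only [hA]
    rw [hself, subEnergy_dependsOn h (i :: x) n hagree, hGd i hagree,
      hagree _ (List.suffix_refl _)]
  · intro i j hij v hv
    have hjv := suffix_of_mem_subtree hv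
    rintro (rfl | hiv)
    · exact not_child_suffix _ j hjv
    · exact hij (child_suffix_inj hiv hjv)
  · rw [mem_singleton_iff.1 hvx] at hv
    exact root_notMem_biUnion x n hv

/-- Integrating out a subtree in a function of the spin at its root and of the spin at another
vertex `z`. The spins along the path from `z` to the root form a Markov chain, whose transition
kernels are given by the weights of the subtrees at the vertices of the path: `z.drop j` is the
`j`-th ancestor of `z`, and the subtraction gives the depth of the part of the subtree below it. -/
theorem lmarginal_subtree (hh : Integrable h (leb β)) (n : ℕ) (x z : Vertex b)
    (hz : z ∈ subtree x n) {u : Spin β → ℝ≥0∞} (hu : Measurable u) {g : Spin β → ℝ} (hg : Tame g)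
    (ng : 0 ≤ g) (ω : Vertex b → Spin β) :
    lmarginal (fun _ => freeSpin β lam) (subtree x n)
      (fun ω => ENNReal.ofReal (Real.exp (subEnergy h x n ω)) *
        (u (ω x) * ENNReal.ofReal (g (ω z)))) ω =
    ∫⁻ σ, u σ * ENNReal.ofReal (weight lam h ω n x σ * chain lam
      (fun j => weight lam h ω (n - (z.length - x.length) + j) (z.drop j)) g
        (z.length - x.length) σ) ∂(freeSpin β lam) := by
  induction n generalizing x z u g with
  | zero =>
    obtain rfl : z = x := by simpa [subtree] using hz
    simp only [subtree]
    rw [lmarginal_singleton]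
    refine lintegral_congr fun σ => ?_
    simp only [subEnergy_zero, Function.update_self, Nat.sub_self, chain]
    have hne : ∀ i : Fin b, (i :: z : Vertex b) ≠ z := fun i h => by
      have := congrArg List.length h
      simp at this
    simp_rw [Function.update_of_ne (hne _)]
    rw [weight, Real.exp_add, Real.exp_sum, ENNReal.ofReal_mul (q := g σ) (by positivity)]
    ring
  | succ n ih =>
    have hW := fun i : Fin b => isWeight_weight (lam := lam) hh ω n (i :: x)
    -- the integral over the subtree of a child that contributes nothing but its energy
    have hone : ∀ (σ : Spin β) (i : Fin b),
        lmarginal (fun _ => freeSpin β lam) (subtree (i :: x) n)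
          (fun ω => ENNReal.ofReal (Real.exp (subEnergy h (i :: x) n ω)) *
            (ENNReal.ofReal (Real.exp (dot σ.1 (ω (i :: x)).1)) * 1)) ω =
          ENNReal.ofReal (transfer lam (weight lam h ω n (i :: x)) σ) := fun σ i => by
      have := ih (i :: x) (i :: x) (root_mem_subtree _ _)
        (tame_dot σ).exp.measurable.ennreal_ofReal (Tame.const 1) fun _ => zero_le_one
      simp only [ENNReal.ofReal_one, Nat.sub_self, chain, mul_one] at this ⊢
      rw [this, lintegral_ofReal_mul (hW i).tame fun ξ => ((hW i).pos ξ).le]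
    obtain ⟨hxz, hlen⟩ := mem_subtree.1 hz
    rw [subtree, Finset.mem_insert, Finset.mem_biUnion] at hz
    rcases hz with rfl | ⟨i₀, -, hz⟩
    · have h1 := lmarginal_subtree_succ (lam := lam) hh z n
        (u := fun σ => u σ * ENNReal.ofReal (g σ)) (hu.mul hg.measurable.ennreal_ofReal)
        (G := fun _ _ => 1) (fun _ => measurable_const)
        (fun _ _ _ _ => rfl) ω
      simp only [Finset.prod_const_one, mul_one] at h1
      rw [h1]
      refine lintegral_congr fun σ => ?_
      have h2 := hone σ
      simp only [mul_one] at h2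
      simp_rw [h2]
      rw [← ENNReal.ofReal_prod_of_nonneg fun i _ => ((hW i).transfer.pos σ).le,
        ← ENNReal.ofReal_mul (Real.exp_pos _).le]
      simp only [Nat.sub_self, chain]
      rw [show weight lam h ω (n + 1) z σ = Real.exp (dot h σ.1) *
          ∏ i, transfer lam (weight lam h ω n (i :: z)) σ from rfl, mul_comm (_ * _) (g σ),
        ENNReal.ofReal_mul (ng σ), mul_assoc]
    · have hlz := (mem_subtree.1 hz).1.length_le
      have hlz' := (mem_subtree.1 hz).2
      simp only [List.length_cons] at hlz hlz'
      obtain ⟨d, hd⟩ : ∃ d, z.length = x.length + 1 + d := ⟨_, (Nat.add_sub_cancel' hlz).symm⟩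
      have hd1 : z.length - x.length = d + 1 := by omega
      have hd2 : z.length - (i₀ :: x).length = d := by simp; omega
      have hdrop : z.drop d = i₀ :: x := by
        obtain ⟨t, rfl⟩ := (mem_subtree.1 hz).1
        have : t.length = d := by simp at hd; omega
        rw [← this, List.drop_left]
      set w : ℕ → Spin β → ℝ := fun j => weight lam h ω (n - d + j) (z.drop j) with hw
      have hww : ∀ j, IsWeight (w j) := fun j => isWeight_weight hh _ _ _
      have hwd : w d = weight lam h ω n (i₀ :: x) := by
        simp only [hw]
        rw [hdrop, Nat.sub_add_cancel (by omega)]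
      have htc := tame_chain (lam := lam) hww hg d
      have hnc := chain_nonneg (lam := lam) hww hg ng d
      have h1 := lmarginal_subtree_succ (lam := lam) hh x n hu
        (G := fun i ω => if i = i₀ then ENNReal.ofReal (g (ω z)) else 1) (fun i => by
          split_ifs
          · exact (hg.measurable.comp (measurable_pi_apply z)).ennreal_ofReal
          · exact measurable_const) (fun i ω ω' hω => by
          split_ifs with hi
          · change ENNReal.ofReal (g (ω z)) = ENNReal.ofReal (g (ω' z))
            rw [hω z (hi ▸ (mem_subtree.1 hz).1)]
          · rfl) ω
      simp only [Finset.prod_ite_eq', Finset.mem_univ, if_true] at h1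
      rw [h1]
      refine lintegral_congr fun σ => ?_
      have h2 : ∀ i : Fin b, lmarginal (fun _ => freeSpin β lam) (subtree (i :: x) n)
          (fun ω => ENNReal.ofReal (Real.exp (subEnergy h (i :: x) n ω)) *
            (ENNReal.ofReal (Real.exp (dot σ.1 (ω (i :: x)).1)) *
              if i = i₀ then ENNReal.ofReal (g (ω z)) else 1)) ω =
          ENNReal.ofReal (transfer lam (weight lam h ω n (i :: x)) σ) *
            if i = i₀ then ENNReal.ofReal (chain lam w g (d + 1) σ) else 1 := fun i => by
        split_ifs with hi
        · subst hi
          have h3 := ih (i :: x) z hz (tame_dot σ).exp.measurable.ennreal_ofReal hg ng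
          rw [h3, hd2, ← hwd, lintegral_ofReal_mul ((hww d).tame.mul htc)
            fun ξ => mul_nonneg ((hww d).pos ξ).le (hnc ξ),
            ← ENNReal.ofReal_mul ((hww d).transfer.pos σ).le, chain, kernel,
            mul_div_cancel₀ _ ((hww d).transfer.pos σ).ne']
        · rw [hone, mul_one]
      simp_rw [h2]
      rw [Finset.prod_mul_distrib, Finset.prod_ite_eq', if_pos (Finset.mem_univ _),
        ← ENNReal.ofReal_prod_of_nonneg fun i _ => ((hW i).transfer.pos σ).le,
        ← mul_assoc (ENNReal.ofReal (Real.exp _)), ← ENNReal.ofReal_mul (Real.exp_pos _).le,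
        hd1, show n + 1 - (d + 1) = n - d by omega,
        show weight lam h ω (n + 1) x σ = Real.exp (dot h σ.1) *
          ∏ i, transfer lam (weight lam h ω n (i :: x)) σ from rfl,
        ENNReal.ofReal_mul (mul_nonneg (Real.exp_pos _).le
          (Finset.prod_nonneg fun i _ => ((hW i).transfer.pos σ).le))]

end Tree

/-! ### Gibbs measures -/

section Gibbs

variable {b : ℕ} {β lam : ℝ} [hβ : Fact (0 ≤ β)] [hlam : Fact (0 ≤ lam)]
  {h : Icc (0 : ℝ) β → ℝ}

theorem measurable_energy (hh : Integrable h (leb β)) (A : Finset (Vertex b))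
    (τ : Vertex b → Spin β) : Measurable (energy h A τ) := by
  rw [funext (energy_eq_sum hh A τ)]
  have h1 : Measurable fun ω : Vertex b → Spin β =>
      ∑ v ∈ A, (dot h (ω v).1 + ∑ i : Fin b, dot (ω v).1 (ω (i :: v)).1) +
      ∑ v ∈ A, ∑ y ∈ parent v \ A, dot (τ y).1 (ω v).1 :=
    (Finset.measurable_sum _ fun v _ => (measurable_dot_field hh v).add
      (Finset.measurable_sum _ fun _ _ => measurable_dot_dot _ _)).add
      (Finset.measurable_sum _ fun v _ => Finset.measurable_sum _ fun y _ =>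
        measurable_dot_field (τ y).integrable v)
  exact h1.comp measurable_updateFinset

theorem exists_energy_le (hh : Integrable h (leb β)) (A : Finset (Vertex b))
    (τ : Vertex b → Spin β) : ∃ C, ∀ σ, energy h A τ σ ≤ C := by
  refine ⟨∑ v ∈ A, ((∫ t, |h t| ∂(leb β)) + ∑ _i : Fin b, β) + ∑ v ∈ A, ∑ y ∈ parent v \ A, β,
    fun σ => ?_⟩
  rw [energy_eq_sum hh]
  refine add_le_add (Finset.sum_le_sum fun v _ => add_le_add (le_of_abs_le (abs_dot_le hh _))
    (Finset.sum_le_sum fun i _ => le_of_abs_le (abs_dot_spin_le _ _)))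
    (Finset.sum_le_sum fun v _ => Finset.sum_le_sum fun y _ => le_of_abs_le (abs_dot_spin_le _ _))

theorem integrable_exp_energy (hh : Integrable h (leb β)) (A : Finset (Vertex b))
    (τ : Vertex b → Spin β) : Integrable (fun σ => Real.exp (energy h A τ σ))
      (Measure.pi fun _ : A => freeSpin β lam) := by
  obtain ⟨C, hC⟩ := exists_energy_le hh A τ
  exact Integrable.of_bound (measurable_energy hh A τ).exp.aestronglyMeasurable (Real.exp C)
    (Eventually.of_forall fun σ => by
      rw [Real.norm_eq_abs, Real.abs_exp]
      exact Real.exp_le_exp.2 (hC σ))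

theorem isProbabilityMeasure_gibbs (hh : Integrable h (leb β)) (A : Finset (Vertex b))
    (τ : Vertex b → Spin β) : IsProbabilityMeasure (gibbs lam h A τ) :=
  isProbabilityMeasure_tilted (integrable_exp_energy hh A τ)

theorem lintegral_gibbs (hh : Integrable h (leb β)) (A : Finset (Vertex b))
    (τ : Vertex b → Spin β) (F : (A → Spin β) → ℝ≥0∞) :
    ∫⁻ σ, F σ ∂(gibbs lam h A τ) = (ENNReal.ofReal (∫ σ, Real.exp (energy h A τ σ)
      ∂(Measure.pi fun _ : A => freeSpin β lam)))⁻¹ *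
        ∫⁻ σ, ENNReal.ofReal (Real.exp (energy h A τ σ)) * F σ
          ∂(Measure.pi fun _ : A => freeSpin β lam) := by
  have hZ := integral_exp_pos (integrable_exp_energy (lam := lam) hh A τ)
  rw [gibbs, lintegral_tilted, ← lintegral_const_mul' _ _ (ENNReal.inv_ne_top.2
    (by simpa using hZ))]
  refine lintegral_congr fun σ => ?_
  rw [ENNReal.ofReal_div_of_pos hZ, div_eq_mul_inv]
  ring

/-- Integrals against the unnormalized Gibbs measure on a subtree. -/
theorem lintegral_exp_energy_subtree (hh : Integrable h (leb β)) (x : Vertex b) (n : ℕ)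
    (z : subtree x n) (τ : Vertex b → Spin β) {u : Spin β → ℝ≥0∞} (hu : Measurable u)
    {g : Spin β → ℝ} (hg : Tame g) (ng : 0 ≤ g) :
    ∫⁻ σ, ENNReal.ofReal (Real.exp (energy h (subtree x n) τ σ)) *
        (u (σ (subtreeRoot x n)) * ENNReal.ofReal (g (σ z)))
          ∂(Measure.pi fun _ : subtree x n => freeSpin β lam) =
      ∫⁻ σ, u σ * ENNReal.ofReal (Real.exp (∑ y ∈ parent x, dot (τ y).1 σ.1)) *
        ENNReal.ofReal (weight lam h τ n x σ * chain lam
          (fun j => weight lam h τ (n - ((z : Vertex b).length - x.length) + j)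
            ((z : Vertex b).drop j)) g ((z : Vertex b).length - x.length) σ)
          ∂(freeSpin β lam) := by
  have hp : Measurable fun σ : Spin β => ∑ y ∈ parent x, dot (τ y).1 σ.1 :=
    Finset.measurable_sum _ fun y _ => (tame_dot (τ y)).measurable
  rw [← lmarginal_subtree (u := fun σ => u σ *
    ENNReal.ofReal (Real.exp (∑ y ∈ parent x, dot (τ y).1 σ.1))) hh n x z z.2
    (hu.mul hp.exp.ennreal_ofReal) hg ng τ, lmarginal]
  refine lintegral_congr fun σ => ?_
  have hin : ∀ v : subtree x n, Function.updateFinset τ (subtree x n) σ v = σ v := fun v => by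
    simp [Function.updateFinset]
  have hroot : Function.updateFinset τ (subtree x n) σ x = σ (subtreeRoot x n) :=
    hin (subtreeRoot x n)
  rw [energy_subtree hh, hin z, hroot, Real.exp_add, ENNReal.ofReal_mul (Real.exp_pos _).le]
  ring

/-- The same integrals under the Gibbs measure, restricted to the event that the spin at the root
is `ξ`. The factor `a` depends only on `ξ`. -/
theorem exists_setLIntegral_gibbs (hh : Integrable h (leb β)) (x : Vertex b) (n : ℕ)
    (τ : Vertex b → Spin β) {ξ : Spin β} (hξ : 0 < (freeSpin β lam).real {ξ}) :
    ∃ a : ℝ≥0∞, a ≠ 0 ∧ a ≠ ∞ ∧ ∀ (z : subtree x n) (g : Spin β → ℝ), Tame g → 0 ≤ g →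
      ∫⁻ σ in {σ | σ (subtreeRoot x n) = ξ}, ENNReal.ofReal (g (σ z))
        ∂(gibbs lam h (subtree x n) τ) =
      a * ENNReal.ofReal (chain lam
          (fun j => weight lam h τ (n - ((z : Vertex b).length - x.length) + j)
            ((z : Vertex b).drop j)) g ((z : Vertex b).length - x.length) ξ) := by
  have hZ := integral_exp_pos (integrable_exp_energy (lam := lam) hh (subtree x n) τ)
  have hW := (isWeight_weight (lam := lam) hh τ n x).pos ξ
  have hms := measurableSet_singleton_spin ξ
  have hφ : (freeSpin β lam) {ξ} ≠ 0 := fun h0 => by simp [Measure.real, h0] at hξ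
  refine ⟨(ENNReal.ofReal (∫ σ, Real.exp (energy h (subtree x n) τ σ)
      ∂(Measure.pi fun _ : subtree x n => freeSpin β lam)))⁻¹ *
      (ENNReal.ofReal (Real.exp (∑ y ∈ parent x, dot (τ y).1 ξ.1)) *
        ENNReal.ofReal (weight lam h τ n x ξ) * freeSpin β lam {ξ}), ?_, ?_, fun z g hg ng => ?_⟩
  · refine mul_ne_zero (ENNReal.inv_ne_zero.2 ENNReal.ofReal_ne_top) (mul_ne_zero
      (mul_ne_zero ?_ ?_) hφ)
    · simpa using Real.exp_pos _
    · simpa using hW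
  · exact ENNReal.mul_ne_top (ENNReal.inv_ne_top.2 (by simpa using hZ)) (ENNReal.mul_ne_top
      (ENNReal.mul_ne_top ENNReal.ofReal_ne_top ENNReal.ofReal_ne_top) (measure_ne_top _ _))
  · have hS : MeasurableSet {σ : subtree x n → Spin β | σ (subtreeRoot x n) = ξ} :=
      (measurable_pi_apply (subtreeRoot x n) :
        Measurable fun σ : subtree x n → Spin β => σ (subtreeRoot x n)) hms
    have h1 : ∀ σ : subtree x n → Spin β,
        {σ : subtree x n → Spin β | σ (subtreeRoot x n) = ξ}.indicator
          (fun σ => ENNReal.ofReal (g (σ z))) σ =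
        ({ξ} : Set (Spin β)).indicator (fun _ => 1) (σ (subtreeRoot x n)) *
          ENNReal.ofReal (g (σ z)) := fun σ => by
      by_cases hσ : σ (subtreeRoot x n) = ξ <;> simp [hσ]
    rw [← lintegral_indicator hS, lintegral_congr h1, lintegral_gibbs hh,
      lintegral_exp_energy_subtree hh x n z τ (measurable_const.indicator hms) hg ng, mul_assoc]
    congr 1
    set c := chain lam (fun j => weight lam h τ (n - ((z : Vertex b).length - x.length) + j)
      ((z : Vertex b).drop j)) g ((z : Vertex b).length - x.length) with hc
    have h2 : ∀ σ : Spin β, ({ξ} : Set (Spin β)).indicator (fun _ => (1 : ℝ≥0∞)) σ *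
        ENNReal.ofReal (Real.exp (∑ y ∈ parent x, dot (τ y).1 σ.1)) *
        ENNReal.ofReal (weight lam h τ n x σ * c σ) = ({ξ} : Set (Spin β)).indicator (fun _ =>
          ENNReal.ofReal (Real.exp (∑ y ∈ parent x, dot (τ y).1 ξ.1)) *
          ENNReal.ofReal (weight lam h τ n x ξ * c ξ)) σ := fun σ => by
      by_cases hσ : σ = ξ <;> simp [hσ]
    rw [lintegral_congr h2, lintegral_indicator_const hms, ENNReal.ofReal_mul hW.le]
    ring

/-- Conditional expectations given the spin at the root of a subtree. -/
theorem integral_cond_gibbs (hh : Integrable h (leb β)) (x : Vertex b) (n : ℕ)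
    (τ : Vertex b → Spin β) {ξ : Spin β} (hξ : 0 < (freeSpin β lam).real {ξ}) (z : subtree x n)
    {g : Spin β → ℝ} (hg : Tame g) :
    ∫ σ, g (σ z) ∂(ProbabilityTheory.cond (gibbs lam h (subtree x n) τ)
        {σ | σ (subtreeRoot x n) = ξ}) =
      chain lam (fun j => weight lam h τ (n - ((z : Vertex b).length - x.length) + j)
            ((z : Vertex b).drop j)) g ((z : Vertex b).length - x.length) ξ := by
  have := isProbabilityMeasure_gibbs (lam := lam) hh (subtree x n) τ
  obtain ⟨a, ha0, hat, ha⟩ := exists_setLIntegral_gibbs (lam := lam) hh x n τ hξ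
  have hw : ∀ j, IsWeight (weight lam h τ (n - ((z : Vertex b).length - x.length) + j)
      ((z : Vertex b).drop j)) := fun j => isWeight_weight hh _ _ _
  have hmass : gibbs lam h (subtree x n) τ {σ | σ (subtreeRoot x n) = ξ} = a := by
    have := ha (subtreeRoot x n) (fun _ => 1) (Tame.const 1) fun _ => zero_le_one
    simpa [chain, subtreeRoot] using this
  have hprob : IsProbabilityMeasure (ProbabilityTheory.cond (gibbs lam h (subtree x n) τ)
      {σ | σ (subtreeRoot x n) = ξ}) := ProbabilityTheory.cond_isProbabilityMeasure (by rwa [hmass])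
  have hint : ∀ f : Spin β → ℝ, Tame f → Integrable (fun σ : subtree x n → Spin β => f (σ z))
      (ProbabilityTheory.cond (gibbs lam h (subtree x n) τ)
        {σ | σ (subtreeRoot x n) = ξ}) := fun f hf => by
    obtain ⟨C, hC⟩ := hf.bdd
    exact Integrable.of_bound (hf.measurable.comp (measurable_pi_apply z)).aestronglyMeasurable C
      (Eventually.of_forall fun σ => hC _)
  -- adding a constant to `g`, one may assume that `g` is nonnegative
  obtain ⟨C, hC⟩ := hg.bdd
  have hgC : Tame fun σ => g σ - -C := hg.sub (Tame.const (-C))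
  have nC : (0 : Spin β → ℝ) ≤ fun σ => g σ - -C := fun σ =>
    sub_nonneg.2 (neg_le_of_abs_le (hC σ))
  have h1 : ∫ σ, (g (σ z) - -C) ∂(ProbabilityTheory.cond (gibbs lam h (subtree x n) τ)
        {σ | σ (subtreeRoot x n) = ξ}) = chain lam (fun j => weight lam h τ
          (n - ((z : Vertex b).length - x.length) + j) ((z : Vertex b).drop j))
            (fun σ => g σ - -C) ((z : Vertex b).length - x.length) ξ := by
    have h0 := integral_eq_lintegral_of_nonneg_ae (μ := ProbabilityTheory.cond
      (gibbs lam h (subtree x n) τ) {σ | σ (subtreeRoot x n) = ξ})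
      (f := fun σ : subtree x n → Spin β => g (σ z) - -C)
      (Eventually.of_forall fun σ => nC (σ z)) (hint _ hgC).1
    rw [h0, ProbabilityTheory.cond, lintegral_smul_measure, ha z _ hgC nC, hmass,
      smul_eq_mul, ← mul_assoc, ENNReal.inv_mul_cancel ha0 hat, one_mul,
      ENNReal.toReal_ofReal (chain_nonneg hw hgC nC _ ξ)]
  rw [chain_sub_const hw hg, integral_sub (hint g hg) (integrable_const _)] at h1
  simpa using h1

/-! ### Decay rates -/

/-- The total magnetization of a spin. -/
theorem tame_magnetization : Tame fun σ : Spin β => dot σ.1 (fun _ => 1) := by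
  simp_rw [dot_comm _ (fun _ => (1 : ℝ))]
  exact tame_dot_left (integrable_const 1)

theorem monotone_magnetization : Monotone fun σ : Spin β => dot σ.1 (fun _ => 1) :=
  fun σ σ' hσ => by
    simp only [dot, mul_one]
    exact integral_mono σ.integrable σ'.integrable hσ

theorem condMag_sub_condMag (hh : Integrable h (leb β)) (x : Vertex b) (n : ℕ)
    (τ : Vertex b → Spin β) (z : subtree x n) :
    condMag lam h (subtree x n) τ (subtreeRoot x n) z (Spin.plus β) -
        condMag lam h (subtree x n) τ (subtreeRoot x n) z (Spin.minus β) =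
      osc (chain lam (fun j => weight lam h τ (n - ((z : Vertex b).length - x.length) + j)
        ((z : Vertex b).drop j)) (fun σ => dot σ.1 (fun _ => 1))
          ((z : Vertex b).length - x.length)) := by
  rw [condMag, condMag, integral_cond_gibbs (lam := lam) (ξ := Spin.plus β) hh x n τ
      (freeSpin_const_pos 1) z tame_magnetization,
    integral_cond_gibbs (lam := lam) (ξ := Spin.minus β) hh x n τ
      (freeSpin_const_pos (-1)) z tame_magnetization, osc]

theorem kappa_le_inv (hb : 2 ≤ b) (hh : Integrable h (leb β)) (τ : Vertex b → Spin β)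
    (hclose : ∀ η > 0, ∃ M, ∀ n, M ≤ n → ∀ x, Close η (weight lam h τ n x) (plusWeight b lam h n)) :
    kappa lam h τ ≤ (b : ℝ≥0∞)⁻¹ := by
  refine le_of_forall_gt_imp_ge_of_dense fun c hc => ?_
  obtain ⟨k, hk, hkc⟩ := ENNReal.lt_iff_exists_nnreal_btwn.1 hc
  refine le_trans (iInf₂_le k ?_) hkc.le
  have hkb : (b : ℝ)⁻¹ < k := by
    have h1 : ((b : ℝ≥0)⁻¹ : ℝ≥0) < k := by
      have hb0 : (b : ℝ≥0) ≠ 0 := by exact_mod_cast (by omega : b ≠ 0)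
      rw [← ENNReal.coe_lt_coe, ENNReal.coe_inv hb0]
      simpa using hk
    exact_mod_cast h1
  obtain ⟨l₀, hl₀⟩ := exists_osc_chain_le_pow (lam := lam) hb hh
    (fun n => range (weight lam h τ n)) (by
      rintro n _ ⟨x, rfl⟩
      exact ⟨isWeight_weight hh _ _ _, holleyLE_weight hh le_rfl _ _⟩) (fun η hη => by
      obtain ⟨M, hM⟩ := hclose η hη
      refine ⟨M, ?_⟩
      rintro n hn _ ⟨x, rfl⟩
      exact hM n hn x) tame_magnetization monotone_magnetization hkb
  refine ⟨l₀, fun x n z hz => ?_⟩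
  rw [condMag_sub_condMag hh]
  exact hl₀ _ _ _ hz fun j => mem_range_self _

/-! ### Uniqueness -/

/-- The root marginal gives mass proportional to the weight of the root to the constant spins. -/
theorem marginal_root_mul_integral (hh : Integrable h (leb β)) (n : ℕ) (τ : Vertex b → Spin β)
    (ξ : Spin β) :
    (marginal lam h (subtree [] n) τ (subtreeRoot [] n)).real {ξ} *
        ∫ σ, weight lam h τ n [] σ ∂(freeSpin β lam) =
      weight lam h τ n [] ξ * (freeSpin β lam).real {ξ} := by
  have hprob := isProbabilityMeasure_gibbs (lam := lam) hh (subtree ([] : Vertex b) n) τ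
  have hW := isWeight_weight (lam := lam) hh τ n []
  have hms := measurableSet_singleton_spin ξ
  have hZ := integral_exp_pos (integrable_exp_energy (lam := lam) hh (subtree ([] : Vertex b) n) τ)
  set Z := ENNReal.ofReal (∫ σ, Real.exp (energy h (subtree ([] : Vertex b) n) τ σ)
      ∂(Measure.pi fun _ : subtree ([] : Vertex b) n => freeSpin β lam)) with hZdef
  have key : ∀ u : Spin β → ℝ≥0∞, Measurable u →
      ∫⁻ σ, u (σ (subtreeRoot [] n)) ∂(gibbs lam h (subtree ([] : Vertex b) n) τ) =
        Z⁻¹ * ∫⁻ σ, u σ * ENNReal.ofReal (weight lam h τ n [] σ) ∂(freeSpin β lam) := fun u hu => by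
    have h1 := lintegral_exp_energy_subtree (lam := lam) hh ([] : Vertex b) n (subtreeRoot [] n) τ
      hu (Tame.const 1) fun _ => zero_le_one
    rw [lintegral_gibbs hh]
    simpa [parent, chain, subtreeRoot] using congrArg (Z⁻¹ * ·) h1
  have htotal : Z⁻¹ * ENNReal.ofReal (∫ σ, weight lam h τ n [] σ ∂(freeSpin β lam)) = 1 := by
    have := key (fun _ => 1) measurable_const
    simp only [lintegral_one, measure_univ, one_mul] at this
    rw [ofReal_integral_eq_lintegral_ofReal hW.tame.integrable
      (Eventually.of_forall fun σ => (hW.pos σ).le), this]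
  have hpoint : marginal lam h (subtree [] n) τ (subtreeRoot [] n) {ξ} =
      Z⁻¹ * (ENNReal.ofReal (weight lam h τ n [] ξ) * freeSpin β lam {ξ}) := by
    have h1 := key _ (measurable_const.indicator hms : Measurable
      (({ξ} : Set (Spin β)).indicator fun _ => (1 : ℝ≥0∞)))
    have h2 : ∀ σ : Spin β, ({ξ} : Set (Spin β)).indicator (fun _ => (1 : ℝ≥0∞)) σ *
        ENNReal.ofReal (weight lam h τ n [] σ) = ({ξ} : Set (Spin β)).indicator (fun _ =>
          ENNReal.ofReal (weight lam h τ n [] ξ)) σ := fun σ => by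
      by_cases hσ : σ = ξ <;> simp [hσ]
    rw [lintegral_congr h2, lintegral_indicator_const hms,
      ← lintegral_map (μ := gibbs lam h (subtree ([] : Vertex b) n) τ)
        (f := ({ξ} : Set (Spin β)).indicator fun _ => (1 : ℝ≥0∞))
        (measurable_const.indicator hms) (measurable_pi_apply (subtreeRoot [] n)),
      lintegral_indicator_const hms, one_mul] at h1
    exact h1
  have hpos : 0 < ∫ σ, weight lam h τ n [] σ ∂(freeSpin β lam) := by
    by_contra hcon
    rw [ENNReal.ofReal_of_nonpos (not_lt.1 hcon), mul_zero] at htotal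
    exact zero_ne_one htotal
  rw [Measure.real, hpoint, ← ENNReal.toReal_ofReal hpos.le, ← ENNReal.toReal_mul,
    mul_right_comm, htotal, one_mul, ENNReal.toReal_mul, ENNReal.toReal_ofReal (hW.pos ξ).le]
  rfl

/-- Under uniqueness, the weights with plus and with minus boundary conditions merge. -/
theorem InUniquenessRegion.exists_weight_mul_le (hu : InUniquenessRegion b lam h)
    (hh : Integrable h (leb β)) {η : ℝ} (hη : 0 < η) :
    ∃ M, ∀ n, M ≤ n →
      weight lam h (fun _ : Vertex b => Spin.plus β) n [] (Spin.plus β) *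
          weight lam h (fun _ : Vertex b => Spin.minus β) n [] (Spin.minus β) ≤
        Real.exp η * (weight lam h (fun _ : Vertex b => Spin.plus β) n [] (Spin.minus β) *
          weight lam h (fun _ : Vertex b => Spin.minus β) n [] (Spin.plus β)) := by
  set D := Real.exp (2 * (∫ t, |h t| ∂(leb β)) + b * (2 * β)) with hD
  have hD0 : 0 < D := Real.exp_pos _
  set φp := (freeSpin β lam).real {Spin.plus β}
  set φm := (freeSpin β lam).real {Spin.minus β}
  have hφp : 0 < φp := freeSpin_const_pos 1
  have hφm : 0 < φm := freeSpin_const_pos (-1)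
  -- a lower bound for the masses of the constant spins
  set c := min φp φm / D with hc
  have hc0 : 0 < c := div_pos (lt_min hφp hφm) hD0
  have hlow : ∀ (τ : Vertex b → Spin β) (n : ℕ) (ξ : Spin β),
      min φp φm ≤ (freeSpin β lam).real {ξ} → 0 < ∫ σ, weight lam h τ n [] σ ∂(freeSpin β lam) ∧
        c ≤ (marginal lam h (subtree [] n) τ (subtreeRoot [] n)).real {ξ} := fun τ n ξ hξ => by
    have hW := isWeight_weight (lam := lam) hh τ n []
    have h1 := marginal_root_mul_integral (lam := lam) hh n τ ξ
    have h2 : ∫ σ, weight lam h τ n [] σ ∂(freeSpin β lam) ≤ D * weight lam h τ n [] ξ := by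
      have := integral_mono (μ := freeSpin β lam) hW.tame.integrable (integrable_const
        (D * weight lam h τ n [] ξ)) fun σ => weight_le_mul_weight hh τ n [] σ ξ
      simpa using this
    have hφ : 0 < (freeSpin β lam).real {ξ} := (lt_min hφp hφm).trans_le hξ
    have h3 : 0 < weight lam h τ n [] ξ * (freeSpin β lam).real {ξ} := mul_pos (hW.pos ξ) hφ
    have h0 : 0 ≤ ∫ σ, weight lam h τ n [] σ ∂(freeSpin β lam) :=
      integral_nonneg fun σ => (hW.pos σ).le
    have hpos : 0 < ∫ σ, weight lam h τ n [] σ ∂(freeSpin β lam) := by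
      refine h0.lt_of_ne fun h4 => ?_
      rw [← h4, mul_zero] at h1
      linarith
    refine ⟨hpos, ?_⟩
    rw [hc, div_le_iff₀ hD0]
    refine hξ.trans (le_of_mul_le_mul_left ?_ (hW.pos ξ))
    rw [← h1]
    have := mul_le_mul_of_nonneg_left h2 (measureReal_nonneg
      (μ := marginal lam h (subtree [] n) τ (subtreeRoot [] n)) (s := {ξ}))
    linarith
  have hev := hu.eventually (gt_mem_nhds (ENNReal.ofReal_pos.2
    (show 0 < c * η / 2 by positivity)))
  obtain ⟨M, hM⟩ := eventually_atTop.1 hev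
  refine ⟨M, fun n hn => ?_⟩
  have htv : ∀ ξ : Spin β,
      |(marginal lam h (subtree ([] : Vertex b) n) (fun _ => Spin.plus β) (subtreeRoot [] n)).real
        {ξ} - (marginal lam h (subtree ([] : Vertex b) n) (fun _ => Spin.minus β)
          (subtreeRoot [] n)).real {ξ}| ≤ c * η / 2 := fun ξ => by
    have h1 := (le_iSup₂ (f := fun (s : Set (Spin β)) (_ : MeasurableSet s) => ENNReal.ofReal
      |(marginal lam h (subtree ([] : Vertex b) n) (fun _ => Spin.plus β) (subtreeRoot [] n)).real
        s - (marginal lam h (subtree ([] : Vertex b) n) (fun _ => Spin.minus β)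
          (subtreeRoot [] n)).real s|) {ξ} (measurableSet_singleton_spin ξ)).trans_lt (hM n hn)
    exact (ENNReal.ofReal_lt_ofReal_iff (by positivity)).1 h1 |>.le
  have e1 := marginal_root_mul_integral (lam := lam) hh n (fun _ : Vertex b => Spin.plus β)
    (Spin.plus β)
  have e2 := marginal_root_mul_integral (lam := lam) hh n (fun _ : Vertex b => Spin.plus β)
    (Spin.minus β)
  have e3 := marginal_root_mul_integral (lam := lam) hh n (fun _ : Vertex b => Spin.minus β)
    (Spin.plus β)
  have e4 := marginal_root_mul_integral (lam := lam) hh n (fun _ : Vertex b => Spin.minus β)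
    (Spin.minus β)
  obtain ⟨i1, -⟩ := hlow (fun _ => Spin.plus β) n (Spin.plus β) (min_le_left _ _)
  obtain ⟨-, l2⟩ := hlow (fun _ => Spin.plus β) n (Spin.minus β) (min_le_right _ _)
  obtain ⟨i2, l3⟩ := hlow (fun _ => Spin.minus β) n (Spin.plus β) (min_le_left _ _)
  have t1 := le_of_abs_le (htv (Spin.plus β))
  have t2 := neg_le_of_abs_le (htv (Spin.minus β))
  have l4 : 0 ≤ (marginal lam h (subtree ([] : Vertex b) n) (fun _ => Spin.minus β)
    (subtreeRoot [] n)).real {Spin.minus β} := measureReal_nonneg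
  generalize (marginal lam h (subtree ([] : Vertex b) n) (fun _ => Spin.plus β)
    (subtreeRoot [] n)).real {Spin.plus β} = ppp at *
  generalize (marginal lam h (subtree ([] : Vertex b) n) (fun _ => Spin.plus β)
    (subtreeRoot [] n)).real {Spin.minus β} = ppm at *
  generalize (marginal lam h (subtree ([] : Vertex b) n) (fun _ => Spin.minus β)
    (subtreeRoot [] n)).real {Spin.plus β} = pmp at *
  generalize (marginal lam h (subtree ([] : Vertex b) n) (fun _ => Spin.minus β)
    (subtreeRoot [] n)).real {Spin.minus β} = pmm at *
  -- the ratios of the masses are at most `1 + η / 2`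
  have r1 : ppp ≤ Real.exp (η / 2) * pmp := by
    have := Real.add_one_le_exp (η / 2)
    nlinarith
  have r2 : pmm ≤ Real.exp (η / 2) * ppm := by
    have := Real.add_one_le_exp (η / 2)
    nlinarith
  have r3 : ppp * pmm ≤ Real.exp η * (ppm * pmp) := by
    have h1 := mul_le_mul r1 r2 l4 (by nlinarith [Real.exp_pos (η / 2)])
    have h2 : Real.exp η = Real.exp (η / 2) * Real.exp (η / 2) := by
      rw [← Real.exp_add]; ring_nf
    rw [h2]
    linarith
  set Zp := ∫ σ, weight lam h (fun _ : Vertex b => Spin.plus β) n [] σ ∂(freeSpin β lam)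
  set Zm := ∫ σ, weight lam h (fun _ : Vertex b => Spin.minus β) n [] σ ∂(freeSpin β lam)
  have r4 := mul_le_mul_of_nonneg_right r3 (mul_pos i1 i2).le
  refine le_of_mul_le_mul_right ?_ (mul_pos hφp hφm)
  calc _ = (weight lam h (fun _ : Vertex b => Spin.plus β) n [] (Spin.plus β) * φp) *
        (weight lam h (fun _ : Vertex b => Spin.minus β) n [] (Spin.minus β) * φm) := by ring
    _ = (ppp * Zp) * (pmm * Zm) := by rw [e1, e4]
    _ ≤ Real.exp η * ((ppm * Zp) * (pmp * Zm)) := by linarith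
    _ = _ := by rw [e2, e3]; ring

/-- Under uniqueness, the weights with any boundary condition are close to those with plus boundary
conditions, because they lie between those with minus and with plus boundary conditions. -/
theorem InUniquenessRegion.exists_close (hu : InUniquenessRegion b lam h)
    (hh : Integrable h (leb β)) (τ : Vertex b → Spin β) {η : ℝ} (hη : 0 < η) :
    ∃ M, ∀ n, M ≤ n → ∀ x, Close η (weight lam h τ n x) (plusWeight b lam h n) := by
  obtain ⟨M, hM⟩ := hu.exists_weight_mul_le hh hη
  refine ⟨M, fun n hn x σ ξ => ?_⟩
  have h4 := hM n hn
  rw [weight_const_eq h (Spin.minus β) n [] x] at h4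
  have hpl : HolleyLE (weight lam h τ n x) (plusWeight b lam h n) := by
    rw [plusWeight, weight_const_eq h (Spin.plus β) n [] x]
    exact holleyLE_weight hh (fun v => (τ v).le_plus) n x
  have hmi := holleyLE_weight (lam := lam) hh (τ := fun _ => Spin.minus β) (τ' := τ)
    (fun v => (τ v).minus_le) n x
  change plusWeight b lam h n _ * _ ≤ _ * (plusWeight b lam h n _ * _) at h4
  have h1 := hpl.ratio ξ.le_plus
  have h2 := hpl.ratio σ.minus_le
  have h3 := hmi.ratio (Spin.minus_le (Spin.plus β))
  have pP := (isWeight_plusWeight (b := b) (lam := lam) hh n).pos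
  have pT := (isWeight_weight (lam := lam) hh τ n x).pos
  have pM := (isWeight_weight (lam := lam) hh (fun _ => Spin.minus β) n x).pos
  generalize plusWeight b lam h n = P at *
  generalize weight lam h τ n x = T at *
  generalize weight lam h (fun _ => Spin.minus β) n x = Q at *
  have h5 : T (Spin.minus β) * P (Spin.plus β) ≤
      Real.exp η * (T (Spin.plus β) * P (Spin.minus β)) := by
    have h6 := mul_le_mul h3 h4 (mul_pos (pP _) (pM _)).le (mul_pos (pM _) (pT _)).le
    refine le_of_mul_le_mul_left ?_ (mul_pos (pM (Spin.plus β)) (pM (Spin.minus β)))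
    linarith
  have h7 := mul_le_mul h1 h2 (mul_pos (pT _) (pP _)).le (mul_pos (pT _) (pP _)).le
  have h8 := mul_le_mul_of_nonneg_left h5 (mul_pos (pT ξ) (pP σ)).le
  refine le_of_mul_le_mul_left ?_ (mul_pos (pT (Spin.plus β)) (pP (Spin.minus β)))
  linarith

/-! ### The exponent `gamma` -/

theorem neighbors_symm {v w : Vertex b} (hvw : v ∈ neighbors w) : w ∈ neighbors v := by
  rcases Finset.mem_union.1 hvw with hc | hp
  · obtain ⟨i, -, rfl⟩ := Finset.mem_image.1 hc
    exact Finset.mem_union_right _ (Finset.mem_singleton_self w)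
  · cases w with
    | nil => simp [parent] at hp
    | cons j p =>
      rw [Finset.mem_singleton.1 hp]
      exact Finset.mem_union_left _ (Finset.mem_image_of_mem _ (Finset.mem_univ j))

theorem card_neighbors_le (v : Vertex b) : (neighbors v).card ≤ b + 1 := by
  refine (Finset.card_union_le _ _).trans (add_le_add ?_ ?_)
  · exact Finset.card_image_le.trans (by simp)
  · cases v <;> simp [parent]

/-- Changing the boundary condition at one vertex changes the energy by a bounded amount. -/
theorem energy_le_energy_add (hh : Integrable h (leb β)) (A : Finset (Vertex b)) {y : Vertex b}
    {η η' : Vertex b → Spin β} (hη : ∀ w, w ≠ y → η w = η' w) (σ : A → Spin β) :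
    energy h A η σ ≤ energy h A η' σ + (b + 1) * (2 * β) := by
  simp only [energy, dot_add_sum hh]
  rw [add_assoc, add_le_add_iff_left, ← sub_le_iff_le_add', ← Finset.sum_sub_distrib]
  have h1 : ∀ v : A, dot h (σ v).1 + ∑ w ∈ neighbors (v : Vertex b) \ A, dot (η w).1 (σ v).1 -
      (dot h (σ v).1 + ∑ w ∈ neighbors (v : Vertex b) \ A, dot (η' w).1 (σ v).1) ≤
      if (v : Vertex b) ∈ neighbors y then 2 * β else 0 := fun v => by
    rw [add_sub_add_left_eq_sub, ← Finset.sum_sub_distrib]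
    have h2 : ∀ w, w ≠ y → dot (η w).1 (σ v).1 - dot (η' w).1 (σ v).1 = 0 := fun w hw => by
      rw [hη w hw, sub_self]
    have hβ0 := hβ.out
    by_cases hy : y ∈ neighbors (v : Vertex b) \ A
    · rw [Finset.sum_eq_single_of_mem y hy fun w _ hw => h2 w hw,
        if_pos (neighbors_symm (Finset.mem_sdiff.1 hy).1)]
      linarith [le_of_abs_le (abs_dot_spin_le (η y) (σ v)),
        neg_le_of_abs_le (abs_dot_spin_le (η' y) (σ v))]
    · rw [Finset.sum_eq_zero fun w hw => h2 w fun hwy => hy (hwy ▸ hw)]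
      split_ifs <;> linarith
  refine (Finset.sum_le_sum fun v _ => h1 v).trans ?_
  rw [Finset.sum_coe_sort A fun v => if v ∈ neighbors y then 2 * β else 0, ← Finset.sum_filter,
    Finset.sum_const, nsmul_eq_mul]
  refine mul_le_mul_of_nonneg_right ?_ (by linarith [hβ.out])
  have h3 : (A.filter (· ∈ neighbors y)).card ≤ b + 1 :=
    (Finset.card_le_card fun v hv => (Finset.mem_filter.1 hv).2).trans (card_neighbors_le y)
  exact_mod_cast h3

/-- The factor `exp D` appears twice, for the density and for the normalization. -/
theorem gibbs_real_le (hh : Integrable h (leb β)) (A : Finset (Vertex b)) {η η' : Vertex b → Spin β}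
    {D : ℝ} (h1 : ∀ σ, energy h A η σ ≤ energy h A η' σ + D)
    (h2 : ∀ σ, energy h A η' σ ≤ energy h A η σ + D) {S : Set (A → Spin β)}
    (hS : MeasurableSet S) :
    (gibbs lam h A η).real S ≤ Real.exp (2 * D) * (gibbs lam h A η').real S := by
  have hexp : ∀ {ζ ζ' : Vertex b → Spin β}, (∀ σ, energy h A ζ σ ≤ energy h A ζ' σ + D) → ∀ σ,
      Real.exp (energy h A ζ σ) ≤ Real.exp D * Real.exp (energy h A ζ' σ) := fun hζ σ => by
    rw [← Real.exp_add, Real.exp_le_exp]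
    linarith [hζ σ]
  have hi := fun ζ : Vertex b → Spin β => integrable_exp_energy (lam := lam) hh A ζ
  have hZ := fun ζ : Vertex b → Spin β => integral_exp_pos (hi ζ)
  have hreal : ∀ ζ : Vertex b → Spin β, (gibbs lam h A ζ).real S =
      (∫ σ in S, Real.exp (energy h A ζ σ) ∂(Measure.pi fun _ : A => freeSpin β lam)) /
        ∫ σ, Real.exp (energy h A ζ σ) ∂(Measure.pi fun _ : A => freeSpin β lam) := fun ζ => by
    rw [Measure.real, gibbs, tilted_apply_eq_ofReal_integral' _ hS, ENNReal.toReal_ofReal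
      (integral_nonneg fun σ => div_nonneg (Real.exp_pos _).le (hZ ζ).le), integral_div]
  have h3 : (∫ σ in S, Real.exp (energy h A η σ) ∂(Measure.pi fun _ : A => freeSpin β lam)) ≤
      Real.exp D * ∫ σ in S, Real.exp (energy h A η' σ)
        ∂(Measure.pi fun _ : A => freeSpin β lam) := by
    rw [← integral_const_mul]
    exact integral_mono (hi η).integrableOn ((hi η').integrableOn.const_mul _) (hexp h1)
  have h4 : (∫ σ, Real.exp (energy h A η' σ) ∂(Measure.pi fun _ : A => freeSpin β lam)) ≤
      Real.exp D * ∫ σ, Real.exp (energy h A η σ) ∂(Measure.pi fun _ : A => freeSpin β lam) := by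
    rw [← integral_const_mul]
    exact integral_mono (hi η') ((hi η).const_mul _) (hexp h2)
  have h5 : 0 ≤ ∫ σ in S, Real.exp (energy h A η' σ)
      ∂(Measure.pi fun _ : A => freeSpin β lam) := integral_nonneg fun σ => (Real.exp_pos _).le
  rw [hreal, hreal, mul_div_assoc', div_le_div_iff₀ (hZ η) (hZ η'), two_mul, Real.exp_add]
  have h6 := mul_le_mul h3 h4 (hZ η').le (mul_nonneg (Real.exp_pos D).le h5)
  linarith

theorem gamma_lt_one (hh : Integrable h (leb β)) : gamma b lam h < 1 := by
  set D : ℝ := (b + 1) * (2 * β) with hD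
  have hlt : ENNReal.ofReal (1 - Real.exp (-(2 * D))) < 1 := by
    rw [← ENNReal.ofReal_one, ENNReal.ofReal_lt_ofReal_iff one_pos]
    linarith [Real.exp_pos (-(2 * D))]
  refine lt_of_le_of_lt ?_ hlt
  refine iSup_le fun l => iSup_le fun A => iSup_le fun _ => iSup_le fun y => iSup_le fun _ =>
    iSup_le fun z => iSup_le fun _ => iSup_le fun η => iSup_le fun η' => iSup_le fun hη =>
    iSup_le fun s => iSup_le fun hs => ENNReal.ofReal_le_ofReal ?_
  have hz := measurable_pi_apply (X := fun _ : A => Spin β) z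
  have hreal : ∀ ζ : Vertex b → Spin β, (marginal lam h A ζ z).real s =
      (gibbs lam h A ζ).real ((fun σ => σ z) ⁻¹' s) := fun ζ => by
    rw [marginal, map_measureReal_apply hz hs]
  have h1 : ∀ ζ : Vertex b → Spin β, (marginal lam h A ζ z).real s ≤ 1 := fun ζ => by
    have := isProbabilityMeasure_gibbs (lam := lam) hh A ζ
    rw [hreal]
    exact measureReal_le_one
  have h2 := gibbs_real_le (lam := lam) hh A (energy_le_energy_add hh A hη)
    (energy_le_energy_add hh A fun w hw => (hη w hw).symm) (hz hs)
  have h3 := gibbs_real_le (lam := lam) hh A (energy_le_energy_add hh A fun w hw => (hη w hw).symm)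
    (energy_le_energy_add hh A hη) (hz hs)
  rw [← hreal, ← hreal, ← hD] at h2 h3
  have h4 := h1 η
  have h5 := h1 η'
  have h6 : 0 ≤ 1 - Real.exp (-(2 * D)) := by
    have hβ0 := hβ.out
    rw [sub_nonneg, Real.exp_le_one_iff, hD]
    have : 0 ≤ ((b : ℝ) + 1) * (2 * β) := by positivity
    linarith
  have h7 : Real.exp (-(2 * D)) * Real.exp (2 * D) = 1 := by
    rw [← Real.exp_add]; simp
  have h8 := mul_le_mul_of_nonneg_left h2 (Real.exp_pos (-(2 * D))).le
  have h9 := mul_le_mul_of_nonneg_left h3 (Real.exp_pos (-(2 * D))).le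
  rw [← mul_assoc (Real.exp (-(2 * D))), h7, one_mul] at h8 h9
  have h10 := mul_le_mul_of_nonneg_left h4 h6
  have h11 := mul_le_mul_of_nonneg_left h5 h6
  rw [abs_le]
  constructor <;> linarith

theorem kappa_mul_gamma_mul_lt_one (hb : 2 ≤ b) (hh : Integrable h (leb β))
    {τ : Vertex b → Spin β} (hτ : kappa lam h τ ≤ (b : ℝ≥0∞)⁻¹) :
    kappa lam h τ * gamma b lam h * (b : ℝ≥0∞) < 1 := by
  have hb0 : (b : ℝ≥0∞) ≠ 0 := by exact_mod_cast (by omega : b ≠ 0)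
  calc kappa lam h τ * gamma b lam h * (b : ℝ≥0∞)
      ≤ (b : ℝ≥0∞)⁻¹ * gamma b lam h * (b : ℝ≥0∞) := by gcongr
    _ = gamma b lam h := by
      rw [mul_right_comm, ENNReal.inv_mul_cancel hb0 (ENNReal.natCast_ne_top b), one_mul]
    _ < 1 := gamma_lt_one hh

end Gibbs

end QuantumIsing

end

theorem theorem5p1 (b : ℕ) (hb : 2 ≤ b) (β lam : ℝ) (hβ : 0 ≤ β) (hlam : 0 ≤ lam)
    (h : Set.Icc (0 : ℝ) β → ℝ) (hh : MeasureTheory.Integrable h (QuantumIsing.leb β)) :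
    (QuantumIsing.kappa (b := b) lam h (fun _ => QuantumIsing.Spin.plus β) ≤ (b : ENNReal)⁻¹ ∧
      (QuantumIsing.InUniquenessRegion b lam h →
        ∀ τ : QuantumIsing.Vertex b → QuantumIsing.Spin β,
          QuantumIsing.kappa lam h τ ≤ (b : ENNReal)⁻¹)) ∧
    (QuantumIsing.kappa (b := b) lam h (fun _ => QuantumIsing.Spin.plus β) *
        QuantumIsing.gamma b lam h * (b : ENNReal) < 1 ∧
      (QuantumIsing.InUniquenessRegion b lam h →
        ∀ τ : QuantumIsing.Vertex b → QuantumIsing.Spin β,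
          QuantumIsing.kappa lam h τ * QuantumIsing.gamma b lam h * (b : ENNReal) < 1)) := by
  have : Fact (0 ≤ β) := ⟨hβ⟩
  have : Fact (0 ≤ lam) := ⟨hlam⟩
  have hplus : QuantumIsing.kappa (b := b) lam h (fun _ => QuantumIsing.Spin.plus β) ≤
      (b : ENNReal)⁻¹ := by
    refine QuantumIsing.kappa_le_inv hb hh _ fun η hη => ⟨0, fun n _ x σ ξ => ?_⟩
    rw [QuantumIsing.plusWeight, QuantumIsing.weight_const_eq h _ n x [], mul_comm]
    have hW := (QuantumIsing.isWeight_weight (b := b) (lam := lam) hh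
      (fun _ => QuantumIsing.Spin.plus β) n []).pos
    exact le_mul_of_one_le_left (mul_pos (hW ξ) (hW σ)).le (Real.one_le_exp hη.le)
  have huniq : QuantumIsing.InUniquenessRegion b lam h →
      ∀ τ : QuantumIsing.Vertex b → QuantumIsing.Spin β,
        QuantumIsing.kappa lam h τ ≤ (b : ENNReal)⁻¹ := fun hu τ =>
    QuantumIsing.kappa_le_inv hb hh τ fun η hη => hu.exists_close hh τ hη
  exact ⟨⟨hplus, huniq⟩, QuantumIsing.kappa_mul_gamma_mul_lt_one hb hh hplus, fun hu τ =>
    QuantumIsing.kappa_mul_gamma_mul_lt_one hb hh (huniq hu τ)⟩
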